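/- Let $(X_i,T_i,Y_i(0),Y_i(1))$, $i\ge1$, be i.i.d. copies of $(X,T,Y(0),Y(1))$, where $X\in\mathbb R^p$, $T\in\{0,1\}$, and $Y(0),Y(1)$ are real with finite second moments; $Y_i=Y_i(T_i)$ is observed. Put $\tau=E\{Y(1)-Y(0)\}$, $\mu_t=E\{Y(t)\}$, $\pi_1(X)=\pi(X)=\Pr(T=1\mid X)$, $\pi_0=1-\pi$. Let $\Phi=(\phi_1,\dots,\phi_K)^\top$ be measurable basis functions on $\mathbb R^p$, $\bar\Phi=n^{-1}\sum_{i\le n}\Phi(X_i)$, $W=(W^{1/2})^\top W^{1/2}$ a fixed positive-definite $K\times K$ matrix, and $\delta=\delta_n\ge0$. Let the loss $f$ be strictly convex and twice continuously differentiable on $(0,\infty)$, let $\tilde f=f$ on $[0,\infty)$ (with $f(0)\in(-\infty,\infty]$ compatible with convexity) and $\tilde f=+\infty$ on $(-\infty,0)$, and let $\tilde f^*(y)=\sup_p\{py-\tilde f(p)\}$; its derivative $\tilde f^{*\prime}$ is the inverse $(\tilde f')^{-1}$ of $\tilde f'$. For each arm $t\in\{0,1\}$ let $\hat\theta_t$ be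 a measurable function of $(X_i,T_i)_{i\le n}$ that minimizes $$\sum_{i\le n:\,T_i=t}\tilde f^*\big(\theta^\top W^{1/2}(\Phi(X_i)-\bar\Phi)\big)+\sqrt{\delta}\,\|\theta\|_2$$ over $\theta\in\mathbb R^K$ whenever a minimizer exists. Put $\hat w_i=\tilde f^{*\prime}\big(\hat\theta_{T_i}^\top W^{1/2}(\Phi(X_i)-\bar\Phi)\big)$, $\hat w_i^{MB}=\hat w_i/\sum_{j\le n:\,T_j=T_i}\hat w_j$, $\hat\mu_t^{MB}=\sum_{i\le n:\,T_i=t}\hat w_i^{MB}Y_i$ and $\hat\tau^{MB}=\hat\mu_1^{MB}-\hat\mu_0^{MB}$. Assume: 1. (strong ignorability) $\{Y(0),Y(1)\}\perp T\mid X$; 2. (overlap) $0<\pi(X)<1$, and in fact $\eta\le\pi(X)\le1-\eta$ almost surely for some $0<\eta<1/2$; 3. (a) there is a compact $\Theta\subset\mathbb R^K$ such that for $t=0,1$ the function $\theta\mapsto E\big[1\{T=t\}\,\tilde f^*\big(\theta^\top W^{1/2}(\Phi(X)-E\{\Phi(X)\})\big)\big]$ has a unique minimizer over $\Theta$, and it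 lies in the interior of $\Theta$; (b) $\delta=o(n)$; (c) $E\exp\big(a\,\theta^\top W^{1/2}[\Phi(X)-E\{\Phi(X)\mid T=t\}]\big)<\infty$ for all $\theta\in\Theta$, $t=0,1$, $a=1,2,3$, and $\Phi(X)$ has finite variance, unconditionally and given $T=t$; (d) the noises $\epsilon_t=Y(t)-E\{Y(t)\mid X\}$, $t=0,1$, are mutually independent, sub-Gaussian, and independent of $X$. Then the estimator $\hat\tau^{MB}$ is doubly robust in the following sense. (i) Suppose that $f''>0$ on $(0,\infty)$. If for an arm $t$ there are a constant $C$ and a $\theta\in\mathbb R^K$ with $$1/\pi_t(X)=C\,\tilde f^{*\prime}\big(\theta^\top W^{1/2}(\Phi(X)-E\{\Phi(X)\})\big)\quad\text{almost surely},$$ then $\hat\mu_t^{MB}-\mu_t=O_p(n^{-1/2})$. If this holds for both arms (each with its own $C$ and $\theta$), then $\hat\tau^{MB}-\tau=O_p(n^{-1/2})$. (ii) If $E\{Y(1)\mid X\}$ and $E\{Y(0)\mid X\}$ are linear combinations of $\phi_1(X),\dots,\phi_K(X)$, then $\hat\tau^{MB}-\tau=O_p(n^{-1/2})$ when at least one of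 the following holds: (a) $f(x)=x\log x$; (b) with probability tending to one $\sum_{i\le n:\,T_i=t}\hat w_i>0$ for $t=0,1$ (so that the normalized weights are well defined), and, for $t=0,1$, $$\frac{\sum_{i\le n:\,T_i=t}(\hat w_i^{MB})^3}{\big(\sum_{i\le n:\,T_i=t}(\hat w_i^{MB})^2\big)^{3/2}}=o_p(1),\qquad \sum_{i\le n}(\hat w_i^{MB})^2=O_p(n^{-1}),\qquad v_t^\top W v_t=O_p(n^{-1}),$$ where $v_t=\sum_{i\le n:\,T_i=t}\hat w_i^{MB}(\Phi(X_i)-\bar\Phi)$. -/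

import Mathlib

open MeasureTheory ProbabilityTheory Filter Topology Set Asymptotics
open scoped ENNReal NNReal

noncomputable section

namespace MahalanobisBalancing

/-! ### The loss function and its conjugate -/

/-- The convex conjugate `f̃*(y) = sup_p (p y - f̃(p))` of the loss `f`, with values in `[-∞, ∞]`,
where `f̃ = f` on `[0, ∞)` and `f̃ = +∞` on `(-∞, 0)`.
Losses are finite convex functions on `(0, ∞)`. By convexity the value `f(0) ∈ (-∞, ∞]` is at least
the limit of `f` at `0+`, so the supremum may be taken over `p > 0` only; this also covers losses
such as `-log` with `f(0) = +∞`. -/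
def conj (f : ℝ → ℝ) (y : ℝ) : EReal :=
  ⨆ p ∈ Ioi (0 : ℝ), ((p * y - f p : ℝ) : EReal)

/-- The derivative `f̃*'` of the conjugate. It is the inverse function `(f̃')⁻¹` of the
derivative of the loss on the range of `f'`, and `0` below that range (when `f'(0+)` is finite). -/
def conjDeriv (f : ℝ → ℝ) (y : ℝ) : ℝ :=
  deriv (fun u => (conj f u).toReal) y

/-- The entropy function `x log x`. -/
def IsEntropy (f : ℝ → ℝ) : Prop := ∀ x, 0 < x → f x = x * Real.log x

/-- Expectation of an extended-real random variable, as the difference of the expectations of its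
positive and negative parts. -/
def eexpect {Ω : Type*} [MeasurableSpace Ω] (P : Measure Ω) (g : Ω → EReal) : EReal :=
  ((∫⁻ ω, (g ω).toENNReal ∂P : ℝ≥0∞) : EReal) - ((∫⁻ ω, (-g ω).toENNReal ∂P : ℝ≥0∞) : EReal)

/-! ### Mahalanobis balancing for a data set `(x i, s i)`, `i < n`

`x i` are the covariates, `s i` is the treatment (`true` is treated, `false` is control),
`Φ` is the vector of basis functions and `R = W^{1/2}` is a factor of the weight
matrix, `W = Rᵀ R`. The treatment arm is denoted `t`. -/

section Data

variable {p K n : ℕ}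

/-- The pooled sample mean of the basis functions. -/
def basisMean (Φ : EuclideanSpace ℝ (Fin p) → EuclideanSpace ℝ (Fin K))
    (x : Fin n → EuclideanSpace ℝ (Fin p)) : EuclideanSpace ℝ (Fin K) :=
  (n : ℝ)⁻¹ • ∑ i, Φ (x i)

/-- `θᵀ R v`. -/
def score (R : Matrix (Fin K) (Fin K) ℝ) (θ v : EuclideanSpace ℝ (Fin K)) : ℝ :=
  inner ℝ θ (Matrix.toEuclideanLin R v)

/-- The objective function of the dual problem of arm `t`,
`∑_{i : s i = t} f̃*(θᵀ R (Φ(x i) - Φ̄)) + √δ ‖θ‖₂`. -/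
def dualObj (f : ℝ → ℝ) (Φ : EuclideanSpace ℝ (Fin p) → EuclideanSpace ℝ (Fin K))
    (R : Matrix (Fin K) (Fin K) ℝ) (δ : ℝ) (t : Bool)
    (x : Fin n → EuclideanSpace ℝ (Fin p)) (s : Fin n → Bool)
    (θ : EuclideanSpace ℝ (Fin K)) : EReal :=
  (∑ i, if s i = t then conj f (score R θ (Φ (x i) - basisMean Φ x)) else 0)
    + ((Real.sqrt δ * ‖θ‖ : ℝ) : EReal)

/-- A (measurable) solver of the dual problems of both arms, for sample size `n`: it returns a
minimizer over `ℝ^K` whenever there is one. -/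
structure IsDualSolver (f : ℝ → ℝ) (Φ : EuclideanSpace ℝ (Fin p) → EuclideanSpace ℝ (Fin K))
    (R : Matrix (Fin K) (Fin K) ℝ) (δ : ℝ)
    (θhat : Bool → (Fin n → EuclideanSpace ℝ (Fin p)) → (Fin n → Bool) →
      EuclideanSpace ℝ (Fin K)) : Prop where
  measurable : ∀ t, Measurable
    (fun d : (Fin n → EuclideanSpace ℝ (Fin p)) × (Fin n → Bool) => θhat t d.1 d.2)
  isMinOn : ∀ t x s, (∃ θ, IsMinOn (dualObj f Φ R δ t x s) univ θ) →
    IsMinOn (dualObj f Φ R δ t x s) univ (θhat t x s)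

/-- The unnormalized weights `ŵ_i = f̃*'(θ̂ᵀ R (Φ(x i) - Φ̄))`, where `θ̂` is the dual solution of the
arm to which unit `i` belongs. -/
def rawWeight (f : ℝ → ℝ) (Φ : EuclideanSpace ℝ (Fin p) → EuclideanSpace ℝ (Fin K))
    (R : Matrix (Fin K) (Fin K) ℝ)
    (θhat : Bool → (Fin n → EuclideanSpace ℝ (Fin p)) → (Fin n → Bool) →
      EuclideanSpace ℝ (Fin K))
    (x : Fin n → EuclideanSpace ℝ (Fin p)) (s : Fin n → Bool) (i : Fin n) : ℝ :=
  conjDeriv f (score R (θhat (s i) x s) (Φ (x i) - basisMean Φ x))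

/-- The sum of the weights `w` over arm `t`. -/
def armSum (s : Fin n → Bool) (t : Bool) (w : Fin n → ℝ) : ℝ :=
  ∑ i, if s i = t then w i else 0

/-- The MB weights: the weights `ŵ_i`, normalized within each arm. -/
def mbWeight (f : ℝ → ℝ) (Φ : EuclideanSpace ℝ (Fin p) → EuclideanSpace ℝ (Fin K))
    (R : Matrix (Fin K) (Fin K) ℝ)
    (θhat : Bool → (Fin n → EuclideanSpace ℝ (Fin p)) → (Fin n → Bool) →
      EuclideanSpace ℝ (Fin K))
    (x : Fin n → EuclideanSpace ℝ (Fin p)) (s : Fin n → Bool) (i : Fin n) : ℝ :=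
  rawWeight f Φ R θhat x s i / armSum s (s i) (rawWeight f Φ R θhat x s)

/-- The multivariate imbalance `vᵀ W v`, `v = ∑_{i : s i = t} w_i (Φ(x i) - Φ̄)`, of the weights `w`
in arm `t`. -/
def imbalance (Φ : EuclideanSpace ℝ (Fin p) → EuclideanSpace ℝ (Fin K))
    (W : Matrix (Fin K) (Fin K) ℝ) (x : Fin n → EuclideanSpace ℝ (Fin p)) (s : Fin n → Bool)
    (t : Bool) (w : Fin n → ℝ) : ℝ :=
  score W (∑ i, if s i = t then w i • (Φ (x i) - basisMean Φ x) else 0)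
    (∑ i, if s i = t then w i • (Φ (x i) - basisMean Φ x) else 0)

end Data

/-! ### Stochastic orders -/

/-- `Z n = O_p(r n)`. -/
def IsBigOP {Ω : Type*} [MeasurableSpace Ω] (P : Measure Ω) (Z : ℕ → Ω → ℝ) (r : ℕ → ℝ) : Prop :=
  ∀ ε : ℝ, 0 < ε → ∃ M : ℝ, ∀ᶠ n in atTop, P {ω | M * r n < |Z n ω|} ≤ ENNReal.ofReal ε

/-- `Z n = o_p(1)`. -/
def IsLittleOPOne {Ω : Type*} [MeasurableSpace Ω] (P : Measure Ω) (Z : ℕ → Ω → ℝ) : Prop :=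
  TendstoInMeasure P Z atTop (fun _ => 0)

/-! ### The population: covariates `X`, treatment `T`, potential outcomes `Y ω t` -/

section Population

variable {Ω : Type*} [MeasurableSpace Ω] {p K : ℕ}

/-- The `σ`-algebra generated by the covariates. -/
@[reducible]
def sigmaX (X : Ω → EuclideanSpace ℝ (Fin p)) : MeasurableSpace Ω :=
  MeasurableSpace.comap X inferInstance

/-- `Pr(T = t ∣ X)`; for `t = true` this is the propensity score `π(X)`, and for `t = false` it is
`1 - π(X)`. -/
def propensity (P : Measure Ω) (X : Ω → EuclideanSpace ℝ (Fin p)) (T : Ω → Bool) (t : Bool) :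
    Ω → ℝ :=
  P⟦T ⁻¹' {t} | sigmaX X⟧

/-- `μ_t(X) = E{Y(t) ∣ X}`. -/
def outcomeReg (P : Measure Ω) (X : Ω → EuclideanSpace ℝ (Fin p)) (Y : Ω → Bool → ℝ) (t : Bool) :
    Ω → ℝ :=
  P[fun ω => Y ω t | sigmaX X]

/-- The noise `ε_t = Y(t) - E{Y(t) ∣ X}`. -/
def noise (P : Measure Ω) (X : Ω → EuclideanSpace ℝ (Fin p)) (Y : Ω → Bool → ℝ) (t : Bool) :
    Ω → ℝ :=
  fun ω => Y ω t - outcomeReg P X Y t ω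

/-- Strong ignorability: `{Y(0), Y(1)} ⊥ T ∣ X`. -/
def StrongIgnorability (P : Measure Ω) (X : Ω → EuclideanSpace ℝ (Fin p)) (T : Ω → Bool)
    (Y : Ω → Bool → ℝ) : Prop :=
  ∀ (A : Set (Bool → ℝ)) (B : Set Bool), MeasurableSet A → MeasurableSet B →
    P⟦Y ⁻¹' A ∩ T ⁻¹' B | sigmaX X⟧ =ᵐ[P]
      fun ω => (P⟦Y ⁻¹' A | sigmaX X⟧) ω * (P⟦T ⁻¹' B | sigmaX X⟧) ω

/-- Overlap: `0 < π(X) < 1`. -/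
def Overlap (P : Measure Ω) (X : Ω → EuclideanSpace ℝ (Fin p)) (T : Ω → Bool) : Prop :=
  ∀ᵐ ω ∂P, 0 < propensity P X T true ω ∧ propensity P X T true ω < 1

/-- `Φ(X) - E{Φ(X)}`. -/
def centered (P : Measure Ω) (X : Ω → EuclideanSpace ℝ (Fin p))
    (Φ : EuclideanSpace ℝ (Fin p) → EuclideanSpace ℝ (Fin K)) (ω : Ω) : EuclideanSpace ℝ (Fin K) :=
  Φ (X ω) - ∫ ω', Φ (X ω') ∂P

/-- The population dual objective `E[1{T = t} f̃*(θᵀ R (Φ(X) - E{Φ(X)}))]` of arm `t`. -/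
def popDualObj (P : Measure Ω) (X : Ω → EuclideanSpace ℝ (Fin p)) (T : Ω → Bool) (f : ℝ → ℝ)
    (Φ : EuclideanSpace ℝ (Fin p) → EuclideanSpace ℝ (Fin K)) (R : Matrix (Fin K) (Fin K) ℝ)
    (t : Bool) (θ : EuclideanSpace ℝ (Fin K)) : EReal :=
  eexpect P (fun ω => if T ω = t then conj f (score R θ (centered P X Φ ω)) else 0)

/-- The regularity conditions on the population, the loss, the basis functions, the thresholds
`δ n` and the parameter space `Θ`. -/
structure Regularity (P : Measure Ω) (X : Ω → EuclideanSpace ℝ (Fin p)) (T : Ω → Bool)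
    (Y : Ω → Bool → ℝ) (f : ℝ → ℝ)
    (Φ : EuclideanSpace ℝ (Fin p) → EuclideanSpace ℝ (Fin K)) (R : Matrix (Fin K) (Fin K) ℝ)
    (δ : ℕ → ℝ) (Θ : Set (EuclideanSpace ℝ (Fin K))) : Prop where
  /-- The parameter space is compact. -/
  isCompact : IsCompact Θ
  /-- The population dual problem of each arm has a unique minimizer over `Θ`, and it is an
  interior point. -/
  unique_min : ∀ t, ∃ θ₀ ∈ interior Θ, ∀ θ ∈ Θ, θ ≠ θ₀ →
    popDualObj P X T f Φ R t θ₀ < popDualObj P X T f Φ R t θ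
  delta_nonneg : ∀ n, 0 ≤ δ n
  /-- `δ = o(n)`. -/
  delta_isLittleO : δ =o[atTop] (fun n : ℕ => (n : ℝ))
  /-- The loss is strictly convex, so that its derivative is invertible. -/
  strictConvexOn : StrictConvexOn ℝ (Ioi 0) f
  /-- The loss is twice continuously differentiable. -/
  contDiffOn : ContDiffOn ℝ 2 f (Ioi 0)
  /-- `E exp(a θᵀ R [Φ(X) - E{Φ(X) ∣ T = t}]) < ∞` for `a = 1, 2, 3`. -/
  exp_moment : ∀ a ∈ ({1, 2, 3} : Set ℝ), ∀ θ ∈ Θ, ∀ t, Integrable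
    (fun ω => Real.exp (a * score R θ (Φ (X ω) - ∫ ω', Φ (X ω') ∂(P[|T ⁻¹' {t}])))) P
  /-- `Var(Φ(X)) < ∞`. -/
  basis_memLp : MemLp (fun ω => Φ (X ω)) 2 P
  /-- `Var(Φ(X) ∣ T = t) < ∞`. -/
  basis_memLp_cond : ∀ t, MemLp (fun ω => Φ (X ω)) 2 (P[|T ⁻¹' {t}])
  /-- The potential outcomes have finite variance. -/
  outcome_memLp : ∀ t, MemLp (fun ω => Y ω t) 2 P
  /-- The two noises are independent of each other (for different subjects the noises are
  independent because the subjects are). -/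
  noise_indep : IndepFun (noise P X Y false) (noise P X Y true) P
  /-- The noises are independent of the covariates. -/
  noise_indep_cov : IndepFun (fun ω t => noise P X Y t ω) X P
  /-- The noises are sub-Gaussian. -/
  noise_subgaussian : ∀ t, ∃ c : ℝ≥0, HasSubgaussianMGF (noise P X Y t) c P
  /-- Strict overlap. -/
  strict_overlap : ∃ η : ℝ, 0 < η ∧ η < 1 / 2 ∧
    ∀ᵐ ω ∂P, η ≤ propensity P X T true ω ∧ propensity P X T true ω ≤ 1 - η

/-- The inverse propensity of arm `t` has the form
`1 / Pr(T = t ∣ X) = C f̃*'(θᵀ R (Φ(X) - E{Φ(X)}))`. -/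
def InversePropensityForm (P : Measure Ω) (X : Ω → EuclideanSpace ℝ (Fin p)) (T : Ω → Bool)
    (f : ℝ → ℝ) (Φ : EuclideanSpace ℝ (Fin p) → EuclideanSpace ℝ (Fin K))
    (R : Matrix (Fin K) (Fin K) ℝ) (t : Bool) : Prop :=
  ∃ (C : ℝ) (θ : EuclideanSpace ℝ (Fin K)), ∀ᵐ ω ∂P,
    1 / propensity P X T t ω = C * conjDeriv f (score R θ (centered P X Φ ω))

/-- `E{Y(t) ∣ X}` is a linear combination of the basis functions. -/
def LinearOutcome (P : Measure Ω) (X : Ω → EuclideanSpace ℝ (Fin p)) (Y : Ω → Bool → ℝ)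
    (Φ : EuclideanSpace ℝ (Fin p) → EuclideanSpace ℝ (Fin K)) (t : Bool) : Prop :=
  ∃ β : EuclideanSpace ℝ (Fin K), outcomeReg P X Y t =ᵐ[P] fun ω => inner ℝ β (Φ (X ω))

/-- `E{Y(t)}`. -/
def armMean (P : Measure Ω) (Y : Ω → Bool → ℝ) (t : Bool) : ℝ := ∫ ω, Y ω t ∂P

/-- The average treatment effect `τ = E{Y(1) - Y(0)}`. -/
def ate (P : Measure Ω) (Y : Ω → Bool → ℝ) : ℝ := ∫ ω, (Y ω true - Y ω false) ∂P

end Population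

/-! ### The sample and the estimator -/

section Sampling

variable {Ω : Type*} [MeasurableSpace Ω] {p K : ℕ}

/-- `(X i, T i, Y i)`, `i = 0, 1, …`, are i.i.d. random vectors; the population is represented by
the first of them. -/
structure IsIIDSample (P : Measure Ω) (X : ℕ → Ω → EuclideanSpace ℝ (Fin p)) (T : ℕ → Ω → Bool)
    (Y : ℕ → Ω → Bool → ℝ) : Prop where
  measurable_X : ∀ i, Measurable (X i)
  measurable_T : ∀ i, Measurable (T i)
  measurable_Y : ∀ i, Measurable (Y i)
  indep : iIndepFun (fun i ω => (X i ω, T i ω, Y i ω)) P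
  identDistrib : ∀ i, IdentDistrib (fun ω => (X i ω, T i ω, Y i ω))
    (fun ω => (X 0 ω, T 0 ω, Y 0 ω)) P P

/-- The unnormalized weights of the first `n` subjects. -/
def sampleRawWeight (X : ℕ → Ω → EuclideanSpace ℝ (Fin p)) (T : ℕ → Ω → Bool) (f : ℝ → ℝ)
    (Φ : EuclideanSpace ℝ (Fin p) → EuclideanSpace ℝ (Fin K)) (R : Matrix (Fin K) (Fin K) ℝ)
    (θhat : Bool → (n : ℕ) → (Fin n → EuclideanSpace ℝ (Fin p)) → (Fin n → Bool) →
      EuclideanSpace ℝ (Fin K)) (n : ℕ) (ω : Ω) : Fin n → ℝ :=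
  rawWeight f Φ R (fun t => θhat t n) (fun i => X i ω) (fun i => T i ω)

/-- The MB weights of the first `n` subjects. -/
def sampleWeight (X : ℕ → Ω → EuclideanSpace ℝ (Fin p)) (T : ℕ → Ω → Bool) (f : ℝ → ℝ)
    (Φ : EuclideanSpace ℝ (Fin p) → EuclideanSpace ℝ (Fin K)) (R : Matrix (Fin K) (Fin K) ℝ)
    (θhat : Bool → (n : ℕ) → (Fin n → EuclideanSpace ℝ (Fin p)) → (Fin n → Bool) →
      EuclideanSpace ℝ (Fin K)) (n : ℕ) (ω : Ω) : Fin n → ℝ :=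
  mbWeight f Φ R (fun t => θhat t n) (fun i => X i ω) (fun i => T i ω)

/-- The weighted mean `∑_{i : T_i = t} ŵ_i^MB Y_i` of arm `t`, where `Y_i = Y_i(T_i)` is the observed
outcome. -/
def armEstimator (X : ℕ → Ω → EuclideanSpace ℝ (Fin p)) (T : ℕ → Ω → Bool)
    (Y : ℕ → Ω → Bool → ℝ) (f : ℝ → ℝ)
    (Φ : EuclideanSpace ℝ (Fin p) → EuclideanSpace ℝ (Fin K)) (R : Matrix (Fin K) (Fin K) ℝ)
    (θhat : Bool → (n : ℕ) → (Fin n → EuclideanSpace ℝ (Fin p)) → (Fin n → Bool) →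
      EuclideanSpace ℝ (Fin K)) (t : Bool) (n : ℕ) (ω : Ω) : ℝ :=
  armSum (fun i : Fin n => T i ω) t
    (fun i => sampleWeight X T f Φ R θhat n ω i * Y i ω (T i ω))

/-- The MB-based estimator of the average treatment effect. -/
def ateEstimator (X : ℕ → Ω → EuclideanSpace ℝ (Fin p)) (T : ℕ → Ω → Bool)
    (Y : ℕ → Ω → Bool → ℝ) (f : ℝ → ℝ)
    (Φ : EuclideanSpace ℝ (Fin p) → EuclideanSpace ℝ (Fin K)) (R : Matrix (Fin K) (Fin K) ℝ)
    (θhat : Bool → (n : ℕ) → (Fin n → EuclideanSpace ℝ (Fin p)) → (Fin n → Bool) →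
      EuclideanSpace ℝ (Fin K)) (n : ℕ) (ω : Ω) : ℝ :=
  armEstimator X T Y f Φ R θhat true n ω - armEstimator X T Y f Φ R θhat false n ω

/-- The weight-stability and imbalance-rate conditions. -/
structure StableWeights (P : Measure Ω) (X : ℕ → Ω → EuclideanSpace ℝ (Fin p))
    (T : ℕ → Ω → Bool) (f : ℝ → ℝ)
    (Φ : EuclideanSpace ℝ (Fin p) → EuclideanSpace ℝ (Fin K))
    (W R : Matrix (Fin K) (Fin K) ℝ)
    (θhat : Bool → (n : ℕ) → (Fin n → EuclideanSpace ℝ (Fin p)) → (Fin n → Bool) →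
      EuclideanSpace ℝ (Fin K)) : Prop where
  /-- The normalization of the weights is well defined with probability tending to one. -/
  pos : ∀ t, Tendsto (fun n : ℕ => P {ω | armSum (fun i : Fin n => T i ω) t
    (sampleRawWeight X T f Φ R θhat n ω) ≤ 0}) atTop (𝓝 0)
  /-- `∑_{i : T_i = t} (ŵ_i^MB)³ / (∑_{i : T_i = t} (ŵ_i^MB)²)^{3/2} = o_p(1)`. -/
  cube : ∀ t, IsLittleOPOne P (fun n ω =>
    armSum (fun i : Fin n => T i ω) t (fun i => sampleWeight X T f Φ R θhat n ω i ^ 3) /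
      Real.sqrt (armSum (fun i : Fin n => T i ω) t
        (fun i => sampleWeight X T f Φ R θhat n ω i ^ 2)) ^ 3)
  /-- `‖ŵ^MB‖₂² = O_p(n⁻¹)`. -/
  square : IsBigOP P (fun n ω => ∑ i, sampleWeight X T f Φ R θhat n ω i ^ 2)
    (fun n => (n : ℝ)⁻¹)
  /-- The multivariate imbalance in each arm is `O_p(n⁻¹)`. -/
  imbalance : ∀ t, IsBigOP P (fun n ω =>
    imbalance Φ W (fun i : Fin n => X i ω) (fun i : Fin n => T i ω) t
      (sampleWeight X T f Φ R θhat n ω)) (fun n => (n : ℝ)⁻¹)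

end Sampling

end MahalanobisBalancing

end

/-!
The two arms are treated separately: the error of the estimated effect is the difference of the
errors of the two weighted means. Write `V = R (Φ(X) - E Φ(X))`, so that the dual problem of an arm
penalizes a sum of `f̃*(⟪θ, V_i - V̄⟫)`.

*Localization of the dual solution.* The penalized empirical objective is convex. If near the scores
of some `θ₁` the conjugate lies above its tangents by a quadratic term, the quadratic form that
results is uniformly positive definite in large samples, and the empirical gradient at `θ₁` is
`O_p(n^{-1/2})`, then the objective at distance `M n^{-1/2}` from `θ₁` exceeds its value at `θ₁`. So
minimizers exist with probability tending to one, and they lie within `O_p(n^{-1/2})` of `θ₁`; the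
penalty does not matter as `δ = o(n)`. This is `penObj_localization` and `dual_localization`. Only a
weighted second moment of `V` is needed, because `max_i ‖V_i‖ = o_p(√n)` keeps all scores in the
region where the quadratic bound holds. Positive definiteness follows from the uniqueness of the
population minimizer: the features of an arm cannot lie in a hyperplane, since the population
objective would be constant along its normal.

*Inverse propensity model.* If `1 / π_t(X) = C f̃*'(⟪θ₁, V⟫)`, then by overlap the scores at `θ₁` stay
in a compact part of the range of `f'`, where `f̃*` is strongly convex and `f̃*'` is Lipschitz. By
strong ignorability, expectations over the arm with weights `f̃*'(⟪θ₁, V⟫)` are multiples of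
expectations over the population; hence the gradient at `θ₁` is centred, localization applies, and
the estimated weights are uniformly close to the true ones. The weighted mean then inherits the rate
of the inverse propensity weighted mean (`armEstimator_of_inversePropensityForm`).

*Linear outcome model.* If `E{Y(t) ∣ X} = ⟪β, Φ(X)⟫`, the error of the weighted mean is the sum of
`⟪β, Φ̄ - E Φ(X)⟫`, of `⟪β, v_t⟫` with the imbalance vector `v_t`, and of a weighted sum of the noise.
The first term obeys the `n^{-1/2}` rate, the second is bounded by the square root of the imbalance,
and the third has conditional second moment proportional to `∑ w_i²`, because the weights are
functions of covariates and treatments and the noise is independent of these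
(`armEstimator_of_linearOutcome`).

*Entropy loss.* Here `f̃*(y) = exp(y - 1)`. By the exponential moments, localization applies at the
population minimizer `θ₀` without any model assumption: the first order condition at the interior
minimum says that the gradient is centred (`integral_exp_smul_eq_zero`). So the weights are within
constant factors of `exp ⟪θ₀, V_i⟫` and their normalized squared norm is `O_p(n⁻¹)`. The first order
condition of the empirical problem bounds the unnormalized imbalance by `√δ`, and the linear outcome
case applies (`armEstimator_of_entropy`).
-/

namespace MahalanobisBalancing

/-! ### Calculus of stochastic orders -/

section Orders

variable {Ω : Type*} [MeasurableSpace Ω] {P : Measure Ω}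

/-- The events `{ω | p n ω}` hold with probability tending to one. No measurability is asked for:
`P` is read as an outer measure. -/
def WHP (P : Measure Ω) (p : ℕ → Ω → Prop) : Prop :=
  Tendsto (fun n => P {ω | ¬ p n ω}) atTop (𝓝 0)

/-- `Z n = O_p(1)`. -/
def BddP (P : Measure Ω) (Z : ℕ → Ω → ℝ) : Prop :=
  ∀ ε : ℝ, 0 < ε → ∃ M : ℝ, ∀ᶠ n in atTop, P {ω | M < |Z n ω|} ≤ ENNReal.ofReal ε

lemma WHP.mono {p q : ℕ → Ω → Prop} (hp : WHP P p) (h : ∀ᶠ n in atTop, ∀ ω, p n ω → q n ω) :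
    WHP P q := by
  refine tendsto_of_tendsto_of_tendsto_of_le_of_le' tendsto_const_nhds hp
    (Eventually.of_forall fun _ => zero_le) ?_
  filter_upwards [h] with n hn
  exact measure_mono fun ω hω hpω => hω (hn ω hpω)

lemma WHP.and {p q : ℕ → Ω → Prop} (hp : WHP P p) (hq : WHP P q) :
    WHP P (fun n ω => p n ω ∧ q n ω) := by
  have := hp.add hq
  rw [add_zero] at this
  refine tendsto_of_tendsto_of_tendsto_of_le_of_le tendsto_const_nhds this
    (fun _ => zero_le) fun n => ?_
  refine (measure_mono ?_).trans (measure_union_le _ _)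
  intro ω hω
  by_contra h
  simp only [mem_union, mem_ofPred_eq, not_or, not_not] at h
  exact hω h

lemma WHP.of_ae {p : ℕ → Ω → Prop} (h : ∀ n, ∀ᵐ ω ∂P, p n ω) : WHP P p := by
  have : (fun n => P {ω | ¬ p n ω}) = fun _ => 0 := funext fun n => h n
  rw [WHP, this]
  exact tendsto_const_nhds

/-- An event that holds with probability tending to one on every event `{|W n| ≤ M}`, where
`W = O_p(1)`, holds with probability tending to one. -/
lemma BddP.whp {W : ℕ → Ω → ℝ} {q : ℕ → Ω → Prop} (hW : BddP P W)
    (h : ∀ M : ℝ, 0 ≤ M → WHP P (fun n ω => |W n ω| ≤ M → q n ω)) : WHP P q := by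
  rw [WHP, ENNReal.tendsto_nhds_zero]
  intro ε hε
  obtain ⟨ε', hε', hle⟩ : ∃ ε' : ℝ, 0 < ε' ∧ ENNReal.ofReal ε' + ENNReal.ofReal ε' ≤ ε := by
    rcases eq_or_ne ε ⊤ with rfl | htop
    · exact ⟨1, one_pos, le_top⟩
    · refine ⟨ε.toReal / 2, half_pos (ENNReal.toReal_pos hε.ne' htop), ?_⟩
      rw [← ENNReal.ofReal_add (by positivity) (by positivity), add_halves,
        ENNReal.ofReal_toReal htop]
  obtain ⟨M, hM⟩ := hW ε' hε'
  have h2 := h (max M 0) (le_max_right _ _)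
  rw [WHP, ENNReal.tendsto_nhds_zero] at h2
  filter_upwards [hM, h2 (ENNReal.ofReal ε') (by simpa using hε')] with n h1 h2
  refine le_trans ?_ ((add_le_add h1 h2).trans hle)
  refine (measure_mono ?_).trans (measure_union_le _ _)
  intro ω hω
  by_cases hm : M < |W n ω|
  · exact Or.inl hm
  · exact Or.inr fun hc => hω (hc ((not_lt.1 hm).trans (le_max_left _ _)))

/-- `Z = O_p(1)` if, for some `W = O_p(1)`, a bound on `W n` entails a bound on `Z n` with
probability tending to one. -/
lemma BddP.of_whp {W Z : ℕ → Ω → ℝ} (hW : BddP P W)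
    (h : ∀ M : ℝ, 0 ≤ M → ∃ M' : ℝ, WHP P (fun n ω => |W n ω| ≤ M → |Z n ω| ≤ M')) :
    BddP P Z := by
  intro ε hε
  obtain ⟨M, hM⟩ := hW (ε / 2) (half_pos hε)
  obtain ⟨M', h2⟩ := h (max M 0) (le_max_right _ _)
  rw [WHP, ENNReal.tendsto_nhds_zero] at h2
  refine ⟨M', ?_⟩
  filter_upwards [hM, h2 (ENNReal.ofReal (ε / 2)) (by simpa using hε)] with n h1 h2
  have hle : ENNReal.ofReal (ε / 2) + ENNReal.ofReal (ε / 2) = ENNReal.ofReal ε := by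
    rw [← ENNReal.ofReal_add (by positivity) (by positivity), add_halves]
  refine le_trans ?_ ((add_le_add h1 h2).trans hle.le)
  refine (measure_mono ?_).trans (measure_union_le _ _)
  intro ω hω
  by_cases hm : M < |W n ω|
  · exact Or.inl hm
  · refine Or.inr fun hc => ?_
    exact absurd (hc ((not_lt.1 hm).trans (le_max_left _ _))) (not_le.2 hω)

lemma BddP.of_whp_le {W Z : ℕ → Ω → ℝ} (hW : BddP P W)
    (h : WHP P (fun n ω => |Z n ω| ≤ |W n ω|)) : BddP P Z :=
  hW.of_whp fun M _ => ⟨M, h.mono (Eventually.of_forall fun _ _ h1 h2 => h1.trans h2)⟩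

lemma WHP.bddP {Z : ℕ → Ω → ℝ} {M : ℝ} (h : WHP P (fun n ω => |Z n ω| ≤ M)) : BddP P Z := by
  intro ε hε
  rw [WHP, ENNReal.tendsto_nhds_zero] at h
  refine ⟨M, ?_⟩
  filter_upwards [h (ENNReal.ofReal ε) (by simpa using hε)] with n hn
  simpa only [not_le] using hn

lemma BddP.of_le {W Z : ℕ → Ω → ℝ} (hW : BddP P W) (h : ∀ n ω, |Z n ω| ≤ |W n ω|) : BddP P Z :=
  hW.of_whp_le (WHP.of_ae fun n => ae_of_all _ (h n))

/-- The sum `|W| + |Z|` serves to control two `O_p(1)` sequences at once. -/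
lemma BddP.abs_add_abs {W Z : ℕ → Ω → ℝ} (hW : BddP P W) (hZ : BddP P Z) :
    BddP P (fun n ω => |W n ω| + |Z n ω|) := by
  intro ε hε
  obtain ⟨M, hM⟩ := hW (ε / 2) (half_pos hε)
  obtain ⟨N, hN⟩ := hZ (ε / 2) (half_pos hε)
  refine ⟨M + N, ?_⟩
  filter_upwards [hM, hN] with n h1 h2
  have hle : ENNReal.ofReal (ε / 2) + ENNReal.ofReal (ε / 2) = ENNReal.ofReal ε := by
    rw [← ENNReal.ofReal_add (by positivity) (by positivity), add_halves]
  refine le_trans ?_ ((add_le_add h1 h2).trans hle.le)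
  refine (measure_mono ?_).trans (measure_union_le _ _)
  intro ω hω
  simp only [mem_ofPred_eq] at hω
  rw [abs_of_nonneg (by positivity)] at hω
  by_contra hc
  simp only [mem_union, mem_ofPred_eq, not_or, not_lt] at hc
  linarith [hc.1, hc.2]

lemma BddP.add {W Z : ℕ → Ω → ℝ} (hW : BddP P W) (hZ : BddP P Z) :
    BddP P (fun n ω => W n ω + Z n ω) :=
  (hW.abs_add_abs hZ).of_le fun _ _ => by
    rw [abs_of_nonneg (a := |_| + |_|) (by positivity)]; exact abs_add_le _ _

lemma BddP.mul {W Z : ℕ → Ω → ℝ} (hW : BddP P W) (hZ : BddP P Z) :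
    BddP P (fun n ω => W n ω * Z n ω) := by
  refine (hW.abs_add_abs hZ).of_whp fun M hM =>
    ⟨M * M, WHP.of_ae fun n => ae_of_all _ fun ω h => ?_⟩
  rw [abs_of_nonneg (by positivity)] at h
  rw [abs_mul]
  have := abs_nonneg (W n ω)
  have := abs_nonneg (Z n ω)
  exact mul_le_mul (by linarith) (by linarith) (by positivity) hM

lemma BddP.const (c : ℝ) : BddP P (fun _ _ => c) :=
  WHP.bddP (M := |c|) (WHP.of_ae fun _ => ae_of_all _ fun _ => le_rfl)

lemma BddP.sum {ι : Type*} (s : Finset ι) {Z : ι → ℕ → Ω → ℝ} (h : ∀ k ∈ s, BddP P (Z k)) :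
    BddP P (fun n ω => ∑ k ∈ s, Z k n ω) := by
  classical
  induction s using Finset.induction_on with
  | empty => simpa using BddP.const (P := P) 0
  | insert a s ha ih =>
    simp only [Finset.sum_insert ha]
    exact (h a (by simp)).add (ih fun k hk => h k (by simp [hk]))

lemma isBigOP_rpow_iff {Z : ℕ → Ω → ℝ} :
    IsBigOP P Z (fun n => (n : ℝ) ^ (-(1 / 2) : ℝ)) ↔ BddP P (fun n ω => √n * Z n ω) := by
  refine forall_congr' fun ε => forall_congr' fun _ => exists_congr fun M => ?_
  refine eventually_congr ?_
  filter_upwards [eventually_gt_atTop 0] with n hn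
  have hn' : (0 : ℝ) < n := by exact_mod_cast hn
  have hs : 0 < √(n : ℝ) := Real.sqrt_pos.2 hn'
  have : ∀ ω, M * (n : ℝ) ^ (-(1 / 2) : ℝ) < |Z n ω| ↔ M < |√n * Z n ω| := by
    intro ω
    rw [Real.rpow_neg hn'.le, ← Real.sqrt_eq_rpow, ← div_eq_mul_inv, div_lt_iff₀ hs, abs_mul,
      abs_of_pos hs, mul_comm]
  simp only [this]

lemma isBigOP_inv_iff {Z : ℕ → Ω → ℝ} :
    IsBigOP P Z (fun n => (n : ℝ)⁻¹) ↔ BddP P (fun n ω => n * Z n ω) := by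
  refine forall_congr' fun ε => forall_congr' fun _ => exists_congr fun M => ?_
  refine eventually_congr ?_
  filter_upwards [eventually_gt_atTop 0] with n hn
  have hn' : (0 : ℝ) < n := by exact_mod_cast hn
  have : ∀ ω, M * (n : ℝ)⁻¹ < |Z n ω| ↔ M < |n * Z n ω| := by
    intro ω
    rw [← div_eq_mul_inv, div_lt_iff₀ hn', abs_mul, abs_of_pos hn', mul_comm]
  simp only [this]

/-- A sequence bounded in `L²` is `O_p(1)`. -/
lemma BddP.of_lintegral_sq_le {Z : ℕ → Ω → ℝ} {C : ℝ} (hC : 0 ≤ C)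
    (h : ∀ᶠ n in atTop, ∫⁻ ω, ENNReal.ofReal (Z n ω ^ 2) ∂P ≤ ENNReal.ofReal C)
    (hm : ∀ n, AEMeasurable (Z n) P) : BddP P Z := by
  intro ε hε
  refine ⟨√((C + 1) / ε), ?_⟩
  filter_upwards [h] with n hn
  have hpos : 0 < (C + 1) / ε := by positivity
  have hmar := mul_meas_ge_le_lintegral₀ (μ := P) (f := fun ω => ENNReal.ofReal (Z n ω ^ 2))
    ((hm n).pow_const 2).ennreal_ofReal (ENNReal.ofReal ((C + 1) / ε))
  have hsub : P {ω | √((C + 1) / ε) < |Z n ω|} ≤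
      P {ω | ENNReal.ofReal ((C + 1) / ε) ≤ ENNReal.ofReal (Z n ω ^ 2)} := by
    refine measure_mono fun ω hω => ?_
    simp only [mem_ofPred_eq] at hω ⊢
    refine ENNReal.ofReal_le_ofReal ?_
    rw [← sq_abs]
    exact (Real.sqrt_le_left (abs_nonneg _)).1 hω.le
  have h3 : ENNReal.ofReal ((C + 1) / ε) * P {ω | √((C + 1) / ε) < |Z n ω|} ≤
      ENNReal.ofReal ((C + 1) / ε) * ENNReal.ofReal ε := by
    refine (mul_le_mul_right hsub _).trans (hmar.trans (hn.trans ?_))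
    rw [← ENNReal.ofReal_mul hpos.le]
    refine ENNReal.ofReal_le_ofReal ?_
    rw [div_mul_cancel₀ _ hε.ne']; linarith
  exact (ENNReal.mul_le_mul_iff_right (by simpa using hpos) ENNReal.ofReal_ne_top).1 h3

end Orders

/-! ### Sample means of i.i.d. data -/

section Sample

/-- The mean of `h` over the first `n` data points. -/
noncomputable def sampleMean {Ω 𝒟 F : Type*} [AddCommGroup F] [Module ℝ F] (D : ℕ → Ω → 𝒟)
    (h : 𝒟 → F) (n : ℕ) (ω : Ω) : F :=
  (n : ℝ)⁻¹ • ∑ i : Fin n, h (D i ω)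

lemma sampleMean_eq_range {Ω 𝒟 F : Type*} [AddCommGroup F] [Module ℝ F] (D : ℕ → Ω → 𝒟)
    (h : 𝒟 → F) (n : ℕ) (ω : Ω) :
    sampleMean D h n ω = (n : ℝ)⁻¹ • ∑ i ∈ Finset.range n, h (D i ω) := by
  rw [sampleMean, Fin.sum_univ_eq_sum_range (fun i => h (D i ω)) n]

variable {Ω : Type*} [MeasurableSpace Ω] {P : Measure Ω} {𝒟 : Type*} [MeasurableSpace 𝒟]
  {D : ℕ → Ω → 𝒟}

/-- Law of large numbers. -/
lemma whp_sampleMean [IsProbabilityMeasure P] {F : Type*} [NormedAddCommGroup F] [NormedSpace ℝ F]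
    [CompleteSpace F] [MeasurableSpace F] [BorelSpace F] (hind : iIndepFun D P)
    (hid : ∀ i, IdentDistrib (D i) (D 0) P P) {h : 𝒟 → F} (hm : Measurable h)
    (hint : Integrable (fun ω => h (D 0 ω)) P) {ε : ℝ} (hε : 0 < ε) :
    WHP P (fun n ω => ‖sampleMean D h n ω - ∫ ω', h (D 0 ω') ∂P‖ ≤ ε) := by
  have hid' : ∀ i, IdentDistrib (fun ω => h (D i ω)) (fun ω => h (D 0 ω)) P P :=
    fun i => (hid i).comp hm
  have hsl := strong_law_ae (μ := P) (fun i ω => h (D i ω)) hint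
    (fun i j hij => (hind.indepFun hij).comp hm hm) hid'
  have hint' : ∀ i, Integrable (fun ω => h (D i ω)) P := fun i => (hid' i).integrable_iff.2 hint
  have hmeas : TendstoInMeasure P
      (fun (n : ℕ) ω => (n : ℝ)⁻¹ • ∑ i ∈ Finset.range n, h (D i ω)) atTop
      (fun _ => ∫ ω', h (D 0 ω') ∂P) := by
    refine tendstoInMeasure_of_tendsto_ae (fun n => ?_) hsl
    exact ((integrable_finsetSum _ fun i _ => hint' i).smul _).aestronglyMeasurable
  rw [tendstoInMeasure_iff_norm] at hmeas
  refine tendsto_of_tendsto_of_tendsto_of_le_of_le tendsto_const_nhds (hmeas ε hε)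
    (fun _ => zero_le) fun n => measure_mono fun ω hω => ?_
  simp only [mem_ofPred_eq, not_le, sampleMean_eq_range] at hω ⊢
  exact hω.le

lemma bddP_sampleMean [IsProbabilityMeasure P] (hind : iIndepFun D P)
    (hid : ∀ i, IdentDistrib (D i) (D 0) P P) {h : 𝒟 → ℝ} (hm : Measurable h)
    (hint : Integrable (fun ω => h (D 0 ω)) P) : BddP P (fun n ω => sampleMean D h n ω) := by
  refine WHP.bddP (M := ‖∫ ω', h (D 0 ω') ∂P‖ + 1)
    ((whp_sampleMean hind hid hm hint one_pos).mono (Eventually.of_forall fun n ω hω => ?_))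
  have := norm_sub_norm_le (sampleMean D h n ω) (∫ ω', h (D 0 ω') ∂P)
  rw [← Real.norm_eq_abs]
  linarith

/-- Sample means of centred square integrable variables are `O_p(n^{-1/2})`. -/
lemma bddP_sqrt_mul_sampleMean [IsProbabilityMeasure P] (hind : iIndepFun D P)
    (hid : ∀ i, IdentDistrib (D i) (D 0) P P) {h : 𝒟 → ℝ} (hm : Measurable h)
    (hint : MemLp (fun ω => h (D 0 ω)) 2 P) (hzero : ∫ ω, h (D 0 ω) ∂P = 0) :
    BddP P (fun n ω => √n * sampleMean D h n ω) := by
  have hid' : ∀ i, IdentDistrib (fun ω => h (D i ω)) (fun ω => h (D 0 ω)) P P :=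
    fun i => (hid i).comp hm
  have hL2 : ∀ i, MemLp (fun ω => h (D i ω)) 2 P := fun i => (hid' i).memLp_iff.2 hint
  set σ := variance (fun ω => h (D 0 ω)) P with hσ
  have hσ0 : 0 ≤ σ := variance_nonneg _ _
  have hsumL2 : ∀ n : ℕ, MemLp (fun ω => ∑ i ∈ Finset.range n, h (D i ω)) 2 P :=
    fun n => memLp_finsetSum _ fun i _ => hL2 i
  have hvar : ∀ n : ℕ, ∫ ω, (∑ i ∈ Finset.range n, h (D i ω)) ^ 2 ∂P = n * σ := by
    intro n
    have h1 := IndepFun.variance_sum (μ := P) (X := fun i ω => h (D i ω)) (s := Finset.range n)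
      (fun i _ => hL2 i) (fun i _ j _ hij => (hind.indepFun hij).comp hm hm)
    have h2 : ∀ i, variance (fun ω => h (D i ω)) P = σ := fun i => (hid' i).variance_eq
    simp only [h2, Finset.sum_const, Finset.card_range, nsmul_eq_mul] at h1
    rw [← h1, variance_eq_sub]
    · have h3 : (∫ ω, (∑ i ∈ Finset.range n, fun ω => h (D i ω)) ω ∂P) = 0 := by
        simp only [Finset.sum_apply]
        rw [integral_finsetSum _ fun i _ => (hL2 i).integrable one_le_two]
        refine Finset.sum_eq_zero fun i _ => ?_
        rw [(hid' i).integral_eq, hzero]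
      rw [h3]; simp
    · simpa only [Finset.sum_fn] using hsumL2 n
  refine BddP.of_lintegral_sq_le hσ0 ?_ fun n => ?_
  · filter_upwards [eventually_gt_atTop 0] with n hn
    have hn' : (0 : ℝ) < n := by exact_mod_cast hn
    have hrw : ∀ ω, (√n * sampleMean D h n ω) ^ 2 =
        (n : ℝ)⁻¹ * (∑ i ∈ Finset.range n, h (D i ω)) ^ 2 := by
      intro ω
      rw [sampleMean_eq_range, smul_eq_mul, mul_pow, mul_pow, Real.sq_sqrt hn'.le]
      field_simp
    simp only [hrw]
    rw [← ofReal_integral_eq_lintegral_ofReal ((hsumL2 n).integrable_sq.const_mul _)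
      (ae_of_all _ fun ω => by positivity), integral_const_mul, hvar]
    refine ENNReal.ofReal_le_ofReal ?_
    rw [← mul_assoc, inv_mul_cancel₀ hn'.ne', one_mul]
  · simp only [sampleMean_eq_range, smul_eq_mul]
    exact ((hsumL2 n).1.aemeasurable.const_mul (n : ℝ)⁻¹).const_mul (√n)

/-- The vector-valued form of `bddP_sqrt_mul_sampleMean`. -/
lemma bddP_sqrt_mul_norm_sampleMean [IsProbabilityMeasure P] {K : ℕ} (hind : iIndepFun D P)
    (hid : ∀ i, IdentDistrib (D i) (D 0) P P) {h : 𝒟 → EuclideanSpace ℝ (Fin K)}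
    (hm : Measurable h)
    (hint : MemLp (fun ω => h (D 0 ω)) 2 P) (hzero : ∫ ω, h (D 0 ω) ∂P = 0) :
    BddP P (fun n ω => √n * ‖sampleMean D h n ω‖) := by
  have hcoord : ∀ k, BddP P (fun n ω => √n * sampleMean D (fun z => h z k) n ω) := by
    intro k
    have hL : ∀ v : EuclideanSpace ℝ (Fin K), v k = EuclideanSpace.proj (𝕜 := ℝ) k v := fun _ => rfl
    refine bddP_sqrt_mul_sampleMean hind hid ?_ ?_ ?_
    · simp only [hL]
      exact (EuclideanSpace.proj (𝕜 := ℝ) k).continuous.measurable.comp hm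
    · simp only [hL]
      exact (EuclideanSpace.proj (𝕜 := ℝ) k).comp_memLp' hint
    · simp only [hL]
      rw [ContinuousLinearMap.integral_comp_comm _ (hint.integrable one_le_two), hzero, map_zero]
  have habs : ∀ k, BddP P (fun n ω => |√n * sampleMean D (fun z => h z k) n ω|) :=
    fun k => (hcoord k).of_le fun n ω => by rw [abs_abs]
  refine (BddP.sum Finset.univ fun k _ => habs k).of_le fun n ω => ?_
  rw [abs_of_nonneg (by positivity), abs_of_nonneg (Finset.sum_nonneg fun _ _ => abs_nonneg _)]
  have hco : ∀ k, sampleMean D (fun z => h z k) n ω = sampleMean D h n ω k := by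
    intro k; simp [sampleMean]
  simp only [hco, abs_mul, abs_of_nonneg (Real.sqrt_nonneg (n : ℝ)), ← Finset.mul_sum]
  refine mul_le_mul_of_nonneg_left ?_ (Real.sqrt_nonneg _)
  set v := sampleMean D h n ω
  rw [EuclideanSpace.norm_eq]
  refine Real.sqrt_le_iff.2 ⟨Finset.sum_nonneg fun _ _ => abs_nonneg _, ?_⟩
  simpa only [Real.norm_eq_abs] using
    Finset.sum_sq_le_sq_sum_of_nonneg (s := Finset.univ) (f := fun k => |v k|)
      (fun _ _ => abs_nonneg _)

/-- The maximum of `n` square integrable variables is `o_p(√n)`. -/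
lemma whp_forall_le_sqrt [IsProbabilityMeasure P]
    (hid : ∀ i, IdentDistrib (D i) (D 0) P P) {h : 𝒟 → ℝ} (hm : Measurable h)
    (hint : MemLp (fun ω => h (D 0 ω)) 2 P) {ε : ℝ} (hε : 0 < ε) :
    WHP P (fun n ω => ∀ i : Fin n, |h (D i ω)| ≤ ε * √n) := by
  have hsq := hint.integrable_sq
  have hD0 := (hid 0).aemeasurable_fst
  have hmh : AEMeasurable (fun ω => h (D 0 ω)) P := hm.comp_aemeasurable hD0
  set A : ℕ → Set Ω := fun n => {ω | ε * √n < |h (D 0 ω)|} with hA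
  have hAm : ∀ n, NullMeasurableSet (A n) P := fun n =>
    nullMeasurableSet_lt aemeasurable_const hmh.abs
  have hlim : Tendsto (fun n => ∫⁻ ω in A n, ENNReal.ofReal (h (D 0 ω) ^ 2) ∂P) atTop (𝓝 0) := by
    have hint' : ∫⁻ ω, ENNReal.ofReal (h (D 0 ω) ^ 2) ∂P ≠ ⊤ := by
      have := hsq.lintegral_lt_top; exact this.ne
    refine tendsto_setLIntegral_zero hint' ?_
    have hanti : Antitone A := by
      intro m n hmn ω hω
      simp only [hA, mem_ofPred_eq] at hω ⊢
      refine lt_of_le_of_lt ?_ hω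
      gcongr
    have hinter : ⋂ n, A n = ∅ := by
      refine eq_empty_of_forall_notMem fun ω hω => ?_
      rw [mem_iInter] at hω
      obtain ⟨n, hn⟩ := exists_nat_gt ((|h (D 0 ω)| / ε) ^ 2)
      have h1 := hω n
      simp only [hA, mem_ofPred_eq] at h1
      have h2 : |h (D 0 ω)| / ε < √n := Real.lt_sqrt_of_sq_lt hn
      rw [div_lt_iff₀ hε] at h2
      linarith
    have := tendsto_measure_iInter_atTop (μ := P) hAm hanti ⟨0, measure_ne_top _ _⟩
    rwa [hinter, measure_empty] at this
  have hbound : ∀ n : ℕ, P {ω | ¬ ∀ i : Fin n, |h (D i ω)| ≤ ε * √n} ≤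
      ENNReal.ofReal ((ε ^ 2)⁻¹) * ∫⁻ ω in A n, ENNReal.ofReal (h (D 0 ω) ^ 2) ∂P := by
    intro n
    have h1 : P {ω | ¬ ∀ i : Fin n, |h (D i ω)| ≤ ε * √n} ≤ n * P (A n) := by
      have hsub : {ω | ¬ ∀ i : Fin n, |h (D i ω)| ≤ ε * √n} ⊆
          ⋃ i : Fin n, {ω | ε * √n < |h (D i ω)|} := by
        intro ω hω
        simp only [mem_ofPred_eq, not_forall, not_le] at hω
        simpa using hω
      refine (measure_mono hsub).trans ((measure_iUnion_fintype_le _ _).trans ?_)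
      have heq : ∀ i : Fin n, P {ω | ε * √n < |h (D i ω)|} = P (A n) := fun i =>
        ((hid i).comp hm).measure_mem_eq (s := {x : ℝ | ε * √n < |x|})
          (measurableSet_lt measurable_const continuous_abs.measurable)
      simp [heq]
    refine h1.trans ?_
    have h2 : ENNReal.ofReal (ε ^ 2 * n) * P (A n) ≤
        ∫⁻ ω in A n, ENNReal.ofReal (h (D 0 ω) ^ 2) ∂P := by
      rw [← setLIntegral_const]
      refine lintegral_mono_ae ?_
      rw [ae_restrict_iff'₀ (hAm n)]
      refine ae_of_all _ fun ω hω => ENNReal.ofReal_le_ofReal ?_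
      simp only [hA, mem_ofPred_eq] at hω
      rw [← sq_abs (h (D 0 ω))]
      calc ε ^ 2 * n = (ε * √n) ^ 2 := by rw [mul_pow, Real.sq_sqrt (Nat.cast_nonneg n)]
        _ ≤ _ := by gcongr
    calc (n : ℝ≥0∞) * P (A n)
        = ENNReal.ofReal ((ε ^ 2)⁻¹) * (ENNReal.ofReal (ε ^ 2 * n) * P (A n)) := by
          rw [← mul_assoc, ← ENNReal.ofReal_mul (by positivity), ← mul_assoc,
            inv_mul_cancel₀ (by positivity), one_mul, ENNReal.ofReal_natCast]
      _ ≤ _ := mul_le_mul_right h2 _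
  have hlim' := ENNReal.Tendsto.const_mul (a := ENNReal.ofReal ((ε ^ 2)⁻¹)) hlim
    (Or.inr ENNReal.ofReal_ne_top)
  rw [mul_zero] at hlim'
  exact tendsto_of_tendsto_of_tendsto_of_le_of_le tendsto_const_nhds hlim' (fun _ => zero_le) hbound

/-- If the pairs `(a i, e i)` are independent of each other and each `a i` is independent of `e i`,
then the vector of the first `n` of the `a i` is independent of that of the `e i`. -/
lemma indepFun_pi_of_pairs [IsProbabilityMeasure P] {α β : Type*} [MeasurableSpace α]
    [MeasurableSpace β] {a : ℕ → Ω → α} {e : ℕ → Ω → β} (ha : ∀ i, Measurable (a i))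
    (he : ∀ i, Measurable (e i)) (hind : iIndepFun (fun i ω => (a i ω, e i ω)) P)
    (hae : ∀ i, IndepFun (a i) (e i) P) (n : ℕ) :
    IndepFun (fun ω (i : Fin n) => a i ω) (fun ω (i : Fin n) => e i ω) P := by
  have hind' : iIndepFun (fun (i : Fin n) ω => (a i ω, e i ω)) P :=
    hind.precomp Fin.val_injective
  have hpa : ∀ i, IsProbabilityMeasure (P.map (a i)) :=
    fun i => Measure.isProbabilityMeasure_map (ha i).aemeasurable
  have hpe : ∀ i, IsProbabilityMeasure (P.map (e i)) :=
    fun i => Measure.isProbabilityMeasure_map (he i).aemeasurable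
  have hmap := (iIndepFun_iff_map_fun_eq_pi_map
    (fun i : Fin n => ((ha i).prodMk (he i)).aemeasurable)).1 hind'
  have hpair : ∀ i, P.map (fun ω => (a i ω, e i ω)) = (P.map (a i)).prod (P.map (e i)) := fun i =>
    (indepFun_iff_map_prod_eq_prod_map_map (ha i).aemeasurable (he i).aemeasurable).1 (hae i)
  simp only [hpair] at hmap
  have hmA : Measurable fun ω (i : Fin n) => a i ω := measurable_pi_lambda _ fun i => ha i
  have hmE : Measurable fun ω (i : Fin n) => e i ω := measurable_pi_lambda _ fun i => he i
  have hA := (iIndepFun_iff_map_fun_eq_pi_map (fun i : Fin n => (ha i).aemeasurable)).1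
    (hind'.comp (fun _ => Prod.fst) fun _ => measurable_fst)
  have hE := (iIndepFun_iff_map_fun_eq_pi_map (fun i : Fin n => (he i).aemeasurable)).1
    (hind'.comp (fun _ => Prod.snd) fun _ => measurable_snd)
  rw [indepFun_iff_map_prod_eq_prod_map_map hmA.aemeasurable hmE.aemeasurable, hA, hE]
  have hmp := measurePreserving_arrowProdEquivProdArrow α β (Fin n)
    (fun i => P.map (a i)) (fun i => P.map (e i))
  rw [← hmp.map_eq, ← hmap, Measure.map_map hmp.measurable
    (measurable_pi_lambda _ fun i => (ha i).prodMk (he i))]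
  rfl

end Sample

/-! ### The conjugate of the loss -/

section Conjugate

variable {f : ℝ → ℝ}

lemma le_conj (f : ℝ → ℝ) {p : ℝ} (hp : 0 < p) (y : ℝ) : ((p * y - f p : ℝ) : EReal) ≤ conj f y :=
  le_iSup₂_of_le (f := fun (p : ℝ) (_ : p ∈ Ioi (0 : ℝ)) => ((p * y - f p : ℝ) : EReal)) p hp le_rfl

lemma conj_ne_bot (f : ℝ → ℝ) (y : ℝ) : conj f y ≠ ⊥ := fun h => by
  have := le_conj f one_pos y
  rw [h, le_bot_iff] at this
  exact EReal.coe_ne_bot _ this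

lemma deriv_mul_sub_le (hf : StrictConvexOn ℝ (Ioi 0) f) (hC : ContDiffOn ℝ 2 f (Ioi 0)) {p q : ℝ}
    (hp : 0 < p) (hq : 0 < q) : f p + deriv f p * (q - p) ≤ f q := by
  have hd : DifferentiableAt ℝ f p :=
    (hC.differentiableOn (by norm_num)).differentiableAt (Ioi_mem_nhds hp)
  rcases lt_trichotomy p q with h | rfl | h
  · have := hf.convexOn.deriv_le_slope (x := p) (y := q) hp hq h hd
    rw [slope_def_field, le_div_iff₀ (by linarith)] at this
    linarith
  · simp
  · have := hf.convexOn.slope_le_deriv (x := q) (y := p) hq hp h hd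
    rw [slope_def_field, div_le_iff₀ (by linarith)] at this
    linarith

lemma strictMonoOn_deriv_loss (hf : StrictConvexOn ℝ (Ioi 0) f) (hC : ContDiffOn ℝ 2 f (Ioi 0)) :
    StrictMonoOn (deriv f) (Ioi 0) :=
  hf.strictMonoOn_deriv fun _ hx =>
    (hC.differentiableOn (by norm_num)).differentiableAt (Ioi_mem_nhds hx)

lemma contDiffOn_deriv_loss (hC : ContDiffOn ℝ 2 f (Ioi 0)) : ContDiffOn ℝ 1 (deriv f) (Ioi 0) :=
  hC.deriv_of_isOpen isOpen_Ioi (by norm_num)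

/-- Equality in the Fenchel inequality. -/
lemma conj_deriv (hf : StrictConvexOn ℝ (Ioi 0) f) (hC : ContDiffOn ℝ 2 f (Ioi 0)) {p : ℝ}
    (hp : 0 < p) : conj f (deriv f p) = ((p * deriv f p - f p : ℝ) : EReal) := by
  refine le_antisymm (iSup₂_le fun q hq => EReal.coe_le_coe_iff.2 ?_) (le_conj f hp _)
  have := deriv_mul_sub_le hf hC hp hq
  linarith

lemma exists_deriv_eq_of_mem_Icc (hC : ContDiffOn ℝ 2 f (Ioi 0)) {a b : ℝ} (ha : 0 < a)
    (hab : a ≤ b) {y : ℝ} (hy : y ∈ Icc (deriv f a) (deriv f b)) :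
    ∃ p ∈ Icc a b, deriv f p = y :=
  intermediate_value_Icc hab
    ((contDiffOn_deriv_loss hC).continuousOn.mono fun _ hx => ha.trans_le hx.1) hy

/-- The derivative of the conjugate inverts the derivative of the loss. -/
lemma hasDerivAt_conj (hf : StrictConvexOn ℝ (Ioi 0) f) (hC : ContDiffOn ℝ 2 f (Ioi 0)) {p : ℝ}
    (hp : 0 < p) : HasDerivAt (fun u => (conj f u).toReal) p (deriv f p) := by
  rw [hasDerivAt_iff_isLittleO, isLittleO_iff]
  intro c hc
  have hmono := strictMonoOn_deriv_loss hf hC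
  set ε := min c (p / 2) with hε
  have hε0 : 0 < ε := lt_min hc (by linarith)
  have hεp : ε ≤ p / 2 := min_le_right _ _
  have h1 : deriv f (p - ε) < deriv f p :=
    hmono (show (0 : ℝ) < p - ε by linarith) hp (by linarith)
  have h2 : deriv f p < deriv f (p + ε) :=
    hmono hp (show (0 : ℝ) < p + ε by linarith) (by linarith)
  filter_upwards [Icc_mem_nhds h1 h2] with y hy
  obtain ⟨q, hq, rfl⟩ := exists_deriv_eq_of_mem_Icc hC (by linarith) (by linarith) hy
  have hq0 : 0 < q := by linarith [hq.1]
  rw [conj_deriv hf hC hq0, conj_deriv hf hC hp, EReal.toReal_coe, EReal.toReal_coe,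
    Real.norm_eq_abs, Real.norm_eq_abs, smul_eq_mul]
  have t1 := deriv_mul_sub_le hf hC hq0 hp
  have t2 := deriv_mul_sub_le hf hC hp hq0
  have hqp : |q - p| ≤ c := (abs_le.2 ⟨by linarith [hq.1], by linarith [hq.2]⟩).trans
    (min_le_left c (p / 2))
  have hle : q * deriv f q - f q - (p * deriv f p - f p) - (deriv f q - deriv f p) * p ≤
      (q - p) * (deriv f q - deriv f p) := by nlinarith
  rw [abs_of_nonneg (by nlinarith)]
  refine hle.trans ((le_abs_self _).trans ?_)
  rw [abs_mul]
  exact mul_le_mul_of_nonneg_right hqp (abs_nonneg _)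

lemma conjDeriv_deriv (hf : StrictConvexOn ℝ (Ioi 0) f) (hC : ContDiffOn ℝ 2 f (Ioi 0)) {p : ℝ}
    (hp : 0 < p) : conjDeriv f (deriv f p) = p :=
  (hasDerivAt_conj hf hC hp).deriv

/-- `f̃*'` vanishes off the range of `f'`: below the range `f̃*` is constant, and above the range
`f̃*` is infinite, where the derivative has its default value. -/
lemma exists_deriv_eq_of_conjDeriv_ne_zero (hf : StrictConvexOn ℝ (Ioi 0) f)
    (hC : ContDiffOn ℝ 2 f (Ioi 0)) {y : ℝ} (hy : conjDeriv f y ≠ 0) :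
    ∃ p, 0 < p ∧ deriv f p = y := by
  by_contra! hcon
  have hcont := (contDiffOn_deriv_loss hC).continuousOn
  have hdiff : DifferentiableAt ℝ (fun u => (conj f u).toReal) y := by
    by_contra h
    exact hy (deriv_zero_of_not_differentiableAt h)
  have hdy : HasDerivAt (fun u => (conj f u).toReal) (conjDeriv f y) y := hdiff.hasDerivAt
  have hside : (∀ p, 0 < p → y < deriv f p) ∨ (∀ p, 0 < p → deriv f p < y) := by
    by_contra! h
    obtain ⟨⟨p, hp, hpy⟩, q, hq, hqy⟩ := h
    obtain ⟨r, hr, hry⟩ := isPreconnected_Ioi.intermediate_value (a := p) (b := q) hp hq hcont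
      ⟨hpy, hqy⟩
    exact hcon r hr hry
  rcases hside with hlow | hhigh
  · have hanti : ∀ p q, 0 < q → q ≤ p → p * y - f p ≤ q * y - f q := by
      intro p q hq hqp
      have := deriv_mul_sub_le hf hC hq (hq.trans_le hqp)
      nlinarith [hlow q hq]
    have hconst : ∀ y' ≤ y, conj f y' = conj f y := by
      intro y' hy'
      refine le_antisymm (iSup₂_le fun p hp => ?_) (iSup₂_le fun p hp => ?_)
      · refine le_trans (EReal.coe_le_coe_iff.2 ?_) (le_conj f hp y)
        have hp' : (0 : ℝ) < p := hp
        nlinarith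
      · refine EReal.le_of_forall_lt_iff_le.1 fun z hz => ?_
        have hp' : (0 : ℝ) < p := hp
        rcases eq_or_ne (conj f y') ⊤ with htop | htop
        · rw [htop] at hz; exact absurd hz not_top_lt
        · obtain ⟨v, hv⟩ : ∃ v : ℝ, conj f y' = v :=
            ⟨_, (EReal.coe_toReal htop (conj_ne_bot f y')).symm⟩
          rw [hv] at hz
          have hvz := EReal.coe_lt_coe_iff.1 hz
          set q := min p ((z - v) / (y - y' + 1)) with hqdef
          have hden : 0 < y - y' + 1 := by linarith
          have hq : 0 < q := lt_min hp' (div_pos (by linarith) hden)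
          have h1 := hanti p q hq (min_le_left _ _)
          have h2 : q * (y - y' + 1) ≤ z - v := by
            rw [← le_div_iff₀ hden]; exact min_le_right _ _
          have h3 := le_conj f hq y'
          rw [hv] at h3
          have h3 := EReal.coe_le_coe_iff.1 h3
          exact EReal.coe_le_coe_iff.2 (by nlinarith)
    have hleft : HasDerivWithinAt (fun u => (conj f u).toReal) 0 (Iic y) y :=
      (hasDerivWithinAt_const y (Iic y) (conj f y).toReal).congr
        (fun u hu => by rw [hconst u hu]) rfl
    exact hy ((uniqueDiffWithinAt_Iic y).eq_deriv _ hdy.hasDerivWithinAt hleft)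
  · have htop : ∀ y' > y, conj f y' = ⊤ := by
      intro y' hy'
      refine EReal.eq_top_iff_forall_lt _ |>.2 fun z => ?_
      set p := max 1 ((z - (y - f 1) + 1) / (y' - y)) with hpdef
      have hp : 0 < p := lt_of_lt_of_le one_pos (le_max_left _ _)
      have h1 : z - (y - f 1) + 1 ≤ p * (y' - y) := by
        rw [← div_le_iff₀ (by linarith)]; exact le_max_right _ _
      have h2 := deriv_mul_sub_le hf hC hp one_pos
      have h3 : f p ≤ f 1 + deriv f p * (p - 1) := by linarith
      have h4 : (deriv f p - y) * (p - 1) ≤ 0 :=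
        mul_nonpos_of_nonpos_of_nonneg (by linarith [hhigh p hp]) (by
          linarith [le_max_left 1 ((z - (y - f 1) + 1) / (y' - y))])
      refine lt_of_lt_of_le (EReal.coe_lt_coe_iff.2 ?_) (le_conj f hp y')
      nlinarith
    have hzero : ∀ y' > y, (conj f y').toReal = 0 := fun y' hy' => by rw [htop y' hy']; rfl
    have hy0 : (conj f y).toReal = 0 := by
      have h1 : Tendsto (fun u => (conj f u).toReal) (𝓝[>] y) (𝓝 (conj f y).toReal) :=
        hdy.continuousAt.tendsto.mono_left nhdsWithin_le_nhds
      have h2 : Tendsto (fun u => (conj f u).toReal) (𝓝[>] y) (𝓝 0) :=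
        tendsto_const_nhds.congr' (by
          filter_upwards [self_mem_nhdsWithin] with u hu using (hzero u hu).symm)
      exact tendsto_nhds_unique h1 h2
    have hright : HasDerivWithinAt (fun u => (conj f u).toReal) 0 (Ici y) y := by
      refine (hasDerivWithinAt_const y (Ici y) (0 : ℝ)).congr (fun u hu => ?_) hy0
      rcases eq_or_lt_of_le (show y ≤ u from hu) with rfl | h
      · exact hy0
      · exact hzero u h
    exact hy ((uniqueDiffWithinAt_Ici y).eq_deriv _ hdy.hasDerivWithinAt hright)

/-- A lower bound for the increment of a convex function on a short step extends, by the convexity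
of `f̃*`, to the long step. -/
lemma coe_le_conj_add {y x s A m c : ℝ} (hA : conj f y = (A : EReal)) (hs : 0 < s) (hs1 : s ≤ 1)
    (h : ((A + m * (s * x) + c : ℝ) : EReal) ≤ conj f (y + s * x)) :
    ((A + m * x + c / s : ℝ) : EReal) ≤ conj f (y + x) := by
  rcases eq_or_ne (conj f (y + x)) ⊤ with htop | htop
  · rw [htop]; exact le_top
  obtain ⟨v, hv⟩ : ∃ v : ℝ, conj f (y + x) = v :=
    ⟨_, (EReal.coe_toReal htop (conj_ne_bot f _)).symm⟩
  have hconv : conj f (y + s * x) ≤ (((1 - s) * A + s * v : ℝ) : EReal) := by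
    refine iSup₂_le fun q hq => EReal.coe_le_coe_iff.2 ?_
    have h1 := le_conj f hq y
    have h2 := le_conj f hq (y + x)
    rw [hA] at h1
    rw [hv] at h2
    have h1 := EReal.coe_le_coe_iff.1 h1
    have h2 := EReal.coe_le_coe_iff.1 h2
    nlinarith [mul_le_mul_of_nonneg_left h1 (sub_nonneg.2 hs1),
      mul_le_mul_of_nonneg_left h2 hs.le]
  have h3 := EReal.coe_le_coe_iff.1 (h.trans hconv)
  rw [hv, EReal.coe_le_coe_iff]
  have h4 : (m * x + c / s) * s = m * (s * x) + c := by field_simp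
  have h5 : (m * x + c / s) * s ≤ (v - A) * s := by rw [h4]; linarith
  have h6 := le_of_mul_le_mul_right h5 hs
  linarith

/-- `conj f` has a strong tangent at `y`, of curvature `c` on the scale `ρ`: it is finite and
continuous up to distance `ρ` from `y` and exceeds its tangent by `c x²` at distance `|x| ≤ ρ`,
hence by `c s x²` at any `x` that a factor `s ≤ 1` brings back to that range. -/
structure HasStrongTangent (f : ℝ → ℝ) (y ρ c : ℝ) : Prop where
  ne_top : ∀ x, |x| ≤ ρ → conj f (y + x) ≠ ⊤
  continuousAt : ∀ x, |x| ≤ ρ → ContinuousAt (fun u => (conj f u).toReal) (y + x)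
  le_conj : ∀ x s, 0 < s → s ≤ 1 → |s * x| ≤ ρ →
    (((conj f y).toReal + conjDeriv f y * x + c * s * x ^ 2 : ℝ) : EReal) ≤ conj f (y + x)

lemma HasStrongTangent.mk_of_le {y ρ c : ℝ} (hρ : 0 ≤ ρ)
    (h1 : ∀ x, |x| ≤ ρ → conj f (y + x) ≠ ⊤)
    (h2 : ∀ x, |x| ≤ ρ → ContinuousAt (fun u => (conj f u).toReal) (y + x))
    (h3 : ∀ x, |x| ≤ ρ → (conj f y).toReal + conjDeriv f y * x + c * x ^ 2 ≤
      (conj f (y + x)).toReal) : HasStrongTangent f y ρ c := by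
  refine ⟨h1, h2, fun x s hs hs1 hsx => ?_⟩
  have hy : conj f y = ((conj f y).toReal : EReal) := by
    have := h1 0 (by simpa using hρ)
    rw [add_zero] at this
    exact (EReal.coe_toReal this (conj_ne_bot f y)).symm
  have h4 := coe_le_conj_add (x := x) (m := conjDeriv f y) (c := c * (s * x) ^ 2) hy hs hs1 (by
    rw [← EReal.coe_toReal (h1 _ hsx) (conj_ne_bot f _), EReal.coe_le_coe_iff]
    exact h3 _ hsx)
  convert h4 using 2
  field_simp

/-- Over a compact part of the range of `f'`, the conjugate of a loss with `f'' > 0` has strong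
tangents of a common curvature, and `f̃*'` is Lipschitz. -/
lemma exists_hasStrongTangent (hf : StrictConvexOn ℝ (Ioi 0) f) (hC : ContDiffOn ℝ 2 f (Ioi 0))
    (hpos : ∀ x : ℝ, 0 < x → 0 < deriv (deriv f) x) {a b : ℝ} (ha : 0 < a) (hab : a ≤ b) :
    ∃ ρ κ L : ℝ, 0 < ρ ∧ 0 < κ ∧ 0 ≤ L ∧ ∀ y₀ ∈ Icc (deriv f a) (deriv f b),
      (∀ y, |y - y₀| ≤ ρ → HasStrongTangent f y ρ κ) ∧
      ∀ y y', |y - y₀| ≤ ρ → |y' - y₀| ≤ ρ →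
        |conjDeriv f y - conjDeriv f y'| ≤ L * |y - y'| := by
  have hmono := strictMonoOn_deriv_loss hf hC
  have hg := contDiffOn_deriv_loss hC
  set a' := a / 2 with ha'
  set b' := 2 * b with hb'
  have ha0 : 0 < a' := by positivity
  have hsub : Icc a' b' ⊆ Ioi 0 := fun x hx => ha0.trans_le hx.1
  have hg2 : ContinuousOn (deriv (deriv f)) (Icc a' b') :=
    ((hg.deriv_of_isOpen (m := 0) isOpen_Ioi (by norm_num)).continuousOn).mono hsub
  have hne : (Icc a' b').Nonempty := ⟨a', le_rfl, by rw [ha', hb']; linarith⟩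
  obtain ⟨x₁, hx₁, hmin⟩ := isCompact_Icc.exists_isMinOn hne hg2
  obtain ⟨x₂, hx₂, hmax⟩ := isCompact_Icc.exists_isMaxOn hne hg2
  set m := deriv (deriv f) x₁
  set N := deriv (deriv f) x₂
  have hm0 : 0 < m := hpos _ (hsub hx₁)
  have hN0 : 0 < N := hpos _ (hsub hx₂)
  have hgc : ContinuousOn (deriv f) (Icc a' b') := hg.continuousOn.mono hsub
  have hgd : DifferentiableOn ℝ (deriv f) (interior (Icc a' b')) :=
    (hg.differentiableOn (by norm_num)).mono (interior_subset.trans hsub)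
  have hlow : ∀ p ∈ Icc a' b', ∀ q ∈ Icc a' b', p ≤ q → m * (q - p) ≤ deriv f q - deriv f p :=
    (convex_Icc a' b').mul_sub_le_image_sub_of_le_deriv hgc hgd
      fun x hx => hmin (interior_subset hx)
  have hup : ∀ p ∈ Icc a' b', ∀ q ∈ Icc a' b', p ≤ q → deriv f q - deriv f p ≤ N * (q - p) :=
    (convex_Icc a' b').image_sub_le_mul_sub_of_deriv_le hgc hgd
      fun x hx => hmax (interior_subset hx)
  have hgaa : deriv f a' < deriv f a := hmono ha0 ha (by rw [ha']; linarith)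
  have hb0 : 0 < b := ha.trans_le hab
  have hgbb : deriv f b < deriv f b' :=
    hmono hb0 (show (0 : ℝ) < b' by positivity) (by rw [hb']; linarith)
  set ρ := min (deriv f a - deriv f a') (deriv f b' - deriv f b) / 2 with hρ
  have hρ0 : 0 < ρ := half_pos (lt_min (by linarith) (by linarith))
  have hmin1 := min_le_left (deriv f a - deriv f a') (deriv f b' - deriv f b)
  have hmin2 := min_le_right (deriv f a - deriv f a') (deriv f b' - deriv f b)
  have hρ1 : 2 * ρ ≤ deriv f a - deriv f a' := by rw [hρ]; linarith
  have hρ2 : 2 * ρ ≤ deriv f b' - deriv f b := by rw [hρ]; linarith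
  have hex : ∀ y₀ ∈ Icc (deriv f a) (deriv f b), ∀ y, |y - y₀| ≤ 2 * ρ →
      ∃ p ∈ Icc a' b', deriv f p = y := by
    intro y₀ hy₀ y hy
    have := abs_le.1 hy
    exact exists_deriv_eq_of_mem_Icc hC ha0 (by rw [ha', hb']; linarith)
      ⟨by linarith [hy₀.1], by linarith [hy₀.2]⟩
  have hin : ∀ p ∈ Icc a' b', 0 < p := fun p hp => hsub hp
  have hLip : ∀ p ∈ Icc a' b', ∀ q ∈ Icc a' b', |p - q| ≤ m⁻¹ * |deriv f p - deriv f q| := by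
    intro p hp q hq
    rw [inv_mul_eq_div, le_div_iff₀ hm0]
    rcases le_total p q with h | h
    · rw [abs_sub_comm p, abs_sub_comm (deriv f p), abs_of_nonneg (by linarith)]
      exact le_trans (by linarith [hlow p hp q hq h]) (le_abs_self _)
    · rw [abs_of_nonneg (by linarith)]
      exact le_trans (by linarith [hlow q hq p hp h]) (le_abs_self _)
  -- Going through the midpoint `z`, the tangents at `p` and at `z` give the quadratic bound.
  have hquad : ∀ p ∈ Icc a' b', ∀ q ∈ Icc a' b',
      (p * deriv f p - f p) + p * (deriv f q - deriv f p) +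
        (4 * N)⁻¹ * (deriv f q - deriv f p) ^ 2 ≤ q * deriv f q - f q := by
    intro p hp q hq
    obtain ⟨r, hr, hrz⟩ : ∃ r ∈ Icc a' b', deriv f r = (deriv f p + deriv f q) / 2 := by
      have hm1 := hmono.monotoneOn (hin a' ⟨le_rfl, hp.1.trans hp.2⟩) (hin p hp) hp.1
      have hm2 := hmono.monotoneOn (hin a' ⟨le_rfl, hp.1.trans hp.2⟩) (hin q hq) hq.1
      have hm3 := hmono.monotoneOn (hin p hp) (hin b' ⟨hp.1.trans hp.2, le_rfl⟩) hp.2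
      have hm4 := hmono.monotoneOn (hin q hq) (hin b' ⟨hp.1.trans hp.2, le_rfl⟩) hq.2
      exact exists_deriv_eq_of_mem_Icc hC ha0 (hp.1.trans hp.2) ⟨by linarith, by linarith⟩
    have t1 := deriv_mul_sub_le hf hC (hin q hq) (hin r hr)
    have t2 := deriv_mul_sub_le hf hC (hin r hr) (hin p hp)
    -- With `z = f'(r)` and `y = f'(p)`, the bound `f'' ≤ N` gives `(r - p) (z - y) ≥ (z - y)² / N`.
    have t3 : (deriv f r - deriv f p) ^ 2 ≤ N * ((r - p) * (deriv f r - deriv f p)) := by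
      rcases le_total p r with h | h
      · have h1 := hup p hp r hr h
        have h2 := hmono.monotoneOn (hin p hp) (hin r hr) h
        nlinarith
      · have h1 := hup r hr p hp h
        have h2 := hmono.monotoneOn (hin r hr) (hin p hp) h
        nlinarith
    have t4 : (4 * N)⁻¹ * (deriv f q - deriv f p) ^ 2 ≤ (r - p) * (deriv f r - deriv f p) := by
      rw [inv_mul_le_iff₀ (by positivity)]
      have : (deriv f q - deriv f p) ^ 2 = 4 * (deriv f r - deriv f p) ^ 2 := by rw [hrz]; ring
      rw [this]; linarith
    have hq' : deriv f q = 2 * deriv f r - deriv f p := by rw [hrz]; ring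
    rw [hq'] at t1 t4 ⊢
    nlinarith
  refine ⟨ρ, (4 * N)⁻¹, m⁻¹, hρ0, by positivity, by positivity, fun y₀ hy₀ => ⟨fun y hy => ?_, ?_⟩⟩
  · have hcl : ∀ x, |x| ≤ ρ → |y + x - y₀| ≤ 2 * ρ := fun x hx => by
      have h1 : y + x - y₀ = (y - y₀) + x := by ring
      rw [h1]; linarith [abs_add_le (y - y₀) x]
    obtain ⟨p, hp, hpy⟩ := hex y₀ hy₀ y (by linarith)
    refine HasStrongTangent.mk_of_le hρ0.le (fun x hx => ?_) (fun x hx => ?_) (fun x hx => ?_)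
    all_goals obtain ⟨q, hq, hqy⟩ := hex y₀ hy₀ (y + x) (hcl x hx)
    · rw [← hqy, conj_deriv hf hC (hin q hq)]; exact EReal.coe_ne_top _
    · rw [← hqy]; exact (hasDerivAt_conj hf hC (hin q hq)).continuousAt
    · have hx' : x = deriv f q - deriv f p := by rw [hqy, hpy]; ring
      rw [← hqy, ← hpy, conj_deriv hf hC (hin q hq), conj_deriv hf hC (hin p hp),
        conjDeriv_deriv hf hC (hin p hp), EReal.toReal_coe, EReal.toReal_coe, hx']
      exact hquad p hp q hq
  · intro y y' hy hy'
    obtain ⟨p, hp, hpy⟩ := hex y₀ hy₀ y (by linarith)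
    obtain ⟨q, hq, hqy⟩ := hex y₀ hy₀ y' (by linarith)
    rw [← hpy, ← hqy, conjDeriv_deriv hf hC (hin p hp), conjDeriv_deriv hf hC (hin q hq)]
    exact hLip p hp q hq

lemma IsEntropy.conj_eq (hE : IsEntropy f) (hf : StrictConvexOn ℝ (Ioi 0) f)
    (hC : ContDiffOn ℝ 2 f (Ioi 0)) (y : ℝ) : conj f y = (Real.exp (y - 1) : EReal) := by
  have hp := Real.exp_pos (y - 1)
  have hd : deriv f (Real.exp (y - 1)) = y := by
    have heq : f =ᶠ[𝓝 (Real.exp (y - 1))] fun x => x * Real.log x := by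
      filter_upwards [Ioi_mem_nhds hp] with x hx using hE x hx
    rw [heq.deriv_eq, Real.deriv_mul_log hp.ne', Real.log_exp]; ring
  have h := conj_deriv hf hC hp
  rw [hd, hE _ hp, Real.log_exp] at h
  rw [h]; congr 1; ring

lemma IsEntropy.toReal_conj (hE : IsEntropy f) (hf : StrictConvexOn ℝ (Ioi 0) f)
    (hC : ContDiffOn ℝ 2 f (Ioi 0)) : (fun y => (conj f y).toReal) = fun y => Real.exp (y - 1) :=
  funext fun y => by rw [hE.conj_eq hf hC, EReal.toReal_coe]

lemma IsEntropy.conjDeriv_eq (hE : IsEntropy f) (hf : StrictConvexOn ℝ (Ioi 0) f)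
    (hC : ContDiffOn ℝ 2 f (Ioi 0)) (y : ℝ) : conjDeriv f y = Real.exp (y - 1) := by
  rw [conjDeriv, hE.toReal_conj hf hC]
  simp

lemma one_add_add_sq_le_exp {x : ℝ} (hx : |x| ≤ 1) : 1 + x + x ^ 2 / 4 ≤ Real.exp x := by
  have h := Real.exp_bound hx (n := 3) (by norm_num)
  simp only [Finset.sum_range_succ, Finset.sum_range_zero, Nat.factorial] at h
  norm_num at h
  have h1 := (abs_le.1 h).1
  have h2 : |x| ^ 3 ≤ x ^ 2 := by
    rw [← sq_abs x]
    exact pow_le_pow_of_le_one (abs_nonneg x) hx (by norm_num)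
  nlinarith [sq_nonneg x]

lemma IsEntropy.hasStrongTangent (hE : IsEntropy f) (hf : StrictConvexOn ℝ (Ioi 0) f)
    (hC : ContDiffOn ℝ 2 f (Ioi 0)) (y : ℝ) :
    HasStrongTangent f y 1 (Real.exp (y - 1) / 4) := by
  refine HasStrongTangent.mk_of_le zero_le_one (fun x _ => ?_) (fun x _ => ?_) (fun x hx => ?_)
  · rw [hE.conj_eq hf hC]; exact EReal.coe_ne_top _
  · rw [hE.toReal_conj hf hC]
    exact (Real.continuous_exp.comp (continuous_id.sub continuous_const)).continuousAt
  · rw [hE.conj_eq hf hC, hE.conj_eq hf hC, hE.conjDeriv_eq hf hC, EReal.toReal_coe,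
      EReal.toReal_coe, show y + x - 1 = (y - 1) + x by ring, Real.exp_add (y - 1) x]
    have := mul_le_mul_of_nonneg_left (one_add_add_sq_le_exp hx) (Real.exp_pos (y - 1)).le
    linarith

end Conjugate

/-! ### Minimizers of penalized sums of conjugates -/

section Localization

variable {ι E : Type*} [Fintype ι] [NormedAddCommGroup E] [InnerProductSpace ℝ E]
  {f : ℝ → ℝ} {u : ι → E} {A : ι → Prop} [DecidablePred A]

/-- The objective `∑_{i ∈ A} f̃*(⟨θ, u i⟩) + √δ ‖θ‖`. -/
noncomputable def penObj (f : ℝ → ℝ) (u : ι → E) (A : ι → Prop) [DecidablePred A] (δ : ℝ)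
    (θ : E) : EReal :=
  (∑ i, if A i then conj f (inner ℝ θ (u i)) else 0) + ((√δ * ‖θ‖ : ℝ) : EReal)

lemma coe_sum_add_le_penObj {δ : ℝ} {θ : E} {v : ι → ℝ}
    (h : ∀ i, A i → (v i : EReal) ≤ conj f (inner ℝ θ (u i))) :
    ((∑ i, (if A i then v i else 0) + √δ * ‖θ‖ : ℝ) : EReal) ≤ penObj f u A δ θ := by
  rw [EReal.coe_add, penObj, show ((∑ i, if A i then v i else 0 : ℝ) : EReal) =
    ∑ i, ((if A i then v i else 0 : ℝ) : EReal) from map_sum (⟨⟨Real.toEReal, EReal.coe_zero⟩,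
      EReal.coe_add⟩ : ℝ →+ EReal) _ _]
  refine add_le_add (Finset.sum_le_sum fun i _ => ?_) le_rfl
  by_cases hi : A i
  · simpa [hi] using h i hi
  · simp [hi]

lemma penObj_eq_coe {δ : ℝ} {θ : E} (h : ∀ i, A i → conj f (inner ℝ θ (u i)) ≠ ⊤) :
    penObj f u A δ θ =
      ((∑ i, (if A i then (conj f (inner ℝ θ (u i))).toReal else 0) + √δ * ‖θ‖ : ℝ) : EReal) := by
  rw [EReal.coe_add, penObj, show ((∑ i, if A i then (conj f (inner ℝ θ (u i))).toReal else 0 : ℝ) :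
    EReal) = ∑ i, ((if A i then (conj f (inner ℝ θ (u i))).toReal else 0 : ℝ) : EReal) from
      map_sum (⟨⟨Real.toEReal, EReal.coe_zero⟩, EReal.coe_add⟩ : ℝ →+ EReal) _ _]
  congr 1
  refine Finset.sum_congr rfl fun i _ => ?_
  by_cases hi : A i
  · simp [hi, EReal.coe_toReal (h i hi) (conj_ne_bot f _)]
  · simp [hi]

/-- If the objective has strong tangents at `θ₁` whose total curvature dominates its gradient at
`θ₁`, then it has minimizers, and they are close to `θ₁`. -/
lemma penObj_localization [FiniteDimensional ℝ E] {θ₁ : E} {ρ r Λ δ : ℝ} {c : ι → ℝ} (hr : 0 < r)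
    (hst : ∀ i, A i → HasStrongTangent f (inner ℝ θ₁ (u i)) ρ (c i))
    (hsmall : ∀ i, A i → r * ‖u i‖ ≤ ρ)
    (hquad : ∀ h : E, Λ * ‖h‖ ^ 2 ≤ ∑ i, if A i then c i * inner ℝ h (u i) ^ 2 else 0)
    (hS : ‖∑ i, if A i then conjDeriv f (inner ℝ θ₁ (u i)) • u i else 0‖ + √δ < Λ * r) :
    (∃ θ, IsMinOn (penObj f u A δ) univ θ) ∧
      ∀ θ, IsMinOn (penObj f u A δ) univ θ → ‖θ - θ₁‖ ≤ r := by
  set S := ∑ i, if A i then conjDeriv f (inner ℝ θ₁ (u i)) • u i else 0 with hSdef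
  set F : ℝ → ℝ := fun y => (conj f y).toReal with hF
  have hinner : ∀ h i, A i → ‖h‖ ≤ r → |inner ℝ h (u i)| ≤ ρ := fun h i hi hh =>
    (abs_real_inner_le_norm h (u i)).trans
      ((mul_le_mul_of_nonneg_right hh (norm_nonneg _)).trans (hsmall i hi))
  have hfin : ∀ θ, ‖θ - θ₁‖ ≤ r → ∀ i, A i → conj f (inner ℝ θ (u i)) ≠ ⊤ := by
    intro θ hθ i hi
    have := (hst i hi).ne_top _ (hinner (θ - θ₁) i hi hθ)
    rwa [← inner_add_left, add_sub_cancel] at this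
  have hfar : ∀ h, r ≤ ‖h‖ → penObj f u A δ θ₁ < penObj f u A δ (θ₁ + h) := by
    intro h hh
    have hh0 : 0 < ‖h‖ := hr.trans_le hh
    have hs : 0 < r / ‖h‖ := by positivity
    have hs1 : r / ‖h‖ ≤ 1 := (div_le_one hh0).2 hh
    have hnorm : ‖(r / ‖h‖) • h‖ ≤ r := by
      rw [norm_smul, Real.norm_of_nonneg hs.le, div_mul_cancel₀ _ hh0.ne']
    refine lt_of_lt_of_le ?_ (coe_sum_add_le_penObj (v := fun i => F (inner ℝ θ₁ (u i)) +
      conjDeriv f (inner ℝ θ₁ (u i)) * inner ℝ h (u i) +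
        c i * (r / ‖h‖) * inner ℝ h (u i) ^ 2) fun i hi => ?_)
    · rw [penObj_eq_coe (hfin θ₁ (by simpa using hr.le)), EReal.coe_lt_coe_iff]
      have hsplit : (∑ i, if A i then F (inner ℝ θ₁ (u i)) +
          conjDeriv f (inner ℝ θ₁ (u i)) * inner ℝ h (u i) +
            c i * (r / ‖h‖) * inner ℝ h (u i) ^ 2 else 0) =
          (∑ i, if A i then F (inner ℝ θ₁ (u i)) else 0) + inner ℝ h S +
            (r / ‖h‖) * ∑ i, if A i then c i * inner ℝ h (u i) ^ 2 else 0 := by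
        rw [hSdef, inner_sum, Finset.mul_sum, ← Finset.sum_add_distrib, ← Finset.sum_add_distrib]
        refine Finset.sum_congr rfl fun i _ => ?_
        by_cases hi : A i
        · simp only [hi, if_true, inner_smul_right]; ring
        · simp [hi]
      rw [hsplit]
      have h1 : -(‖h‖ * ‖S‖) ≤ inner ℝ h S := (abs_le.1 (abs_real_inner_le_norm h S)).1
      have h2 : r * Λ * ‖h‖ ≤
          (r / ‖h‖) * ∑ i, if A i then c i * inner ℝ h (u i) ^ 2 else 0 := by
        refine le_trans (le_of_eq ?_) (mul_le_mul_of_nonneg_left (hquad h) hs.le)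
        field_simp
      have h3 : ‖θ₁‖ - ‖h‖ ≤ ‖θ₁ + h‖ := by
        have := norm_sub_norm_le θ₁ (-h)
        rwa [norm_neg, sub_neg_eq_add] at this
      have h4 := mul_le_mul_of_nonneg_left h3 (Real.sqrt_nonneg δ)
      have h5 := mul_lt_mul_of_pos_right hS hh0
      simp only [hF] at *
      nlinarith
    · rw [inner_add_left]
      refine (hst i hi).le_conj _ _ hs hs1 ?_
      rw [← real_inner_smul_left]
      exact hinner _ i hi hnorm
  refine ⟨?_, fun θ hθ => ?_⟩
  · have hcont : ContinuousOn (fun θ => ∑ i, (if A i then F (inner ℝ θ (u i)) else 0) + √δ * ‖θ‖)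
        (Metric.closedBall θ₁ r) := by
      refine ContinuousOn.add (continuousOn_finsetSum _ fun i _ => ?_) (by fun_prop)
      by_cases hi : A i
      · simp only [hi, if_true]
        intro θ hθ
        have hc := (hst i hi).continuousAt _ (hinner (θ - θ₁) i hi (mem_closedBall_iff_norm.1 hθ))
        rw [← inner_add_left, add_sub_cancel] at hc
        exact (ContinuousAt.comp (f := fun θ => inner ℝ θ (u i)) hc
          (by fun_prop)).continuousWithinAt
      · simp only [hi, if_false]; exact continuousOn_const
    have : ProperSpace E := FiniteDimensional.proper ℝ E
    obtain ⟨θ, hθ, hmin⟩ := (isCompact_closedBall θ₁ r).exists_isMinOn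
      ⟨θ₁, Metric.mem_closedBall_self hr.le⟩ hcont
    have hin : ∀ η ∈ Metric.closedBall θ₁ r, penObj f u A δ θ ≤ penObj f u A δ η := by
      intro η hη
      rw [penObj_eq_coe (hfin η (mem_closedBall_iff_norm.1 hη)),
        penObj_eq_coe (hfin θ (mem_closedBall_iff_norm.1 hθ)), EReal.coe_le_coe_iff]
      exact hmin hη
    refine ⟨θ, fun η _ => ?_⟩
    rcases le_total ‖η - θ₁‖ r with h | h
    · exact hin η (mem_closedBall_iff_norm.2 h)
    · have := hfar _ h
      rw [add_sub_cancel] at this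
      exact (hin θ₁ (Metric.mem_closedBall_self hr.le)).trans this.le
  · by_contra! hlt
    have := hfar _ hlt.le
    rw [add_sub_cancel] at this
    exact absurd (hθ (mem_univ θ₁)) (not_le.2 this)

/-- First-order condition: the penalty bounds the gradient of the exponential part at a
minimizer. -/
lemma norm_sum_exp_smul_le_of_isMinOn {δ : ℝ} (hconj : ∀ y, conj f y = (Real.exp (y - 1) : EReal))
    {θ : E} (hθ : IsMinOn (penObj f u A δ) univ θ) :
    ‖∑ i, if A i then Real.exp (inner ℝ θ (u i) - 1) • u i else 0‖ ≤ √δ := by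
  set S := ∑ i, if A i then Real.exp (inner ℝ θ (u i) - 1) • u i else 0 with hS
  have hobj : ∀ η, penObj f u A δ η =
      ((∑ i, (if A i then Real.exp (inner ℝ η (u i) - 1) else 0) + √δ * ‖η‖ : ℝ) : EReal) := by
    intro η
    rw [penObj_eq_coe fun i _ => by rw [hconj]; exact EReal.coe_ne_top _]
    simp only [hconj, EReal.toReal_coe]
  -- Move from `θ` in the direction `-S`.
  set φ : ℝ → ℝ := fun s =>
    ∑ i, (if A i then Real.exp (inner ℝ θ (u i) + s * (-inner ℝ S (u i)) - 1) else 0) +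
      s * (√δ * ‖S‖)
    with hφ
  have hge : ∀ s, 0 ≤ s → φ 0 ≤ φ s := by
    intro s hs
    have h1 := hθ (mem_univ (θ + s • (-S)))
    simp only [mem_ofPred_eq, hobj, EReal.coe_le_coe_iff, inner_add_left, inner_smul_left,
      inner_neg_left, RCLike.conj_to_real] at h1
    have h2 : ‖θ + s • (-S)‖ ≤ ‖θ‖ + s * ‖S‖ := by
      refine (norm_add_le _ _).trans_eq ?_
      rw [norm_smul, norm_neg, Real.norm_of_nonneg hs]
    have h3 := mul_le_mul_of_nonneg_left h2 (Real.sqrt_nonneg δ)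
    simp only [hφ, zero_mul, add_zero]
    linarith
  have hder : HasDerivAt φ (inner ℝ S (-S) + √δ * ‖S‖) 0 := by
    have h1 : ∀ i, HasDerivAt
        (fun s : ℝ => if A i then Real.exp (inner ℝ θ (u i) + s * (-inner ℝ S (u i)) - 1) else 0)
        (if A i then Real.exp (inner ℝ θ (u i) - 1) * (-inner ℝ S (u i)) else 0) 0 := by
      intro i
      by_cases hi : A i
      · simp only [hi, if_true]
        have := ((((hasDerivAt_id (0 : ℝ)).mul_const (-inner ℝ S (u i))).const_add
          (inner ℝ θ (u i))).sub_const 1).exp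
        simpa using this
      · simp only [hi, if_false]; exact hasDerivAt_const _ _
    have h2 := (HasDerivAt.fun_sum fun i (_ : i ∈ Finset.univ) => h1 i).add
      ((hasDerivAt_id (0 : ℝ)).mul_const (√δ * ‖S‖))
    have heq : inner ℝ S (-S) =
        ∑ i, if A i then Real.exp (inner ℝ θ (u i) - 1) * (-inner ℝ S (u i)) else 0 := by
      rw [inner_neg_right]
      conv_lhs => rw [hS, ← hS, inner_sum]
      rw [← Finset.sum_neg_distrib]
      refine Finset.sum_congr rfl fun i _ => ?_
      by_cases hi : A i
      · simp only [hi, if_true, inner_smul_right]; ring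
      · simp [hi]
    rw [heq]
    rw [one_mul] at h2
    exact h2
  have hnonneg : 0 ≤ inner ℝ S (-S) + √δ * ‖S‖ := by
    refine ge_of_tendsto hder.tendsto_slope_zero_right ?_
    filter_upwards [self_mem_nhdsWithin] with s hs
    have hs' : (0 : ℝ) < s := hs
    have := hge s hs'.le
    rw [zero_add, smul_eq_mul]
    exact mul_nonneg (inv_nonneg.2 hs'.le) (sub_nonneg.2 this)
  rw [inner_neg_right, real_inner_self_eq_norm_sq] at hnonneg
  by_contra! hlt
  have hSpos : 0 < ‖S‖ := (Real.sqrt_nonneg δ).trans_lt hlt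
  nlinarith

end Localization

/-! ### Localization of the dual solution -/

section DualLocalization

variable {Ω : Type*} [MeasurableSpace Ω] {P : Measure Ω} [IsProbabilityMeasure P]
  {𝒟 : Type*} [MeasurableSpace 𝒟] {D : ℕ → Ω → 𝒟} {K : ℕ} {U : 𝒟 → EuclideanSpace ℝ (Fin K)}

/-- The `i`-th value of `U`, centred at the sample mean. -/
noncomputable def recentered {Ω 𝒟 : Type*} {K : ℕ} (D : ℕ → Ω → 𝒟)
    (U : 𝒟 → EuclideanSpace ℝ (Fin K)) (n : ℕ) (ω : Ω) (i : Fin n) : EuclideanSpace ℝ (Fin K) :=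
  U (D i ω) - sampleMean D U n ω

/-- A positive definite weighted second moment matrix stays uniformly positive definite in the
sample, after centring at the sample mean. -/
lemma exists_whp_le_sum_inner_sq (hind : iIndepFun D P)
    (hid : ∀ i, IdentDistrib (D i) (D 0) P P) (hU : Measurable U)
    (hUint : Integrable (fun ω => U (D 0 ω)) P) (hU0 : ∫ ω, U (D 0 ω) ∂P = 0)
    {a : 𝒟 → ℝ} (ha : Measurable a) (ha0 : ∀ z, 0 ≤ a z)
    (haint : Integrable (fun ω => a (D 0 ω)) P)
    (haU : Integrable (fun ω => a (D 0 ω) * ‖U (D 0 ω)‖ ^ 2) P)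
    (hpos : ∀ h : EuclideanSpace ℝ (Fin K), h ≠ 0 →
      0 < ∫ ω, a (D 0 ω) * inner ℝ h (U (D 0 ω)) ^ 2 ∂P) :
    ∃ Λ : ℝ, 0 < Λ ∧ WHP P (fun n ω => ∀ h : EuclideanSpace ℝ (Fin K),
      Λ * n * ‖h‖ ^ 2 ≤ ∑ i : Fin n, a (D i ω) * inner ℝ h (recentered D U n ω i) ^ 2) := by
  set B : 𝒟 → (EuclideanSpace ℝ (Fin K) →L[ℝ] EuclideanSpace ℝ (Fin K)) :=
    fun z => a z • InnerProductSpace.rankOne ℝ (U z) (U z) with hB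
  have hBm : Measurable B := by
    refine ha.smul (Continuous.measurable (f := fun v : EuclideanSpace ℝ (Fin K) =>
      InnerProductSpace.rankOne ℝ v v) ?_ |>.comp hU)
    exact ((InnerProductSpace.rankOne ℝ).continuous.clm_apply continuous_id)
  have hDm := (hid 0).aemeasurable_fst
  have hBint : Integrable (fun ω => B (D 0 ω)) P := by
    refine haU.mono' (hBm.comp_aemeasurable hDm).aestronglyMeasurable (ae_of_all _ fun ω => ?_)
    simp only [hB, norm_smul, InnerProductSpace.norm_rankOne, Real.norm_of_nonneg (ha0 _)]
    rw [pow_two]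
  have hBq : ∀ (z : 𝒟) (h : EuclideanSpace ℝ (Fin K)),
      inner ℝ h (B z h) = a z * inner ℝ h (U z) ^ 2 := by
    intro z h
    simp only [hB, _root_.smul_apply, InnerProductSpace.rankOne_apply,
      inner_smul_right, real_inner_comm h (U z)]
    ring
  set M := ∫ ω, B (D 0 ω) ∂P with hM
  have hMq : ∀ h, inner ℝ h (M h) = ∫ ω, a (D 0 ω) * inner ℝ h (U (D 0 ω)) ^ 2 ∂P := by
    intro h
    rw [hM, ContinuousLinearMap.integral_apply hBint,
      ← integral_inner (hBint.apply_continuousLinearMap h)]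
    simp only [hBq]
  obtain ⟨lam, hlam, hMlow⟩ : ∃ lam : ℝ, 0 < lam ∧ ∀ h, lam * ‖h‖ ^ 2 ≤ inner ℝ h (M h) := by
    rcases isEmpty_or_nonempty (Fin K) with hK | hK
    · refine ⟨1, one_pos, fun h => ?_⟩
      have : h = 0 := Subsingleton.elim _ _
      simp [this]
    · obtain ⟨h₀, hh₀, hmin⟩ := (isCompact_sphere (0 : EuclideanSpace ℝ (Fin K)) 1).exists_isMinOn
        (NormedSpace.sphere_nonempty.2 zero_le_one)
        (f := fun h => inner ℝ h (M h)) (by fun_prop)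
      have hh₀' : ‖h₀‖ = 1 := by simpa using hh₀
      refine ⟨inner ℝ h₀ (M h₀), ?_, fun h => ?_⟩
      · rw [hMq]; exact hpos h₀ (by rintro rfl; simp at hh₀')
      · rcases eq_or_ne h 0 with rfl | hne
        · simp
        · have hn : 0 < ‖h‖ := norm_pos_iff.2 hne
          have h1 := hmin (a := ‖h‖⁻¹ • h) (by
            rw [mem_sphere_zero_iff_norm, norm_smul, norm_inv, norm_norm, inv_mul_cancel₀ hn.ne'])
          simp only [mem_ofPred_eq, map_smul, inner_smul_left, inner_smul_right,
            RCLike.conj_to_real] at h1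
          rw [← le_div_iff₀ (by positivity)]
          refine h1.trans_eq ?_
          field_simp
  set C := ∫ ω, a (D 0 ω) ∂P + 1 with hC
  have hC0 : 0 < C := by
    have : 0 ≤ ∫ ω, a (D 0 ω) ∂P := integral_nonneg fun ω => ha0 _
    linarith
  refine ⟨lam / 4, by positivity, ?_⟩
  have e1 := whp_sampleMean hind hid hBm hBint (ε := lam / 4) (by positivity)
  have e2 := whp_sampleMean hind hid ha haint one_pos
  have e3 := whp_sampleMean hind hid hU hUint (ε := √(lam / (8 * C))) (by positivity)
  refine ((e1.and e2).and e3).mono ?_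
  filter_upwards [eventually_gt_atTop 0] with n hn ω hω h
  obtain ⟨⟨h1, h2⟩, h3⟩ := hω
  have hn' : (0 : ℝ) < n := by exact_mod_cast hn
  set d := sampleMean D U n ω with hd
  rw [hU0, sub_zero] at h3
  have h3' : ‖d‖ ^ 2 ≤ lam / (8 * C) := (Real.le_sqrt (norm_nonneg _) (by positivity)).1 h3
  have hsumB : inner ℝ h (sampleMean D B n ω h) =
      (n : ℝ)⁻¹ * ∑ i : Fin n, a (D i ω) * inner ℝ h (U (D i ω)) ^ 2 := by
    simp only [sampleMean, _root_.smul_apply, _root_.sum_apply,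
      inner_smul_right, inner_sum, hBq]
  have hBlow : 3 * lam / 4 * ‖h‖ ^ 2 ≤
      (n : ℝ)⁻¹ * ∑ i : Fin n, a (D i ω) * inner ℝ h (U (D i ω)) ^ 2 := by
    rw [← hsumB]
    have k1 : |inner ℝ h ((sampleMean D B n ω - M) h)| ≤ lam / 4 * ‖h‖ ^ 2 := by
      refine (abs_real_inner_le_norm _ _).trans ?_
      have := (ContinuousLinearMap.le_opNorm (sampleMean D B n ω - M) h).trans
        (mul_le_mul_of_nonneg_right h1 (norm_nonneg h))
      nlinarith [mul_le_mul_of_nonneg_left this (norm_nonneg h)]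
    rw [_root_.sub_apply, inner_sub_right] at k1
    linarith [(abs_le.1 k1).1, hMlow h]
  have hsuma : (n : ℝ)⁻¹ * ∑ i : Fin n, a (D i ω) ≤ C := by
    have := (abs_le.1 h2).2
    simp only [sampleMean, smul_eq_mul] at this
    linarith
  have hterm : ∀ i : Fin n,
      a (D i ω) * inner ℝ h (U (D i ω)) ^ 2 / 2 - a (D i ω) * inner ℝ h d ^ 2 ≤
      a (D i ω) * inner ℝ h (recentered D U n ω i) ^ 2 := by
    intro i
    rw [recentered, inner_sub_right]
    have := ha0 (D i ω)
    nlinarith [mul_nonneg this (sq_nonneg (inner ℝ h (U (D i ω)) - 2 * inner ℝ h d))]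
  have hsum := Finset.sum_le_sum fun i (_ : i ∈ Finset.univ) => hterm i
  rw [Finset.sum_sub_distrib, ← Finset.sum_div, ← Finset.sum_mul] at hsum
  refine le_trans ?_ hsum
  have k2 : inner ℝ h d ^ 2 ≤ lam / (8 * C) * ‖h‖ ^ 2 := by
    rw [← sq_abs]
    calc |inner ℝ h d| ^ 2 ≤ (‖h‖ * ‖d‖) ^ 2 := by
          gcongr; exact abs_real_inner_le_norm _ _
      _ = ‖d‖ ^ 2 * ‖h‖ ^ 2 := by ring
      _ ≤ _ := by gcongr
  have k3 : (∑ i : Fin n, a (D i ω)) * inner ℝ h d ^ 2 ≤ n * (lam / 8 * ‖h‖ ^ 2) := by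
    have k4 : ∑ i : Fin n, a (D i ω) ≤ n * C := by
      rwa [inv_mul_le_iff₀ hn'] at hsuma
    calc _ ≤ (n * C) * (lam / (8 * C) * ‖h‖ ^ 2) := by gcongr
      _ = _ := by field_simp
  have k5 : n * (3 * lam / 4 * ‖h‖ ^ 2) ≤ ∑ i : Fin n, a (D i ω) * inner ℝ h (U (D i ω)) ^ 2 := by
    rwa [le_inv_mul_iff₀ hn'] at hBlow
  nlinarith

/-- The arm `t` of the sample, in the objective of the dual problem of the recentered data. -/
noncomputable def samplePenObj {Ω 𝒟 : Type*} {K : ℕ} (f : ℝ → ℝ) (D : ℕ → Ω → 𝒟)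
    (U : 𝒟 → EuclideanSpace ℝ (Fin K)) (s : 𝒟 → Bool) (t : Bool) (δ : ℝ) (n : ℕ) (ω : Ω) :
    EuclideanSpace ℝ (Fin K) → EReal :=
  penObj f (recentered D U n ω) (fun i => s (D i ω) = t) δ

/-- The gradient at `θ` of the unpenalized objective, divided by `n`. -/
noncomputable def sampleGrad {Ω 𝒟 : Type*} {K : ℕ} (f : ℝ → ℝ) (D : ℕ → Ω → 𝒟)
    (U : 𝒟 → EuclideanSpace ℝ (Fin K)) (s : 𝒟 → Bool) (t : Bool)
    (θ : EuclideanSpace ℝ (Fin K)) (n : ℕ) (ω : Ω) : EuclideanSpace ℝ (Fin K) :=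
  (n : ℝ)⁻¹ • ∑ i : Fin n, if s (D i ω) = t then
    conjDeriv f (inner ℝ θ (recentered D U n ω i)) • recentered D U n ω i else 0

lemma norm_sampleMean_le_of_forall {Ω 𝒟 : Type*} {K : ℕ} {D : ℕ → Ω → 𝒟}
    {U : 𝒟 → EuclideanSpace ℝ (Fin K)} {n : ℕ} {ω : Ω} {b : ℝ} (hn : 0 < n)
    (h : ∀ i : Fin n, ‖U (D i ω)‖ ≤ b) : ‖sampleMean D U n ω‖ ≤ b := by
  have hn' : (0 : ℝ) < n := by exact_mod_cast hn
  rw [sampleMean, norm_smul, norm_inv, Real.norm_of_nonneg hn'.le, inv_mul_le_iff₀ hn']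
  refine (norm_sum_le_of_le _ fun i _ => h i).trans ?_
  simp

/-- The dual solution is within `O_p(n^{-1/2})` of a point at which the gradient of the objective
is `O_p(n^{1/2})` and the objective has strong tangents of nondegenerate curvature. -/
lemma dual_localization (hind : iIndepFun D P)
    (hid : ∀ i, IdentDistrib (D i) (D 0) P P) (hU : Measurable U)
    (hU2 : MemLp (fun ω => U (D 0 ω)) 2 P) (hU0 : ∫ ω, U (D 0 ω) ∂P = 0)
    {s : 𝒟 → Bool} {t : Bool} {a : 𝒟 → ℝ} (ha : Measurable a) (ha0 : ∀ z, 0 ≤ a z)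
    (has : ∀ z, s z ≠ t → a z = 0)
    (haint : Integrable (fun ω => a (D 0 ω)) P)
    (haU : Integrable (fun ω => a (D 0 ω) * ‖U (D 0 ω)‖ ^ 2) P)
    (hpos : ∀ h : EuclideanSpace ℝ (Fin K), h ≠ 0 →
      0 < ∫ ω, a (D 0 ω) * inner ℝ h (U (D 0 ω)) ^ 2 ∂P)
    {f : ℝ → ℝ} {δ : ℕ → ℝ} (hδ : δ =o[atTop] (fun n : ℕ => (n : ℝ)))
    {θ₁ : EuclideanSpace ℝ (Fin K)} {κ ρ : ℝ} (hκ : 0 < κ) (hρ : 0 < ρ)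
    (hst : WHP P (fun n ω => ∀ i : Fin n, s (D i ω) = t →
      HasStrongTangent f (inner ℝ θ₁ (recentered D U n ω i)) ρ (κ * a (D i ω))))
    (hS : BddP P (fun n ω => √n * ‖sampleGrad f D U s t θ₁ n ω‖))
    {θhat : ℕ → Ω → EuclideanSpace ℝ (Fin K)}
    (hθ : ∀ n ω, (∃ θ, IsMinOn (samplePenObj f D U s t (δ n) n ω) univ θ) →
      IsMinOn (samplePenObj f D U s t (δ n) n ω) univ (θhat n ω)) :
    WHP P (fun n ω => IsMinOn (samplePenObj f D U s t (δ n) n ω) univ (θhat n ω)) ∧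
      BddP P (fun n ω => √n * ‖θhat n ω - θ₁‖) ∧
      ∀ ε : ℝ, 0 < ε →
        WHP P (fun n ω => ∀ i : Fin n, |inner ℝ (θhat n ω - θ₁) (U (D i ω))| ≤ ε) := by
  obtain ⟨Λ, hΛ, hquad⟩ := exists_whp_le_sum_inner_sq hind hid hU (hU2.integrable one_le_two) hU0 ha
    ha0 haint haU hpos
  have hmax : ∀ ε : ℝ, 0 < ε → WHP P (fun n ω => ∀ i : Fin n, ‖U (D i ω)‖ ≤ ε * √n) :=
    fun ε hε => by
      simpa only [abs_norm] using whp_forall_le_sqrt hid hU.norm hU2.norm hε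
  have hδ' : ∀ᶠ n : ℕ in atTop, √(δ n) ≤ √n := by
    filter_upwards [hδ.bound one_pos] with n hn
    refine Real.sqrt_le_sqrt ((le_abs_self _).trans ?_)
    simpa using hn
  have hmain : ∀ M : ℝ, 0 ≤ M → ∃ M' : ℝ, 0 < M' ∧ WHP P (fun n ω =>
      |√n * ‖sampleGrad f D U s t θ₁ n ω‖| ≤ M →
        IsMinOn (samplePenObj f D U s t (δ n) n ω) univ (θhat n ω) ∧
          √n * ‖θhat n ω - θ₁‖ ≤ M') := by
    intro M hM
    set M' := (M + 2) / (κ * Λ) with hM'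
    have hM0 : 0 < M' := by positivity
    refine ⟨M', hM0, ((hquad.and hst).and (hmax (ρ / (2 * M')) (by positivity))).mono ?_⟩
    filter_upwards [eventually_gt_atTop 0, hδ'] with n hn hδn ω hω hW
    obtain ⟨⟨h1, h2⟩, h3⟩ := hω
    have hn' : (0 : ℝ) < n := by exact_mod_cast hn
    have hsn : 0 < √(n : ℝ) := Real.sqrt_pos.2 hn'
    have hss : √(n : ℝ) * √n = n := Real.mul_self_sqrt hn'.le
    have hd := norm_sampleMean_le_of_forall hn h3
    have hloc := penObj_localization (f := f) (u := recentered D U n ω)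
      (A := fun i => s (D i ω) = t) (θ₁ := θ₁) (ρ := ρ) (r := M' / √n) (Λ := κ * (Λ * n)) (δ := δ n)
      (c := fun i => κ * a (D i ω)) (by positivity) h2 (fun i _ => ?_) (fun h => ?_) ?_
    · refine ⟨hθ n ω hloc.1, ?_⟩
      have := hloc.2 _ (hθ n ω hloc.1)
      rwa [le_div_iff₀ hsn, mul_comm] at this
    · have hu : ‖recentered D U n ω i‖ ≤ 2 * (ρ / (2 * M') * √n) := by
        refine (norm_sub_le _ _).trans ?_
        linarith [h3 i]
      calc M' / √n * ‖recentered D U n ω i‖ ≤ M' / √n * (2 * (ρ / (2 * M') * √n)) := by gcongr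
        _ = ρ := by field_simp
    · rw [mul_assoc]
      refine (mul_le_mul_of_nonneg_left (h1 h) hκ.le).trans_eq ?_
      rw [Finset.mul_sum]
      refine Finset.sum_congr rfl fun i _ => ?_
      by_cases hi : s (D i ω) = t
      · simp [hi, mul_assoc]
      · simp [hi, has _ hi]
    · have hgr : ‖∑ i : Fin n, if s (D i ω) = t then
          conjDeriv f (inner ℝ θ₁ (recentered D U n ω i)) • recentered D U n ω i else 0‖ =
          n * ‖sampleGrad f D U s t θ₁ n ω‖ := by
        rw [sampleGrad, norm_smul, norm_inv, Real.norm_of_nonneg hn'.le, ← mul_assoc,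
          mul_inv_cancel₀ hn'.ne', one_mul]
      rw [hgr]
      have hW' : √n * ‖sampleGrad f D U s t θ₁ n ω‖ ≤ M := (le_abs_self _).trans hW
      have e1 : n * ‖sampleGrad f D U s t θ₁ n ω‖ ≤ √n * M := by
        calc n * ‖sampleGrad f D U s t θ₁ n ω‖ = √n * (√n * ‖sampleGrad f D U s t θ₁ n ω‖) := by
              rw [← mul_assoc, hss]
          _ ≤ _ := by gcongr
      have e2 : κ * (Λ * n) * (M' / √n) = (M + 2) * √n := by
        have e3 : M' / √n * n = M' * √n := by
          rw [div_mul_eq_mul_div, div_eq_iff hsn.ne', mul_assoc, hss]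
        calc κ * (Λ * n) * (M' / √n) = κ * Λ * (M' / √n * n) := by ring
          _ = _ := by rw [e3, hM']; field_simp
      rw [e2]
      nlinarith
  have hbdd : BddP P (fun n ω => √n * ‖θhat n ω - θ₁‖) := by
    refine hS.of_whp fun M hM => ?_
    obtain ⟨M', -, h⟩ := hmain M hM
    refine ⟨M', h.mono (Eventually.of_forall fun n ω h1 h2 => ?_)⟩
    rw [abs_of_nonneg (by positivity)]
    exact (h1 h2).2
  refine ⟨hS.whp fun M hM => ?_, hbdd, fun ε hε => hbdd.whp fun M hM => ?_⟩
  · obtain ⟨M', -, h⟩ := hmain M hM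
    exact h.mono (Eventually.of_forall fun n ω h1 h2 => (h1 h2).1)
  · refine (hmax (ε / (M + 1)) (by positivity)).mono ?_
    filter_upwards [eventually_gt_atTop 0] with n hn ω h1 h2 i
    rw [abs_of_nonneg (by positivity)] at h2
    calc |inner ℝ (θhat n ω - θ₁) (U (D i ω))| ≤ ‖θhat n ω - θ₁‖ * ‖U (D i ω)‖ :=
          abs_real_inner_le_norm _ _
      _ ≤ ‖θhat n ω - θ₁‖ * (ε / (M + 1) * √n) := by gcongr; exact h1 i
      _ = (√n * ‖θhat n ω - θ₁‖) * (ε / (M + 1)) := by ring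
      _ ≤ M * (ε / (M + 1)) := by gcongr
      _ ≤ ε := by rw [mul_div_assoc', div_le_iff₀ (by positivity)]; nlinarith

end DualLocalization

/-! ### Consequences of strong ignorability -/

section Ignorability

variable {Ω : Type*} [MeasurableSpace Ω] {P : Measure Ω} {p K : ℕ}
  {X : Ω → EuclideanSpace ℝ (Fin p)} {T : Ω → Bool} {Y : Ω → Bool → ℝ}

lemma measurable_propensity (hX : Measurable X) (t : Bool) : Measurable (propensity P X T t) :=
  (stronglyMeasurable_condExp.mono hX.comap_le).measurable

lemma propensity_nonneg (t : Bool) : ∀ᵐ ω ∂P, 0 ≤ propensity P X T t ω :=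
  condExp_nonneg (ae_of_all _ fun _ => indicator_nonneg (fun _ _ => zero_le_one) _)

variable [IsProbabilityMeasure P]

lemma propensity_le_one (hX : Measurable X) (hT : Measurable T) (t : Bool) :
    ∀ᵐ ω ∂P, propensity P X T t ω ≤ 1 := by
  have h := condExp_mono (m := sigmaX X) (μ := P)
    (f := (T ⁻¹' {t}).indicator fun _ => (1 : ℝ)) (g := fun _ => (1 : ℝ))
    ((integrable_const 1).indicator (hT (measurableSet_singleton t))) (integrable_const 1)
    (ae_of_all _ fun _ => indicator_le_self' (fun _ _ => zero_le_one) _)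
  rw [condExp_const hX.comap_le] at h
  exact h

lemma propensity_false (hX : Measurable X) (hT : Measurable T) :
    ∀ᵐ ω ∂P, propensity P X T false ω = 1 - propensity P X T true ω := by
  have hind : (T ⁻¹' {false}).indicator (fun _ => (1 : ℝ)) =
      (fun _ => (1 : ℝ)) - (T ⁻¹' {true}).indicator (fun _ => (1 : ℝ)) := by
    funext ω
    cases h : T ω <;> simp [indicator, h]
  have h := condExp_sub (μ := P) (m := sigmaX X) (f := fun _ => (1 : ℝ))
    (g := (T ⁻¹' {true}).indicator fun _ => (1 : ℝ)) (integrable_const 1)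
    ((integrable_const 1).indicator (hT (measurableSet_singleton true)))
  rw [← hind, condExp_const hX.comap_le] at h
  exact h

/-- Strict overlap holds for both arms. -/
lemma exists_le_propensity (hX : Measurable X) (hT : Measurable T)
    (h : ∃ η : ℝ, 0 < η ∧ η < 1 / 2 ∧
      ∀ᵐ ω ∂P, η ≤ propensity P X T true ω ∧ propensity P X T true ω ≤ 1 - η) :
    ∃ η : ℝ, 0 < η ∧ ∀ t, ∀ᵐ ω ∂P, η ≤ propensity P X T t ω := by
  obtain ⟨η, h0, -, h1⟩ := h
  refine ⟨η, h0, fun t => ?_⟩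
  cases t
  · filter_upwards [h1, propensity_false hX hT] with ω h1 h2
    rw [h2]; linarith [h1.2]
  · filter_upwards [h1] with ω h1 using h1.1

/-- Under strong ignorability, conditioning on arm `t` amounts to weighting by the propensity. -/
lemma StrongIgnorability.map_restrict (hX : Measurable X) (hT : Measurable T) (hY : Measurable Y)
    (hign : StrongIgnorability P X T Y) (t : Bool) :
    (P.restrict (T ⁻¹' {t})).map (fun ω => (X ω, Y ω)) =
      (P.withDensity fun ω => ENNReal.ofReal (propensity P X T t ω)).map
        (fun ω => (X ω, Y ω)) := by
  refine Measure.ext_prod fun {C A} hC hA => ?_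
  have hXY : Measurable fun ω => (X ω, Y ω) := hX.prodMk hY
  have hTm : MeasurableSet (T ⁻¹' {t}) := hT (measurableSet_singleton t)
  have hpre : (fun ω => (X ω, Y ω)) ⁻¹' (C ×ˢ A) = X ⁻¹' C ∩ Y ⁻¹' A := rfl
  have hXC : MeasurableSet[sigmaX X] (X ⁻¹' C) := ⟨C, hC, rfl⟩
  have hXC' : MeasurableSet (X ⁻¹' C) := hX hC
  have hYA : MeasurableSet (Y ⁻¹' A) := hY hA
  rw [Measure.map_apply hXY (hC.prod hA), Measure.map_apply hXY (hC.prod hA), hpre,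
    withDensity_apply _ (hXC'.inter hYA), Measure.restrict_apply (hXC'.inter hYA)]
  have hpi1 : Integrable (propensity P X T t) P := integrable_condExp
  have hint : Integrable ((Y ⁻¹' A).indicator (fun _ => (1 : ℝ)) * propensity P X T t) P := by
    refine hpi1.mono' (((measurable_const.indicator hYA).mul
      (measurable_propensity hX t)).aestronglyMeasurable) ?_
    filter_upwards [propensity_nonneg (P := P) (X := X) (T := T) t] with ω hω
    rw [Pi.mul_apply, norm_mul, Real.norm_of_nonneg hω]
    refine mul_le_of_le_one_left hω ?_
    by_cases h : ω ∈ Y ⁻¹' A <;> simp [h]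
  -- Condition on `X` inside `{X ∈ C}` and pull the propensity out.
  have key : ∫ ω in X ⁻¹' C, (Y ⁻¹' A ∩ T ⁻¹' {t}).indicator (fun _ => (1 : ℝ)) ω ∂P =
      ∫ ω in X ⁻¹' C, ((Y ⁻¹' A).indicator (fun _ => (1 : ℝ)) * propensity P X T t) ω ∂P := by
    rw [← setIntegral_condExp hX.comap_le
      ((integrable_const (1 : ℝ)).indicator (hYA.inter hTm)) hXC,
      ← setIntegral_condExp hX.comap_le hint hXC]
    refine setIntegral_congr_ae hXC' ?_
    filter_upwards [hign A {t} hA (measurableSet_singleton t),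
      condExp_mul_of_aestronglyMeasurable_right (m := sigmaX X) (μ := P)
        stronglyMeasurable_condExp.aestronglyMeasurable hint
        ((integrable_const (1 : ℝ)).indicator hYA)] with ω h1 h2 _
    exact h1.trans h2.symm
  have e1 : ∫ ω in X ⁻¹' C, (Y ⁻¹' A ∩ T ⁻¹' {t}).indicator (fun _ => (1 : ℝ)) ω ∂P =
      P.real (X ⁻¹' C ∩ Y ⁻¹' A ∩ T ⁻¹' {t}) := by
    rw [integral_indicator (hYA.inter hTm), setIntegral_const, smul_eq_mul, mul_one,
      measureReal_def,
      measureReal_def, Measure.restrict_apply (hYA.inter hTm), inter_comm, inter_assoc]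
  have e2 : ENNReal.ofReal (∫ ω in X ⁻¹' C,
      ((Y ⁻¹' A).indicator (fun _ => (1 : ℝ)) * propensity P X T t) ω ∂P) =
      ∫⁻ ω in X ⁻¹' C ∩ Y ⁻¹' A, ENNReal.ofReal (propensity P X T t ω) ∂P := by
    have : (Y ⁻¹' A).indicator (fun _ => (1 : ℝ)) * propensity P X T t =
        (Y ⁻¹' A).indicator (propensity P X T t) := by
      funext ω; by_cases h : ω ∈ Y ⁻¹' A <;> simp [h]
    rw [this, setIntegral_indicator hYA, ofReal_integral_eq_lintegral_ofReal hpi1.integrableOn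
      (ae_restrict_of_ae (propensity_nonneg t))]
  rw [← e2, ← key, e1, ofReal_measureReal]

/-- `E[1{T = t} h(X, Y)] = E[Pr(T = t ∣ X) h(X, Y)]` under strong ignorability. -/
lemma StrongIgnorability.setIntegral_eq (hX : Measurable X) (hT : Measurable T) (hY : Measurable Y)
    (hign : StrongIgnorability P X T Y) (t : Bool) {F : Type*} [NormedAddCommGroup F]
    [NormedSpace ℝ F] {h : EuclideanSpace ℝ (Fin p) × (Bool → ℝ) → F} (hh : StronglyMeasurable h) :
    ∫ ω in T ⁻¹' {t}, h (X ω, Y ω) ∂P = ∫ ω, propensity P X T t ω • h (X ω, Y ω) ∂P := by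
  have hXY : Measurable fun ω => (X ω, Y ω) := hX.prodMk hY
  have h1 := integral_map (μ := P.restrict (T ⁻¹' {t})) hXY.aemeasurable
    (f := h) hh.aestronglyMeasurable
  rw [hign.map_restrict hX hT hY t, integral_map hXY.aemeasurable hh.aestronglyMeasurable] at h1
  rw [← h1]
  have h2 := integral_withDensity_eq_integral_smul (μ := P)
    (f := fun ω => (propensity P X T t ω).toNNReal) (measurable_propensity hX t).real_toNNReal
    (fun ω => h (X ω, Y ω))
  refine h2.trans (integral_congr_ae ?_)
  filter_upwards [propensity_nonneg (P := P) (X := X) (T := T) t] with ω hω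
  rw [NNReal.smul_def, Real.coe_toNNReal _ hω]

lemma measure_arm_pos {η : ℝ} (hη : 0 < η) {t : Bool} (hX : Measurable X) (hT : Measurable T)
    (h : ∀ᵐ ω ∂P, η ≤ propensity P X T t ω) : 0 < P (T ⁻¹' {t}) := by
  have h1 : ∫ ω, propensity P X T t ω ∂P = P.real (T ⁻¹' {t}) := by
    rw [propensity, integral_condExp hX.comap_le,
      integral_indicator (hT (measurableSet_singleton t))]
    simp
  have h2 : η ≤ P.real (T ⁻¹' {t}) := by
    rw [← h1]
    have := integral_mono_ae (integrable_const η) (integrable_condExp (m := sigmaX X)) h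
    rw [integral_const, probReal_univ, one_smul] at this
    exact this
  exact pos_iff_ne_zero.2 fun h0 => by rw [measureReal_def, h0, ENNReal.toReal_zero] at h2; linarith

/-- A function of `(X, Y)` that is independent of `X` is independent of `(X, T)` under strong
ignorability. -/
lemma StrongIgnorability.indepFun (hX : Measurable X) (hT : Measurable T) (hY : Measurable Y)
    (hign : StrongIgnorability P X T Y)
    {e : EuclideanSpace ℝ (Fin p) × (Bool → ℝ) → ℝ} (he : Measurable e)
    (hind : IndepFun (fun ω => e (X ω, Y ω)) X P) :
    IndepFun (fun ω => (X ω, T ω)) (fun ω => e (X ω, Y ω)) P := by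
  have hXY : Measurable fun ω => (X ω, Y ω) := hX.prodMk hY
  have heXY : Measurable fun ω => e (X ω, Y ω) := he.comp hXY
  have hrect : ∀ (t : Bool) (C : Set (EuclideanSpace ℝ (Fin p))) (B : Set ℝ), MeasurableSet C →
      MeasurableSet B → P.real (T ⁻¹' {t} ∩ X ⁻¹' C ∩ (fun ω => e (X ω, Y ω)) ⁻¹' B) =
        P.real (T ⁻¹' {t} ∩ X ⁻¹' C) * P.real ((fun ω => e (X ω, Y ω)) ⁻¹' B) := by
    intro t C B hC hB
    have hTm : MeasurableSet (T ⁻¹' {t}) := hT (measurableSet_singleton t)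
    have hgen : ∀ B' : Set ℝ, MeasurableSet B' →
        P.real (T ⁻¹' {t} ∩ X ⁻¹' C ∩ (fun ω => e (X ω, Y ω)) ⁻¹' B') =
        ∫ ω, propensity P X T t ω * (C.indicator 1 (X ω) * B'.indicator 1 (e (X ω, Y ω))) ∂P := by
      intro B' hB'
      have hm : StronglyMeasurable fun z : EuclideanSpace ℝ (Fin p) × (Bool → ℝ) =>
          C.indicator (1 : EuclideanSpace ℝ (Fin p) → ℝ) z.1 * B'.indicator (1 : ℝ → ℝ) (e z) :=
        (((measurable_one.indicator hC).comp measurable_fst).mul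
          ((measurable_one.indicator hB').comp he)).stronglyMeasurable
      have hset := hign.setIntegral_eq hX hT hY t hm
      simp only [smul_eq_mul] at hset
      rw [← hset]
      have : ∀ ω, C.indicator (1 : EuclideanSpace ℝ (Fin p) → ℝ) (X ω) *
          B'.indicator (1 : ℝ → ℝ) (e (X ω, Y ω)) =
          (X ⁻¹' C ∩ (fun ω => e (X ω, Y ω)) ⁻¹' B').indicator 1 ω := by
        intro ω
        by_cases h1 : X ω ∈ C <;> by_cases h2 : e (X ω, Y ω) ∈ B' <;> simp [indicator, h1, h2]
      simp only [this]
      rw [integral_indicator_one ((hX hC).inter (heXY hB')), measureReal_restrict_apply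
        ((hX hC).inter (heXY hB'))]
      congr 1
      ext ω; simp only [mem_inter_iff]; tauto
    obtain ⟨g, hg, hgX⟩ : ∃ g : EuclideanSpace ℝ (Fin p) → ℝ, Measurable g ∧
        propensity P X T t = g ∘ X :=
      Measurable.exists_eq_measurable_comp (f := X) stronglyMeasurable_condExp.measurable
    have hprod : ∀ B' : Set ℝ, MeasurableSet B' →
        ∫ ω, propensity P X T t ω * (C.indicator 1 (X ω) * B'.indicator 1 (e (X ω, Y ω))) ∂P =
        (∫ ω, g (X ω) * C.indicator 1 (X ω) ∂P) *
          P.real ((fun ω => e (X ω, Y ω)) ⁻¹' B') := by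
      intro B' hB'
      have hgC : Measurable fun x => g x * C.indicator 1 x := hg.mul (measurable_one.indicator hC)
      have hB1 : Measurable (B'.indicator (1 : ℝ → ℝ)) := measurable_one.indicator hB'
      have h1 := (hind.symm.comp hgC hB1).integral_fun_mul_eq_mul_integral
        (hgC.comp hX).aestronglyMeasurable (hB1.comp heXY).aestronglyMeasurable
      have h2 : ∫ ω, B'.indicator (1 : ℝ → ℝ) (e (X ω, Y ω)) ∂P =
          P.real ((fun ω => e (X ω, Y ω)) ⁻¹' B') := by
        rw [← integral_indicator_one (heXY hB')]; rfl
      simp only [Function.comp_def, h2] at h1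
      rw [← h1]
      refine integral_congr_ae (ae_of_all _ fun ω => ?_)
      simp only [hgX, Function.comp_apply]; ring
    have huniv := hgen univ MeasurableSet.univ
    rw [hprod univ MeasurableSet.univ, preimage_univ, inter_univ, probReal_univ, mul_one] at huniv
    rw [hgen B hB, hprod B hB, ← huniv]
  rw [indepFun_iff_measure_inter_preimage_eq_mul]
  intro S B hS hB
  set G : Bool → Set (EuclideanSpace ℝ (Fin p)) := fun t => {x | (x, t) ∈ S} with hG
  have hGm : ∀ t, MeasurableSet (G t) := fun t =>
    (measurable_id.prodMk measurable_const) hS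
  have hsplit : ∀ Z : Set Ω, MeasurableSet Z → P.real ((fun ω => (X ω, T ω)) ⁻¹' S ∩ Z) =
      P.real (T ⁻¹' {false} ∩ X ⁻¹' (G false) ∩ Z) +
        P.real (T ⁻¹' {true} ∩ X ⁻¹' (G true) ∩ Z) := by
    intro Z hZ
    rw [← measureReal_union]
    · congr 1
      ext ω
      cases h : T ω <;> simp [hG, h]
    · refine Set.disjoint_left.2 fun ω h1 h2 => ?_
      have h3 : T ω = false := h1.1.1
      have h4 : T ω = true := h2.1.1
      simp [h3] at h4
    · exact ((hT (measurableSet_singleton true)).inter (hX (hGm true))).inter hZ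
  have hfin : P.real ((fun ω => (X ω, T ω)) ⁻¹' S ∩ (fun ω => e (X ω, Y ω)) ⁻¹' B) =
      P.real ((fun ω => (X ω, T ω)) ⁻¹' S) * P.real ((fun ω => e (X ω, Y ω)) ⁻¹' B) := by
    have h0 := hsplit univ MeasurableSet.univ
    simp only [inter_univ] at h0
    rw [hsplit _ (heXY hB), h0, hrect _ _ _ (hGm _) hB, hrect _ _ _ (hGm _) hB, add_mul]
  rw [measureReal_def, measureReal_def, measureReal_def, ← ENNReal.toReal_mul] at hfin
  exact (ENNReal.toReal_eq_toReal_iff' (measure_ne_top _ _)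
    (ENNReal.mul_ne_top (measure_ne_top _ _) (measure_ne_top _ _))).1 hfin

end Ignorability

/-! ### The sample in terms of the centred features `R (Φ(X) - E Φ(X))` -/

section Features

variable {Ω : Type*} [MeasurableSpace Ω] {P : Measure Ω} {p K : ℕ}

/-- The observation `(X i, T i, Y i)`. -/
def obs {Ω : Type*} {p : ℕ} (X : ℕ → Ω → EuclideanSpace ℝ (Fin p)) (T : ℕ → Ω → Bool)
    (Y : ℕ → Ω → Bool → ℝ) (i : ℕ) (ω : Ω) : EuclideanSpace ℝ (Fin p) × Bool × (Bool → ℝ) :=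
  (X i ω, T i ω, Y i ω)

/-- The centred and rescaled features `R (Φ(x) - E Φ(X))` of an observation `(x, s, y)`. -/
noncomputable def feature (P : Measure Ω) (X : Ω → EuclideanSpace ℝ (Fin p))
    (Φ : EuclideanSpace ℝ (Fin p) → EuclideanSpace ℝ (Fin K)) (R : Matrix (Fin K) (Fin K) ℝ)
    (z : EuclideanSpace ℝ (Fin p) × Bool × (Bool → ℝ)) : EuclideanSpace ℝ (Fin K) :=
  Matrix.toEuclideanLin R (Φ z.1 - ∫ ω, Φ (X ω) ∂P)

variable {X : ℕ → Ω → EuclideanSpace ℝ (Fin p)} {T : ℕ → Ω → Bool} {Y : ℕ → Ω → Bool → ℝ}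
  {f : ℝ → ℝ} {Φ : EuclideanSpace ℝ (Fin p) → EuclideanSpace ℝ (Fin K)}
  {R W : Matrix (Fin K) (Fin K) ℝ} {δ : ℕ → ℝ} {Θ : Set (EuclideanSpace ℝ (Fin K))}
  {θhat : Bool → (n : ℕ) → (Fin n → EuclideanSpace ℝ (Fin p)) → (Fin n → Bool) →
      EuclideanSpace ℝ (Fin K)}

lemma measurable_toEuclideanLin (R : Matrix (Fin K) (Fin K) ℝ) :
    Measurable (Matrix.toEuclideanLin R) :=
  (LinearMap.continuous_of_finiteDimensional (Matrix.toEuclideanLin R)).measurable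

lemma measurable_feature {X₀ : Ω → EuclideanSpace ℝ (Fin p)} (hΦ : Measurable Φ) :
    Measurable (feature P X₀ Φ R) :=
  (measurable_toEuclideanLin R).comp ((hΦ.comp measurable_fst).sub_const _)

lemma memLp_feature [IsProbabilityMeasure P] (h : MemLp (fun ω => Φ (X 0 ω)) 2 P) :
    MemLp (fun ω => feature P (X 0) Φ R (obs X T Y 0 ω)) 2 P :=
  (LinearMap.toContinuousLinearMap (Matrix.toEuclideanLin R)).comp_memLp'
    (h.sub (memLp_const _))

lemma integral_feature [IsProbabilityMeasure P] (h : MemLp (fun ω => Φ (X 0 ω)) 2 P) :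
    ∫ ω, feature P (X 0) Φ R (obs X T Y 0 ω) ∂P = 0 := by
  have hint := h.integrable one_le_two
  have h1 := (LinearMap.toContinuousLinearMap (Matrix.toEuclideanLin R)).integral_comp_comm
    (hint.sub (integrable_const (∫ ω, Φ (X 0 ω) ∂P)))
  refine h1.trans ?_
  simp only [Pi.sub_apply]
  rw [integral_sub hint (integrable_const _)]
  simp

lemma IsIIDSample.iIndepFun_obs (h : IsIIDSample P X T Y) : iIndepFun (obs X T Y) P := h.indep

lemma IsIIDSample.identDistrib_obs (h : IsIIDSample P X T Y) (i : ℕ) :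
    IdentDistrib (obs X T Y i) (obs X T Y 0) P P := h.identDistrib i

lemma IsIIDSample.measurable_obs (h : IsIIDSample P X T Y) (i : ℕ) : Measurable (obs X T Y i) :=
  (h.measurable_X i).prodMk ((h.measurable_T i).prodMk (h.measurable_Y i))

lemma toEuclideanLin_sub_basisMean {X₀ : Ω → EuclideanSpace ℝ (Fin p)} (n : ℕ) (ω : Ω)
    (i : Fin n) :
    Matrix.toEuclideanLin R (Φ (X i ω) - basisMean Φ (fun i : Fin n => X i ω)) =
      recentered (obs X T Y) (feature P X₀ Φ R) n ω i := by
  have hn : (n : ℝ) ≠ 0 := by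
    have := i.pos
    positivity
  rw [recentered, sampleMean, feature, basisMean]
  simp only [feature, obs, ← map_sum, ← map_smul, ← map_sub]
  congr 1
  rw [Finset.sum_sub_distrib, smul_sub, Finset.sum_const, Finset.card_univ, Fintype.card_fin,
    ← Nat.cast_smul_eq_nsmul ℝ, smul_smul, inv_mul_cancel₀ hn, one_smul]
  abel

lemma score_sub_basisMean {X₀ : Ω → EuclideanSpace ℝ (Fin p)} (θ : EuclideanSpace ℝ (Fin K))
    (n : ℕ) (ω : Ω) (i : Fin n) :
    score R θ (Φ (X i ω) - basisMean Φ (fun i : Fin n => X i ω)) =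
      inner ℝ θ (recentered (obs X T Y) (feature P X₀ Φ R) n ω i) := by
  rw [score, toEuclideanLin_sub_basisMean (T := T) (Y := Y) (P := P) (X₀ := X₀)]

lemma dualObj_eq_samplePenObj {X₀ : Ω → EuclideanSpace ℝ (Fin p)} (d : ℝ) (t : Bool) (n : ℕ)
    (ω : Ω) : dualObj f Φ R d t (fun i : Fin n => X i ω) (fun i => T i ω) =
      samplePenObj f (obs X T Y) (feature P X₀ Φ R) (fun z => z.2.1) t d n ω := by
  funext θ
  simp only [dualObj, samplePenObj, penObj,
    score_sub_basisMean (T := T) (Y := Y) (P := P) (X₀ := X₀)]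
  rfl

lemma isMinOn_samplePenObj {X₀ : Ω → EuclideanSpace ℝ (Fin p)}
    (hθ : ∀ n, IsDualSolver f Φ R (δ n) (fun t => θhat t n)) (t : Bool) (n : ℕ) (ω : Ω)
    (h : ∃ θ, IsMinOn (samplePenObj f (obs X T Y) (feature P X₀ Φ R) (fun z => z.2.1) t (δ n) n ω)
      univ θ) :
    IsMinOn (samplePenObj f (obs X T Y) (feature P X₀ Φ R) (fun z => z.2.1) t (δ n) n ω) univ
      (θhat t n (fun i => X i ω) (fun i => T i ω)) := by
  rw [← dualObj_eq_samplePenObj] at h ⊢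
  exact (hθ n).isMinOn t _ _ h

lemma sampleRawWeight_eq {X₀ : Ω → EuclideanSpace ℝ (Fin p)} {t : Bool} {n : ℕ} {ω : Ω}
    {i : Fin n} (hi : T i ω = t) :
    sampleRawWeight X T f Φ R θhat n ω i =
      conjDeriv f (inner ℝ (θhat t n (fun i => X i ω) (fun i => T i ω))
        (recentered (obs X T Y) (feature P X₀ Φ R) n ω i)) := by
  rw [sampleRawWeight, rawWeight, score_sub_basisMean (T := T) (Y := Y) (P := P) (X₀ := X₀), hi]

lemma sampleWeight_eq {Ω : Type*} {X : ℕ → Ω → EuclideanSpace ℝ (Fin p)} {T : ℕ → Ω → Bool}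
    {t : Bool} {n : ℕ} {ω : Ω} {i : Fin n} (hi : T i ω = t) :
    sampleWeight X T f Φ R θhat n ω i = sampleRawWeight X T f Φ R θhat n ω i /
      armSum (fun i : Fin n => T i ω) t (sampleRawWeight X T f Φ R θhat n ω) := by
  subst hi; rfl

lemma armSum_congr {n : ℕ} {s : Fin n → Bool} {t : Bool} {v w : Fin n → ℝ}
    (h : ∀ i, s i = t → v i = w i) : armSum s t v = armSum s t w :=
  Finset.sum_congr rfl fun i _ => by
    by_cases hi : s i = t
    · simp [hi, h i hi]
    · simp [hi]

lemma armSum_div {n : ℕ} {s : Fin n → Bool} {t : Bool} {v : Fin n → ℝ} (c : ℝ) :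
    armSum s t (fun i => v i / c) = armSum s t v / c := by
  rw [armSum, armSum, Finset.sum_div]
  exact Finset.sum_congr rfl fun i _ => by by_cases hi : s i = t <;> simp [hi]

lemma armSum_mul_const {n : ℕ} {s : Fin n → Bool} {t : Bool} {v : Fin n → ℝ} (c : ℝ) :
    armSum s t (fun i => v i * c) = armSum s t v * c := by
  rw [armSum, armSum, Finset.sum_mul]
  exact Finset.sum_congr rfl fun i _ => by by_cases hi : s i = t <;> simp [hi]

lemma armSum_add {n : ℕ} {s : Fin n → Bool} {t : Bool} {v w : Fin n → ℝ} :
    armSum s t (fun i => v i + w i) = armSum s t v + armSum s t w := by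
  rw [armSum, armSum, armSum, ← Finset.sum_add_distrib]
  exact Finset.sum_congr rfl fun i _ => by by_cases hi : s i = t <;> simp [hi]

/-- The error of the normalized estimator, as a ratio of sums. -/
lemma armEstimator_sub_eq {Ω : Type*} {X : ℕ → Ω → EuclideanSpace ℝ (Fin p)} {T : ℕ → Ω → Bool}
    {Y : ℕ → Ω → Bool → ℝ} {t : Bool} {n : ℕ} {ω : Ω} (m : ℝ)
    (hS : armSum (fun i : Fin n => T i ω) t (sampleRawWeight X T f Φ R θhat n ω) ≠ 0) :
    armEstimator X T Y f Φ R θhat t n ω - m =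
      armSum (fun i : Fin n => T i ω) t
        (fun i => sampleRawWeight X T f Φ R θhat n ω i * (Y i ω t - m)) /
        armSum (fun i : Fin n => T i ω) t (sampleRawWeight X T f Φ R θhat n ω) := by
  set S := armSum (fun i : Fin n => T i ω) t (sampleRawWeight X T f Φ R θhat n ω) with hSdef
  have h1 : armEstimator X T Y f Φ R θhat t n ω = armSum (fun i : Fin n => T i ω) t
      (fun i => sampleRawWeight X T f Φ R θhat n ω i * Y i ω t) / S := by
    rw [armEstimator, ← armSum_div]
    refine armSum_congr fun i hi => ?_
    rw [sampleWeight_eq hi, hi]; ring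
  have h2 : armSum (fun i : Fin n => T i ω) t
      (fun i => sampleRawWeight X T f Φ R θhat n ω i * (Y i ω t - m)) =
      armSum (fun i : Fin n => T i ω) t
        (fun i => sampleRawWeight X T f Φ R θhat n ω i * Y i ω t) - S * m := by
    rw [hSdef, ← armSum_mul_const, eq_sub_iff_add_eq, ← armSum_add]
    exact armSum_congr fun i _ => by ring
  rw [h1, h2]; field_simp

/-- Uniqueness of the population minimizer excludes that the features of an arm lie in a
hyperplane: the objective would be constant along the normal direction. -/
lemma not_ae_inner_feature_eq_zero {t : Bool}
    (hmin : ∃ θ₀ ∈ interior Θ, ∀ θ ∈ Θ, θ ≠ θ₀ →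
      popDualObj P (X 0) (T 0) f Φ R t θ₀ < popDualObj P (X 0) (T 0) f Φ R t θ)
    {h : EuclideanSpace ℝ (Fin K)} (hh : h ≠ 0) :
    ¬ ∀ᵐ ω ∂P, T 0 ω = t → inner ℝ h (feature P (X 0) Φ R (obs X T Y 0 ω)) = 0 := by
  intro hae
  obtain ⟨θ₀, hθ₀, hlt⟩ := hmin
  have hcont : Tendsto (fun c : ℝ => θ₀ + c • h) (𝓝[≠] 0) (𝓝 θ₀) := by
    have : Continuous fun c : ℝ => θ₀ + c • h := by fun_prop
    simpa using (this.tendsto 0).mono_left nhdsWithin_le_nhds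
  obtain ⟨c, hc, hc0⟩ := ((hcont.eventually (mem_interior_iff_mem_nhds.1 hθ₀)).and
    self_mem_nhdsWithin).exists
  have hne : θ₀ + c • h ≠ θ₀ := by
    simpa using smul_ne_zero hc0 hh
  refine (hlt _ hc hne).ne ?_
  have hcongr : (fun ω => if T 0 ω = t then conj f (score R θ₀ (centered P (X 0) Φ ω)) else 0)
      =ᵐ[P] fun ω => if T 0 ω = t then
        conj f (score R (θ₀ + c • h) (centered P (X 0) Φ ω)) else 0 := by
    filter_upwards [hae] with ω hω
    by_cases hT : T 0 ω = t
    · have h0 : inner ℝ h (Matrix.toEuclideanLin R (centered P (X 0) Φ ω)) = 0 := hω hT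
      simp only [hT, if_true, score, inner_add_left, inner_smul_left, h0, mul_zero, add_zero]
    · simp [hT]
  rw [popDualObj, popDualObj, eexpect, eexpect]
  congr 2
  · exact lintegral_congr_ae (hcongr.mono fun ω hω => by
      exact congrArg EReal.toENNReal hω)
  · exact lintegral_congr_ae (hcongr.mono fun ω hω => by
      exact congrArg (fun x : EReal => (-x).toENNReal) hω)

lemma integral_mul_inner_feature_sq_pos {t : Bool}
    (hmin : ∃ θ₀ ∈ interior Θ, ∀ θ ∈ Θ, θ ≠ θ₀ →
      popDualObj P (X 0) (T 0) f Φ R t θ₀ < popDualObj P (X 0) (T 0) f Φ R t θ)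
    (hD : AEMeasurable (obs X T Y 0) P) (hΦ : Measurable Φ)
    {a : EuclideanSpace ℝ (Fin p) × Bool × (Bool → ℝ) → ℝ} (ha : Measurable a) (ha0 : ∀ z, 0 ≤ a z)
    (hat : ∀ z, z.2.1 = t → 0 < a z)
    (haU : Integrable (fun ω => a (obs X T Y 0 ω) * ‖feature P (X 0) Φ R (obs X T Y 0 ω)‖ ^ 2) P)
    {h : EuclideanSpace ℝ (Fin K)} (hh : h ≠ 0) :
    0 < ∫ ω, a (obs X T Y 0 ω) * inner ℝ h (feature P (X 0) Φ R (obs X T Y 0 ω)) ^ 2 ∂P := by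
  have hint : Integrable (fun ω =>
      a (obs X T Y 0 ω) * inner ℝ h (feature P (X 0) Φ R (obs X T Y 0 ω)) ^ 2) P := by
    refine (haU.const_mul (‖h‖ ^ 2)).mono' ?_ (ae_of_all _ fun ω => ?_)
    · have hm : Measurable fun z => a z * inner ℝ h (feature P (X 0) Φ R z) ^ 2 :=
        ha.mul ((measurable_const.inner (measurable_feature hΦ)).pow_const 2)
      exact (hm.comp_aemeasurable hD).aestronglyMeasurable
    · rw [Real.norm_of_nonneg (mul_nonneg (ha0 _) (sq_nonneg _)), ← sq_abs]
      calc a (obs X T Y 0 ω) * |inner ℝ h (feature P (X 0) Φ R (obs X T Y 0 ω))| ^ 2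
          ≤ a (obs X T Y 0 ω) * (‖h‖ * ‖feature P (X 0) Φ R (obs X T Y 0 ω)‖) ^ 2 := by
            have := ha0 (obs X T Y 0 ω)
            gcongr
            exact abs_real_inner_le_norm _ _
        _ = _ := by ring
  have hnn : ∀ ω, 0 ≤ a (obs X T Y 0 ω) * inner ℝ h (feature P (X 0) Φ R (obs X T Y 0 ω)) ^ 2 :=
    fun ω => mul_nonneg (ha0 _) (sq_nonneg _)
  refine lt_of_le_of_ne (integral_nonneg hnn) fun h0 => ?_
  have hz := (integral_eq_zero_iff_of_nonneg hnn hint).1 h0.symm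
  refine not_ae_inner_feature_eq_zero (Y := Y) hmin hh ?_
  filter_upwards [hz] with ω hω hT
  have := hat (obs X T Y 0 ω) hT
  simpa [this.ne'] using hω

end Features

/-! ### Weights that model the inverse propensity -/

section InversePropensity

variable {Ω : Type*} [MeasurableSpace Ω] {P : Measure Ω} [IsProbabilityMeasure P] {p K : ℕ}
  {X : ℕ → Ω → EuclideanSpace ℝ (Fin p)} {T : ℕ → Ω → Bool} {Y : ℕ → Ω → Bool → ℝ}
  {f : ℝ → ℝ} {Φ : EuclideanSpace ℝ (Fin p) → EuclideanSpace ℝ (Fin K)}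
  {R : Matrix (Fin K) (Fin K) ℝ} {δ : ℕ → ℝ} {Θ : Set (EuclideanSpace ℝ (Fin K))}
  {θhat : Bool → (n : ℕ) → (Fin n → EuclideanSpace ℝ (Fin p)) → (Fin n → Bool) →
      EuclideanSpace ℝ (Fin K)}

lemma mul_sampleMean {Ω 𝒟 : Type*} {D : ℕ → Ω → 𝒟} {h : 𝒟 → ℝ} {n : ℕ} {ω : Ω} (hn : 0 < n) :
    n * sampleMean D h n ω = ∑ i : Fin n, h (D i ω) := by
  have : (n : ℝ) ≠ 0 := by positivity
  rw [sampleMean, smul_eq_mul, mul_inv_cancel_left₀ this]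

lemma measurable_conjDeriv (f : ℝ → ℝ) : Measurable (conjDeriv f) := measurable_deriv _

/-- By overlap, the scores in a model of the inverse propensity stay in a compact part of the range
of `f'`. -/
lemma InversePropensityForm.exists_bounds (hX : Measurable (X 0)) (hT : Measurable (T 0))
    (hf : StrictConvexOn ℝ (Ioi 0) f) (hC : ContDiffOn ℝ 2 f (Ioi 0)) {t : Bool} {η : ℝ}
    (hη : 0 < η) (hov : ∀ᵐ ω ∂P, η ≤ propensity P (X 0) (T 0) t ω)
    (hform : InversePropensityForm P (X 0) (T 0) f Φ R t) :
    ∃ (C : ℝ) (θ₁ : EuclideanSpace ℝ (Fin K)) (a b : ℝ), 0 < a ∧ a ≤ b ∧ ∀ᵐ ω ∂P,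
      inner ℝ θ₁ (feature P (X 0) Φ R (obs X T Y 0 ω)) ∈ Icc (deriv f a) (deriv f b) ∧
      propensity P (X 0) (T 0) t ω *
        conjDeriv f (inner ℝ θ₁ (feature P (X 0) Φ R (obs X T Y 0 ω))) = C := by
  obtain ⟨C, θ₁, hform⟩ := hform
  have hform' : ∀ᵐ ω ∂P, 1 / propensity P (X 0) (T 0) t ω =
      C * conjDeriv f (inner ℝ θ₁ (feature P (X 0) Φ R (obs X T Y 0 ω))) := hform
  have hkey : ∀ᵐ ω ∂P, ∃ q, 0 < q ∧
      deriv f q = inner ℝ θ₁ (feature P (X 0) Φ R (obs X T Y 0 ω)) ∧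
      1 / propensity P (X 0) (T 0) t ω = C * q ∧ η ≤ propensity P (X 0) (T 0) t ω ∧
      propensity P (X 0) (T 0) t ω ≤ 1 := by
    filter_upwards [hform', hov, propensity_le_one (P := P) hX hT t] with ω h1 h2 h3
    have hpos : 0 < 1 / propensity P (X 0) (T 0) t ω := by
      have : 0 < propensity P (X 0) (T 0) t ω := hη.trans_le h2
      positivity
    have hne : conjDeriv f (inner ℝ θ₁ (feature P (X 0) Φ R (obs X T Y 0 ω))) ≠ 0 := fun h0 => by
      rw [h0, mul_zero] at h1; linarith
    obtain ⟨q, hq, hqy⟩ := exists_deriv_eq_of_conjDeriv_ne_zero hf hC hne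
    refine ⟨q, hq, hqy, ?_, h2, h3⟩
    rw [h1, ← hqy, conjDeriv_deriv hf hC hq]
  have hC0 : 0 < C := by
    obtain ⟨ω, q, hq, -, h1, h2, -⟩ := hkey.exists
    have hpos : 0 < 1 / propensity P (X 0) (T 0) t ω := by
      have : 0 < propensity P (X 0) (T 0) t ω := hη.trans_le h2
      positivity
    rw [h1] at hpos
    exact (pos_iff_pos_of_mul_pos hpos).2 hq
  have hη1 : η ≤ 1 := by
    obtain ⟨ω, q, -, -, -, h2, h3⟩ := hkey.exists
    exact h2.trans h3
  have hab : 1 / C ≤ 1 / (C * η) :=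
    one_div_le_one_div_of_le (by positivity) (mul_le_of_le_one_right hC0.le hη1)
  refine ⟨1 / C, θ₁, 1 / C, 1 / (C * η), by positivity, hab, ?_⟩
  filter_upwards [hkey] with ω ⟨q, hq, hqy, h1, h2, h3⟩
  have hπ : 0 < propensity P (X 0) (T 0) t ω := hη.trans_le h2
  have hqe : q = 1 / (C * propensity P (X 0) (T 0) t ω) := by
    field_simp at h1 ⊢; linarith
  have hmono := (strictMonoOn_deriv_loss hf hC).monotoneOn
  have hqa : 1 / C ≤ q := by
    rw [hqe]
    exact one_div_le_one_div_of_le (by positivity) (mul_le_of_le_one_right hC0.le h3)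
  have hqb : q ≤ 1 / (C * η) := by
    rw [hqe]
    exact one_div_le_one_div_of_le (by positivity) (by gcongr)
  rw [← hqy, conjDeriv_deriv hf hC hq]
  refine ⟨⟨hmono (show (0 : ℝ) < 1 / C by positivity) hq hqa,
    hmono hq (show (0 : ℝ) < 1 / (C * η) by positivity) hqb⟩, ?_⟩
  rw [hqe]; field_simp

/-- If the weights of arm `t` are bounded away from zero and within `O_p(n^{-1/2})` of fixed weights
`q`, for which the weighted mean of `Y(t) - m` is `O_p(n^{-1/2})`, then the normalized weighted mean
of the outcomes is within `O_p(n^{-1/2})` of `m`. -/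
lemma armEstimator_of_weights_close (hsample : IsIIDSample P X T Y)
    (hYL2 : ∀ t, MemLp (fun ω => Y 0 ω t) 2 P) {t : Bool} (harmpos : 0 < P (T 0 ⁻¹' {t})) {m c : ℝ}
    (hc : 0 < c) {V q : EuclideanSpace ℝ (Fin p) × Bool × (Bool → ℝ) → ℝ} (hV : Measurable V)
    (hV0 : ∀ z, 0 ≤ V z) (hV2 : MemLp (fun ω => V (obs X T Y 0 ω)) 2 P)
    {E₁ E₂ : ℕ → Ω → ℝ} (hE₁0 : ∀ n ω, 0 ≤ E₁ n ω) (hE₂0 : ∀ n ω, 0 ≤ E₂ n ω)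
    (hE₁ : BddP P (fun n ω => √n * E₁ n ω)) (hE₂ : BddP P (fun n ω => √n * E₂ n ω))
    (hw : WHP P (fun n ω => ∀ i : Fin n, T i ω = t →
      |sampleRawWeight X T f Φ R θhat n ω i - q (obs X T Y i ω)| ≤
        E₁ n ω * V (obs X T Y i ω) + E₂ n ω ∧ c ≤ sampleRawWeight X T f Φ R θhat n ω i))
    (hN : BddP P (fun n ω => √n * sampleMean (obs X T Y)
      (fun z => if z.2.1 = t then q z * (z.2.2 t - m) else 0) n ω)) :
    BddP P (fun n ω => √n * (armEstimator X T Y f Φ R θhat t n ω - m)) := by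
  have hT := hsample.measurable_T 0
  have hind := hsample.iIndepFun_obs
  have hid := hsample.identDistrib_obs
  have hD0 := hsample.measurable_obs 0
  set D := obs X T Y with hD
  have hYt : Measurable fun z : EuclideanSpace ℝ (Fin p) × Bool × (Bool → ℝ) => z.2.2 t - m := by
    have h : Measurable fun z : EuclideanSpace ℝ (Fin p) × Bool × (Bool → ℝ) => z.2.2 t :=
      (measurable_pi_apply t).comp (measurable_snd.comp measurable_snd)
    exact h.sub_const m
  have hY2 : MemLp (fun ω => Y 0 ω t - m) 2 P := (hYL2 t).sub (memLp_const m)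
  have hYD : ∀ i ω, (D i ω).2.2 t - m = Y i ω t - m := fun _ _ => rfl
  have hA1 : BddP P (fun n ω => sampleMean D (fun z => V z * |z.2.2 t - m|) n ω) :=
    bddP_sampleMean hind hid (hV.mul hYt.abs) (hV2.integrable_mul hY2.abs)
  have hA2 : BddP P (fun n ω => sampleMean D (fun z => |z.2.2 t - m|) n ω) :=
    bddP_sampleMean hind hid hYt.abs (hY2.integrable one_le_two).abs
  set α : EuclideanSpace ℝ (Fin p) × Bool × (Bool → ℝ) → ℝ :=
    fun z => if z.2.1 = t then 1 else 0 with hα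
  have hαm : Measurable α := Measurable.ite
    ((measurable_fst.comp measurable_snd) (measurableSet_singleton t))
    measurable_const measurable_const
  have hαint : Integrable (fun ω => α (D 0 ω)) P :=
    (integrable_const (1 : ℝ)).mono' (hαm.comp hD0).aestronglyMeasurable
      (ae_of_all _ fun ω => by simp only [hα]; split_ifs <;> simp)
  set π₀ := ∫ ω, α (D 0 ω) ∂P with hπ₀
  have hπpos : 0 < π₀ := by
    have h1 : π₀ = P.real (T 0 ⁻¹' {t}) := by
      rw [← integral_indicator_one (hT (measurableSet_singleton t))]
      refine integral_congr_ae (ae_of_all _ fun ω => ?_)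
      by_cases h : T 0 ω = t <;> simp [hα, hD, obs, h]
    rw [h1]
    exact ENNReal.toReal_pos harmpos.ne' (measure_ne_top _ _)
  set c' := c * (π₀ / 2) with hc'
  have hc0 : 0 < c' := by positivity
  refine ((hN.abs_add_abs ((hE₁.mul hA1).add (hE₂.mul hA2))).mul (BddP.const c'⁻¹)).of_whp_le ?_
  refine (hw.and (whp_sampleMean hind hid hαm hαint (ε := π₀ / 2) (by positivity))).mono ?_
  filter_upwards [eventually_gt_atTop 0] with n hn ω ⟨hw, hα'⟩
  have hn' : (0 : ℝ) < n := by exact_mod_cast hn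
  set N := sampleMean D (fun z => if z.2.1 = t then q z * (z.2.2 t - m) else 0) n ω with hNdef
  set A1 := sampleMean D (fun z => V z * |z.2.2 t - m|) n ω with hA1def
  set A2 := sampleMean D (fun z => |z.2.2 t - m|) n ω with hA2def
  set S := armSum (fun i : Fin n => T i ω) t (sampleRawWeight X T f Φ R θhat n ω) with hS
  have he₁ := hE₁0 n ω
  have he₂ := hE₂0 n ω
  set e₁ := E₁ n ω
  set e₂ := E₂ n ω
  have hSlow : n * c' ≤ S := by
    have h1 : π₀ / 2 ≤ sampleMean D α n ω := by linarith [(abs_le.1 hα').1]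
    have h2 := mul_sampleMean (D := D) (h := α) (ω := ω) hn
    calc (n : ℝ) * c' = c * (n * (π₀ / 2)) := by rw [hc']; ring
      _ ≤ c * (n * sampleMean D α n ω) := by gcongr
      _ = ∑ i : Fin n, c * α (D i ω) := by rw [h2, Finset.mul_sum]
      _ ≤ S := by
        refine Finset.sum_le_sum fun i _ => ?_
        by_cases h : T i ω = t
        · simpa [hα, hD, obs, h] using (hw i h).2
        · simp [hα, hD, obs, h]
  have hSpos : 0 < S := lt_of_lt_of_le (by positivity) hSlow
  have hA1nn : 0 ≤ A1 := smul_nonneg (by positivity)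
    (Finset.sum_nonneg fun i _ => mul_nonneg (hV0 _) (abs_nonneg _))
  have hA2nn : 0 ≤ A2 := smul_nonneg (by positivity) (Finset.sum_nonneg fun i _ => abs_nonneg _)
  have hnum : |armSum (fun i : Fin n => T i ω) t
      (fun i => sampleRawWeight X T f Φ R θhat n ω i * (Y i ω t - m))| ≤
      n * (|N| + (e₁ * A1 + e₂ * A2)) := by
    have hsum : ∑ i : Fin n, (e₁ * V (D i ω) + e₂) * |Y i ω t - m| =
        n * (e₁ * A1 + e₂ * A2) := by
      have e1 := mul_sampleMean (D := D) (h := fun z => V z * |z.2.2 t - m|) (ω := ω) hn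
      have e2 := mul_sampleMean (D := D) (h := fun z => |z.2.2 t - m|) (ω := ω) hn
      have e3 : ∀ i : Fin n, (e₁ * V (D i ω) + e₂) * |Y i ω t - m| =
          e₁ * (V (D i ω) * |(D i ω).2.2 t - m|) + e₂ * |(D i ω).2.2 t - m| :=
        fun i => by rw [hYD]; ring
      simp only [e3]
      rw [Finset.sum_add_distrib, ← Finset.mul_sum, ← Finset.mul_sum, ← e1, ← e2]
      ring
    have hsplit : armSum (fun i : Fin n => T i ω) t
        (fun i => sampleRawWeight X T f Φ R θhat n ω i * (Y i ω t - m)) =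
        n * N + armSum (fun i : Fin n => T i ω) t
          (fun i => (sampleRawWeight X T f Φ R θhat n ω i - q (D i ω)) * (Y i ω t - m)) := by
      have e1 : n * N = armSum (fun i : Fin n => T i ω) t
          (fun i => q (D i ω) * (Y i ω t - m)) := mul_sampleMean hn
      rw [e1, ← armSum_add]
      exact armSum_congr fun i _ => by ring
    rw [hsplit, mul_add, ← hsum]
    refine (abs_add_le _ _).trans (add_le_add ?_ ?_)
    · rw [abs_mul, abs_of_pos hn']
    · refine (Finset.abs_sum_le_sum_abs _ _).trans (Finset.sum_le_sum fun i _ => ?_)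
      by_cases h : T i ω = t
      · simp only [h, if_true, abs_mul]
        gcongr
        exact (hw i h).1
      · simp only [h, if_false, abs_zero]
        have := hV0 (D i ω)
        positivity
  rw [armEstimator_sub_eq m hSpos.ne', abs_mul, abs_div, abs_of_pos hSpos,
    abs_of_nonneg (Real.sqrt_nonneg _)]
  set B := |N| + (e₁ * A1 + e₂ * A2) with hB
  have hB0 : 0 ≤ B := by positivity
  have hquot : |armSum (fun i : Fin n => T i ω) t
      (fun i => sampleRawWeight X T f Φ R θhat n ω i * (Y i ω t - m))| / S ≤ B * c'⁻¹ := by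
    rw [div_le_iff₀ hSpos]
    calc _ ≤ n * B := hnum
      _ = B * c'⁻¹ * (n * c') := by field_simp
      _ ≤ B * c'⁻¹ * S := by gcongr
  refine (mul_le_mul_of_nonneg_left hquot (Real.sqrt_nonneg _)).trans ?_
  refine le_trans (le_of_eq ?_) (le_abs_self _)
  rw [abs_mul, abs_of_nonneg (Real.sqrt_nonneg _), abs_of_nonneg (a := _ + _) (by positivity), hB]
  ring

/-- When the weights model the inverse propensity of arm `t`, the dual solution is within
`O_p(n^{-1/2})` of the true parameter, hence the weights are uniformly close to the true ones and
the weighted mean inherits the rate of the inverse propensity weighted mean. -/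
theorem armEstimator_of_inversePropensityForm (hsample : IsIIDSample P X T Y) (hΦ : Measurable Φ)
    (hθ : ∀ n, IsDualSolver f Φ R (δ n) (fun t => θhat t n))
    (hign : StrongIgnorability P (X 0) (T 0) (Y 0))
    (hreg : Regularity P (X 0) (T 0) (Y 0) f Φ R δ Θ)
    (hf2 : ∀ x : ℝ, 0 < x → 0 < deriv (deriv f) x) {t : Bool}
    (hform : InversePropensityForm P (X 0) (T 0) f Φ R t) :
    BddP P (fun n ω => √n * (armEstimator X T Y f Φ R θhat t n ω - armMean P (Y 0) t)) := by
  have hX := hsample.measurable_X 0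
  have hT := hsample.measurable_T 0
  have hY := hsample.measurable_Y 0
  have hf := hreg.strictConvexOn
  have hC := hreg.contDiffOn
  have hind := hsample.iIndepFun_obs
  have hid := hsample.identDistrib_obs
  have hD0 := hsample.measurable_obs 0
  obtain ⟨η, hη, hov⟩ := exists_le_propensity hX hT hreg.strict_overlap
  obtain ⟨C, θ₁, a, b, ha, hab, hbd⟩ :=
    hform.exists_bounds (Y := Y) hX hT hf hC hη (hov t)
  set D := obs X T Y with hD
  set V := feature P (X 0) Φ R with hVdef
  have hV : Measurable V := measurable_feature hΦ
  have hV2 : MemLp (fun ω => V (D 0 ω)) 2 P := memLp_feature hreg.basis_memLp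
  have hV0 : ∫ ω, V (D 0 ω) ∂P = 0 := integral_feature hreg.basis_memLp
  obtain ⟨ρ, κ, L, hρ, hκ, hL, hloc⟩ := exists_hasStrongTangent hf hC hf2 ha hab
  set q : EuclideanSpace ℝ (Fin p) × Bool × (Bool → ℝ) → ℝ :=
    fun z => conjDeriv f (inner ℝ θ₁ (V z)) with hq
  have hsm : Measurable fun z : EuclideanSpace ℝ (Fin p) × Bool × (Bool → ℝ) => inner ℝ θ₁ (V z) :=
    measurable_const.inner hV
  have hqm : Measurable q := (measurable_conjDeriv f).comp hsm
  have hqab : ∀ z, inner ℝ θ₁ (V z) ∈ Icc (deriv f a) (deriv f b) → a ≤ q z ∧ q z ≤ b := by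
    intro z hz
    obtain ⟨r, hr, hrz⟩ := exists_deriv_eq_of_mem_Icc hC ha hab hz
    simp only [hq, ← hrz, conjDeriv_deriv hf hC (ha.trans_le hr.1)]
    exact hr
  have hq0 : ∀ᵐ ω ∂P, ‖q (D 0 ω)‖ ≤ b := by
    filter_upwards [hbd] with ω hω
    have := hqab _ hω.1
    rw [Real.norm_of_nonneg (by linarith)]
    exact this.2
  have hyW : WHP P (fun n ω => ∀ i : Fin n,
      inner ℝ θ₁ (V (D i ω)) ∈ Icc (deriv f a) (deriv f b)) := by
    refine WHP.of_ae fun n => ae_all_iff.2 fun i => ?_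
    exact (hid i).symm.ae_snd (p := fun z => inner ℝ θ₁ (V z) ∈ Icc (deriv f a) (deriv f b))
      (hsm measurableSet_Icc) (hbd.mono fun ω hω => hω.1)
  have hd : ∀ ε : ℝ, 0 < ε → WHP P (fun n ω => ‖sampleMean D V n ω‖ ≤ ε) := by
    intro ε hε
    simpa only [hV0, sub_zero] using
      whp_sampleMean hind hid hV (hV2.integrable one_le_two) hε
  have hdB : BddP P (fun n ω => √n * ‖sampleMean D V n ω‖) :=
    bddP_sqrt_mul_norm_sampleMean hind hid hV hV2 hV0
  have hVB : BddP P (fun n ω => sampleMean D (fun z => ‖V z‖) n ω) :=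
    bddP_sampleMean hind hid hV.norm (hV2.integrable one_le_two).norm
  have harm : MeasurableSet {z : EuclideanSpace ℝ (Fin p) × Bool × (Bool → ℝ) | z.2.1 = t} :=
    (measurable_fst.comp measurable_snd) (measurableSet_singleton t)
  -- Expectations over the arm, with weights `q`, are expectations over the population.
  have hipw : ∀ {F : Type} [NormedAddCommGroup F] [NormedSpace ℝ F],
      ∀ h : EuclideanSpace ℝ (Fin p) × (Bool → ℝ) → F, StronglyMeasurable h →
      ∫ ω, (if T 0 ω = t then q (D 0 ω) • h (X 0 ω, Y 0 ω) else 0) ∂P =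
        C • ∫ ω, h (X 0 ω, Y 0 ω) ∂P := by
    intro F _ _ h hh
    have hq' : Measurable fun z : EuclideanSpace ℝ (Fin p) × (Bool → ℝ) => q (z.1, t, z.2) :=
      hqm.comp (measurable_fst.prodMk (measurable_const.prodMk measurable_snd))
    have h1 := hign.setIntegral_eq hX hT hY t (hq'.stronglyMeasurable.smul hh)
    have h2 : ∫ ω, (if T 0 ω = t then q (D 0 ω) • h (X 0 ω, Y 0 ω) else 0) ∂P =
        ∫ ω in T 0 ⁻¹' {t}, q (X 0 ω, t, Y 0 ω) • h (X 0 ω, Y 0 ω) ∂P := by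
      rw [← integral_indicator (hT (measurableSet_singleton t))]
      refine integral_congr_ae (ae_of_all _ fun ω => ?_)
      by_cases h : T 0 ω = t <;> simp [indicator, h, hD, obs]
    rw [h2, ← integral_smul]
    refine h1.trans (integral_congr_ae ?_)
    filter_upwards [hbd] with ω hω
    rw [Pi.smul_apply', smul_smul]
    exact congrArg (· • h (X 0 ω, Y 0 ω)) hω.2
  -- The indicator of the arm weights the second moment matrix.
  set α : EuclideanSpace ℝ (Fin p) × Bool × (Bool → ℝ) → ℝ :=
    fun z => if z.2.1 = t then 1 else 0 with hα
  have hαm : Measurable α := Measurable.ite harm measurable_const measurable_const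
  have hα0 : ∀ z, 0 ≤ α z := fun z => by simp only [hα]; split_ifs <;> norm_num
  have hα1 : ∀ z, α z ≤ 1 := fun z => by simp only [hα]; split_ifs <;> norm_num
  have hαint : Integrable (fun ω => α (D 0 ω)) P :=
    (integrable_const (1 : ℝ)).mono' (hαm.comp hD0).aestronglyMeasurable
      (ae_of_all _ fun ω => by rw [Real.norm_of_nonneg (hα0 _)]; exact hα1 _)
  have hαV : Integrable (fun ω => α (D 0 ω) * ‖V (D 0 ω)‖ ^ 2) P := by
    refine hV2.norm.integrable_sq.mono'
      ((hαm.comp hD0).mul ((hV.comp hD0).norm.pow_const 2)).aestronglyMeasurable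
      (ae_of_all _ fun ω => ?_)
    rw [norm_mul, Real.norm_of_nonneg (hα0 _), Real.norm_of_nonneg (by positivity)]
    exact mul_le_of_le_one_left (by positivity) (hα1 _)
  have hst : WHP P (fun n ω => ∀ i : Fin n, (D i ω).2.1 = t →
      HasStrongTangent f (inner ℝ θ₁ (recentered D V n ω i)) ρ (κ * α (D i ω))) := by
    refine (hyW.and (hd (ρ / (‖θ₁‖ + 1)) (by positivity))).mono
      (Eventually.of_forall fun n ω hω i hi => ?_)
    have h1 : κ * α (D i ω) = κ := by simp [hα, hi]
    rw [h1]
    refine (hloc _ (hω.1 i)).1 _ ?_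
    rw [recentered, inner_sub_right, sub_sub_cancel_left, abs_neg]
    refine (abs_real_inner_le_norm _ _).trans ?_
    calc ‖θ₁‖ * ‖sampleMean D V n ω‖ ≤ (‖θ₁‖ + 1) * (ρ / (‖θ₁‖ + 1)) := by
          gcongr
          · linarith
          · exact hω.2
      _ = ρ := by field_simp
  have hgrad : BddP P (fun n ω => √n * ‖sampleGrad f D V (fun z => z.2.1) t θ₁ n ω‖) := by
    set G : EuclideanSpace ℝ (Fin p) × Bool × (Bool → ℝ) → EuclideanSpace ℝ (Fin K) :=
      fun z => if z.2.1 = t then q z • V z else 0 with hG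
    have hGm : Measurable G := Measurable.ite harm (hqm.smul hV) measurable_const
    have hG2 : MemLp (fun ω => G (D 0 ω)) 2 P := by
      refine hV2.of_le_mul (c := b) (hGm.comp hD0).aestronglyMeasurable ?_
      filter_upwards [hq0] with ω hω
      by_cases h : (D 0 ω).2.1 = t
      · simp only [hG, h, if_true, norm_smul]; gcongr
      · simp only [hG, h, if_false, norm_zero]
        exact mul_nonneg (by linarith) (norm_nonneg _)
    have hGz : ∫ ω, G (D 0 ω) ∂P = 0 := by
      have hVm : StronglyMeasurable fun z : EuclideanSpace ℝ (Fin p) × (Bool → ℝ) =>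
          V (z.1, t, z.2) := (hV.comp (measurable_fst.prodMk
            (measurable_const.prodMk measurable_snd))).stronglyMeasurable
      refine (hipw _ hVm).trans ?_
      exact (congrArg (C • ·) hV0).trans (smul_zero C)
    have hGB := bddP_sqrt_mul_norm_sampleMean hind hid hGm hG2 hGz
    refine ((hGB.add (hdB.mul (BddP.const b))).add
      ((hdB.mul (hVB.add (BddP.const 1))).mul (BddP.const (L * ‖θ₁‖)))).of_whp_le ?_
    refine ((hyW.and (hd (ρ / (‖θ₁‖ + 1)) (by positivity))).and (hd 1 one_pos)).mono ?_
    filter_upwards [eventually_gt_atTop 0] with n hn ω hω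
    obtain ⟨⟨hy, hd1⟩, hd2⟩ := hω
    have hn' : (0 : ℝ) < n := by exact_mod_cast hn
    set d := sampleMean D V n ω with hddef
    have hθd : |inner ℝ θ₁ d| ≤ ‖θ₁‖ * ‖d‖ := abs_real_inner_le_norm _ _
    have hθd' : |inner ℝ θ₁ d| ≤ ρ := by
      refine hθd.trans ?_
      calc ‖θ₁‖ * ‖d‖ ≤ (‖θ₁‖ + 1) * (ρ / (‖θ₁‖ + 1)) := by
            gcongr
            linarith
        _ = ρ := by field_simp
    have hterm : ∀ i : Fin n, ‖(if (D i ω).2.1 = t then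
        conjDeriv f (inner ℝ θ₁ (recentered D V n ω i)) • recentered D V n ω i else 0) -
          G (D i ω)‖ ≤ b * ‖d‖ + L * (‖θ₁‖ * ‖d‖) * (‖V (D i ω)‖ + 1) := by
      intro i
      by_cases h : (D i ω).2.1 = t
      · simp only [h, if_true, hG]
        have hLip := (hloc _ (hy i)).2 (inner ℝ θ₁ (recentered D V n ω i))
          (inner ℝ θ₁ (V (D i ω))) (by
            rw [recentered, inner_sub_right, sub_sub_cancel_left, abs_neg]; exact hθd')
          (by simpa using hρ.le)
        have hdiff : inner ℝ θ₁ (recentered D V n ω i) - inner ℝ θ₁ (V (D i ω)) =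
            -inner ℝ θ₁ d := by rw [recentered, inner_sub_right, sub_sub_cancel_left]
        rw [hdiff, abs_neg] at hLip
        have hqi := hqab _ (hy i)
        have hsplit : conjDeriv f (inner ℝ θ₁ (recentered D V n ω i)) • recentered D V n ω i -
            q (D i ω) • V (D i ω) =
            (conjDeriv f (inner ℝ θ₁ (recentered D V n ω i)) - q (D i ω)) • recentered D V n ω i -
              q (D i ω) • d := by
          rw [sub_smul, recentered, ← hddef, smul_sub (q (D i ω)) (V (D i ω)) d]; abel
        rw [hsplit]
        refine (norm_sub_le _ _).trans ?_
        rw [norm_smul, norm_smul, Real.norm_of_nonneg (show 0 ≤ q (D i ω) by linarith),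
          Real.norm_eq_abs, add_comm]
        have hrec : ‖recentered D V n ω i‖ ≤ ‖V (D i ω)‖ + 1 := by
          refine (norm_sub_le _ _).trans ?_
          linarith
        gcongr
        · exact hqi.2
        · exact hLip.trans (by gcongr)
      · simp only [h, if_false, hG, sub_zero, norm_zero]
        have : 0 ≤ b := by linarith
        positivity
    have hsum : ‖sampleGrad f D V (fun z => z.2.1) t θ₁ n ω‖ ≤ ‖sampleMean D G n ω‖ +
        (b * ‖d‖ + L * (‖θ₁‖ * ‖d‖) * (sampleMean D (fun z => ‖V z‖) n ω + 1)) := by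
      have h1 : sampleGrad f D V (fun z => z.2.1) t θ₁ n ω = sampleMean D G n ω +
          (n : ℝ)⁻¹ • ∑ i : Fin n, ((if (D i ω).2.1 = t then
            conjDeriv f (inner ℝ θ₁ (recentered D V n ω i)) • recentered D V n ω i else 0) -
              G (D i ω)) := by
        rw [sampleGrad, Finset.sum_sub_distrib, smul_sub, sampleMean]; abel
      rw [h1]
      refine (norm_add_le _ _).trans (add_le_add le_rfl ?_)
      rw [norm_smul, norm_inv, Real.norm_of_nonneg hn'.le, inv_mul_le_iff₀ hn']
      refine (norm_sum_le_of_le _ fun i _ => hterm i).trans_eq ?_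
      have e1 : ∀ i : Fin n, b * ‖d‖ + L * (‖θ₁‖ * ‖d‖) * (‖V (D i ω)‖ + 1) =
          L * (‖θ₁‖ * ‖d‖) * ‖V (D i ω)‖ + (b * ‖d‖ + L * (‖θ₁‖ * ‖d‖)) := fun i => by ring
      simp only [e1]
      rw [Finset.sum_add_distrib, ← Finset.mul_sum,
        ← mul_sampleMean (D := D) (h := fun z => ‖V z‖) (ω := ω) hn]
      simp only [Finset.sum_const, Finset.card_univ, Fintype.card_fin, nsmul_eq_mul]
      ring
    rw [abs_of_nonneg (by positivity)]
    refine le_trans ?_ (le_abs_self _)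
    calc √n * ‖sampleGrad f D V (fun z => z.2.1) t θ₁ n ω‖ ≤ √n * (‖sampleMean D G n ω‖ +
        (b * ‖d‖ + L * (‖θ₁‖ * ‖d‖) * (sampleMean D (fun z => ‖V z‖) n ω + 1))) := by gcongr
      _ = _ := by ring
  obtain ⟨-, hH, hmax⟩ := dual_localization hind hid hV hV2 hV0 (s := fun z => z.2.1) (t := t)
    hαm hα0 (fun z hz => by simp only [hα]; exact if_neg hz) hαint hαV
    (fun h hh => integral_mul_inner_feature_sq_pos (hreg.unique_min t) hD0.aemeasurable hΦ hαm hα0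
      (fun z hz => by simp [hα, hz]) hαV hh)
    hreg.delta_isLittleO hκ hρ hst hgrad
    (θhat := fun n ω => θhat t n (fun i => X i ω) (fun i => T i ω))
    (fun n ω h => isMinOn_samplePenObj hθ t n ω h)
  set θn : ℕ → Ω → EuclideanSpace ℝ (Fin K) :=
    fun n ω => θhat t n (fun i => X i ω) (fun i => T i ω) with hθn
  -- The weights of the arm are close to the true ones and bounded away from zero.
  have hweights : WHP P (fun n ω => ∀ i : Fin n, T i ω = t →
      |sampleRawWeight X T f Φ R θhat n ω i - q (D i ω)| ≤ L * (‖θn n ω - θ₁‖ * ‖V (D i ω)‖ +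
        (‖θ₁‖ + √n * ‖θn n ω - θ₁‖) * ‖sampleMean D V n ω‖) ∧
      a / 2 ≤ sampleRawWeight X T f Φ R θhat n ω i) := by
    refine hH.whp fun M hM => ?_
    set r := min ρ (a / (2 * (L + 1))) with hr
    have hr0 : 0 < r := lt_min hρ (by positivity)
    refine ((hyW.and (hmax (r / 2) (by positivity))).and
      (hd (r / 2 / (‖θ₁‖ + M + 1)) (by positivity))).mono ?_
    filter_upwards [eventually_gt_atTop 0] with n hn ω hω hHM i hi
    obtain ⟨⟨hy, hmx⟩, hdd⟩ := hω
    have hn1 : (1 : ℝ) ≤ √n := by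
      rw [Real.one_le_sqrt]; exact_mod_cast hn
    rw [abs_of_nonneg (by positivity)] at hHM
    have hΔeq : inner ℝ (θn n ω) (recentered D V n ω i) - inner ℝ θ₁ (V (D i ω)) =
        inner ℝ (θn n ω - θ₁) (V (D i ω)) - inner ℝ (θn n ω) (sampleMean D V n ω) := by
      rw [recentered, inner_sub_right, inner_sub_left]; ring
    have hθd : |inner ℝ (θn n ω) (sampleMean D V n ω)| ≤
        (‖θ₁‖ + √n * ‖θn n ω - θ₁‖) * ‖sampleMean D V n ω‖ := by
      refine (abs_real_inner_le_norm _ _).trans ?_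
      gcongr
      have h1 := norm_add_le θ₁ (θn n ω - θ₁)
      rw [add_sub_cancel] at h1
      have h2 := mul_le_mul_of_nonneg_right hn1 (norm_nonneg (θn n ω - θ₁))
      linarith
    have hθd' : (‖θ₁‖ + √n * ‖θn n ω - θ₁‖) * ‖sampleMean D V n ω‖ ≤ r / 2 := by
      calc (‖θ₁‖ + √n * ‖θn n ω - θ₁‖) * ‖sampleMean D V n ω‖
          ≤ (‖θ₁‖ + M + 1) * (r / 2 / (‖θ₁‖ + M + 1)) :=
            mul_le_mul (by linarith) hdd (norm_nonneg _) (by positivity)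
        _ = r / 2 := by field_simp
    have hΔ1 : |inner ℝ (θn n ω) (recentered D V n ω i) - inner ℝ θ₁ (V (D i ω))| ≤ r := by
      rw [hΔeq]
      refine (abs_sub _ _).trans ?_
      linarith [hmx i]
    have hΔ2 : |inner ℝ (θn n ω) (recentered D V n ω i) - inner ℝ θ₁ (V (D i ω))| ≤
        ‖θn n ω - θ₁‖ * ‖V (D i ω)‖ +
          (‖θ₁‖ + √n * ‖θn n ω - θ₁‖) * ‖sampleMean D V n ω‖ := by
      rw [hΔeq]
      refine (abs_sub _ _).trans (add_le_add (abs_real_inner_le_norm _ _) hθd)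
    have hraw : sampleRawWeight X T f Φ R θhat n ω i =
        conjDeriv f (inner ℝ (θn n ω) (recentered D V n ω i)) := sampleRawWeight_eq hi
    have hLip := (hloc _ (hy i)).2 (inner ℝ (θn n ω) (recentered D V n ω i))
      (inner ℝ θ₁ (V (D i ω))) (hΔ1.trans (min_le_left _ _)) (by simpa using hρ.le)
    rw [hraw]
    refine ⟨hLip.trans (by gcongr), ?_⟩
    have hLr : L * r ≤ a / 2 := by
      calc L * r ≤ (L + 1) * (a / (2 * (L + 1))) := by
            gcongr
            · linarith
            · exact min_le_right _ _
        _ = a / 2 := by field_simp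
    have h3 := (abs_le.1 (hLip.trans (mul_le_mul_of_nonneg_left hΔ1 hL))).1
    have h4 := (hqab _ (hy i)).1
    simp only [hq] at h4
    linarith
  refine armEstimator_of_weights_close hsample hreg.outcome_memLp (measure_arm_pos hη hX hT (hov t))
    (half_pos ha) (q := q) hV.norm (fun z => norm_nonneg _) hV2.norm
    (E₁ := fun n ω => L * ‖θn n ω - θ₁‖)
    (E₂ := fun n ω => L * ((‖θ₁‖ + √n * ‖θn n ω - θ₁‖) * ‖sampleMean D V n ω‖))
    (fun n ω => by positivity) (fun n ω => by positivity)
    ((hH.mul (BddP.const L)).of_le fun n ω => le_of_eq (by congr 1; ring))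
    (((((BddP.const ‖θ₁‖).add hH).mul hdB).mul (BddP.const L)).of_le
      fun n ω => le_of_eq (by congr 1; ring))
    (hweights.mono (Eventually.of_forall fun n ω h i hi =>
      ⟨(h i hi).1.trans_eq (by ring), (h i hi).2⟩)) ?_
  set m := armMean P (Y 0) t with hm
  have hNm : Measurable fun z : EuclideanSpace ℝ (Fin p) × Bool × (Bool → ℝ) =>
      if z.2.1 = t then q z * (z.2.2 t - m) else 0 := by
    have h : Measurable fun z : EuclideanSpace ℝ (Fin p) × Bool × (Bool → ℝ) => z.2.2 t :=
      (measurable_pi_apply t).comp (measurable_snd.comp measurable_snd)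
    exact Measurable.ite harm (hqm.mul (h.sub_const m)) measurable_const
  have hY2 : MemLp (fun ω => Y 0 ω t - m) 2 P := (hreg.outcome_memLp t).sub (memLp_const m)
  refine bddP_sqrt_mul_sampleMean hind hid hNm ?_ ?_
  · refine hY2.of_le_mul (c := b) (hNm.comp hD0).aestronglyMeasurable ?_
    filter_upwards [hq0] with ω hω
    by_cases h : (D 0 ω).2.1 = t
    · simp only [h, if_true, norm_mul]
      exact mul_le_mul_of_nonneg_right hω (norm_nonneg _)
    · simp only [h, if_false, norm_zero]
      exact mul_nonneg (by linarith) (norm_nonneg _)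
  · have hYm : StronglyMeasurable fun z : EuclideanSpace ℝ (Fin p) × (Bool → ℝ) =>
        z.2 t - m := by
      have h : Measurable fun z : EuclideanSpace ℝ (Fin p) × (Bool → ℝ) => z.2 t :=
        (measurable_pi_apply t).comp measurable_snd
      exact (h.sub_const m).stronglyMeasurable
    refine (hipw _ hYm).trans ?_
    simp only
    rw [integral_sub ((hreg.outcome_memLp t).integrable one_le_two) (integrable_const m)]
    simp [hm, armMean]

end InversePropensity

/-! ### Weighted sums of the noise -/

section Noise

variable {Ω : Type*} [MeasurableSpace Ω] {P : Measure Ω}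

/-- `Z = O_p(1)` if `Z` agrees with some `O_p(1)` sequence on each event `{|W n| ≤ M}`, where
`W = O_p(1)`. -/
lemma BddP.of_truncation {W Z : ℕ → Ω → ℝ} (hW : BddP P W)
    (h : ∀ M : ℝ, 0 ≤ M → ∃ Z' : ℕ → Ω → ℝ, BddP P Z' ∧
      ∀ᶠ n in atTop, ∀ ω, |W n ω| ≤ M → Z n ω = Z' n ω) : BddP P Z := by
  intro ε hε
  obtain ⟨M, hM⟩ := hW (ε / 2) (half_pos hε)
  obtain ⟨Z', hZ', heq⟩ := h (max M 0) (le_max_right _ _)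
  obtain ⟨M', hM'⟩ := hZ' (ε / 2) (half_pos hε)
  refine ⟨M', ?_⟩
  filter_upwards [hM, hM', heq] with n h1 h2 h3
  have hle : ENNReal.ofReal (ε / 2) + ENNReal.ofReal (ε / 2) = ENNReal.ofReal ε := by
    rw [← ENNReal.ofReal_add (by positivity) (by positivity), add_halves]
  refine le_trans ?_ ((add_le_add h1 h2).trans hle.le)
  refine (measure_mono ?_).trans (measure_union_le _ _)
  intro ω hω
  by_cases hm : M < |W n ω|
  · exact Or.inl hm
  · refine Or.inr ?_
    have := h3 ω ((not_lt.1 hm).trans (le_max_left _ _))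
    simp only [mem_ofPred_eq] at hω ⊢
    rwa [← this]

/-- The second moment of a sum of uncorrelated centred variables with random weights that are
independent of them. -/
lemma lintegral_sq_sum_mul_le [IsProbabilityMeasure P] {ι α : Type*} [Fintype ι]
    [MeasurableSpace α] {A : Ω → α} (hA : Measurable A) {e : Ω → ι → ℝ}
    (hind : IndepFun A e P) (he2 : ∀ i, MemLp (fun ω => e ω i) 2 P) {σ : ℝ} (hσ : 0 ≤ σ)
    (hvar : ∀ i, ∫ ω, e ω i * e ω i ∂P = σ)
    (hcov : ∀ i j, i ≠ j → ∫ ω, e ω i * e ω j ∂P = 0)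
    {c : α → ι → ℝ} (hc : ∀ i, Measurable fun a => c a i) {B : ℝ} (hcB : ∀ a, ∑ i, c a i ^ 2 ≤ B) :
    ∫⁻ ω, ENNReal.ofReal ((∑ i, c (A ω) i * e ω i) ^ 2) ∂P ≤ ENNReal.ofReal (B * σ) := by
  classical
  have hcb : ∀ a i, |c a i| ≤ √B := fun a i => by
    refine Real.abs_le_sqrt ((Finset.single_le_sum (f := fun i => c a i ^ 2)
      (fun j _ => sq_nonneg _) (Finset.mem_univ i)).trans (hcB a))
  have hcc : ∀ i j, Integrable (fun ω => c (A ω) i * c (A ω) j) P := fun i j =>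
    (integrable_const (√B * √B)).mono' (((hc i).comp hA).mul ((hc j).comp hA)).aestronglyMeasurable
      (ae_of_all _ fun ω => by
        rw [norm_mul, Real.norm_eq_abs, Real.norm_eq_abs]
        exact mul_le_mul (hcb _ _) (hcb _ _) (abs_nonneg _) (Real.sqrt_nonneg _))
  have hee : ∀ i j, Integrable (fun ω => e ω i * e ω j) P := fun i j =>
    (he2 i).integrable_mul (he2 j)
  have hind' : ∀ i j, IndepFun (fun ω => c (A ω) i * c (A ω) j) (fun ω => e ω i * e ω j) P :=
    fun i j => by
      have h1 : Measurable fun v : ι → ℝ => v i := measurable_pi_apply i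
      have h2 : Measurable fun v : ι → ℝ => v j := measurable_pi_apply j
      exact hind.comp ((hc i).mul (hc j)) (h1.mul h2)
  have hterm : ∀ i j, Integrable (fun ω => (c (A ω) i * c (A ω) j) * (e ω i * e ω j)) P :=
    fun i j => (hind' i j).integrable_mul (hcc i j) (hee i j)
  have hexp : ∀ ω, (∑ i, c (A ω) i * e ω i) ^ 2 =
      ∑ i, ∑ j, (c (A ω) i * c (A ω) j) * (e ω i * e ω j) := by
    intro ω
    rw [pow_two, Finset.sum_mul_sum]
    exact Finset.sum_congr rfl fun i _ => Finset.sum_congr rfl fun j _ => by ring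
  have hint : Integrable (fun ω => (∑ i, c (A ω) i * e ω i) ^ 2) P := by
    simp only [hexp]
    exact integrable_finsetSum _ fun i _ => integrable_finsetSum _ fun j _ => hterm i j
  rw [← ofReal_integral_eq_lintegral_ofReal hint (ae_of_all _ fun ω => sq_nonneg _)]
  refine ENNReal.ofReal_le_ofReal ?_
  have hval : ∫ ω, (∑ i, c (A ω) i * e ω i) ^ 2 ∂P = ∑ i, (∫ ω, c (A ω) i * c (A ω) i ∂P) * σ := by
    simp only [hexp]
    rw [integral_finsetSum _ fun i _ => integrable_finsetSum _ fun j _ => hterm i j]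
    refine Finset.sum_congr rfl fun i _ => ?_
    rw [integral_finsetSum _ fun j _ => hterm i j, Finset.sum_eq_single i]
    · rw [(hind' i i).integral_fun_mul_eq_mul_integral (hcc i i).1 (hee i i).1, hvar]
    · intro j _ hj
      rw [(hind' i j).integral_fun_mul_eq_mul_integral (hcc i j).1 (hee i j).1, hcov i j hj.symm,
        mul_zero]
    · simp
  rw [hval, ← Finset.sum_mul]
  refine mul_le_mul_of_nonneg_right ?_ hσ
  rw [← integral_finsetSum _ fun i _ => hcc i i]
  have := integral_mono (μ := P) (integrable_finsetSum _ fun i _ => hcc i i)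
    (integrable_const B) (fun ω => by simpa only [pow_two] using hcB (A ω))
  simpa using this

end Noise

section Balance

variable {Ω : Type*} [MeasurableSpace Ω] {P : Measure Ω} {p K : ℕ}
  {X : ℕ → Ω → EuclideanSpace ℝ (Fin p)} {T : ℕ → Ω → Bool} {Y : ℕ → Ω → Bool → ℝ}
  {f : ℝ → ℝ} {Φ : EuclideanSpace ℝ (Fin p) → EuclideanSpace ℝ (Fin K)}
  {W R : Matrix (Fin K) (Fin K) ℝ} {δ : ℕ → ℝ} {Θ : Set (EuclideanSpace ℝ (Fin K))}
  {θhat : Bool → (n : ℕ) → (Fin n → EuclideanSpace ℝ (Fin p)) → (Fin n → Bool) →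
      EuclideanSpace ℝ (Fin K)}

lemma score_self_eq_norm_sq (hR : R.transpose * R = W) (v : EuclideanSpace ℝ (Fin K)) :
    score W v v = ‖Matrix.toEuclideanLin R v‖ ^ 2 := by
  rw [← real_inner_self_eq_norm_sq, score, ← hR]
  simp only [Matrix.toLpLin_apply, EuclideanSpace.inner_eq_star_dotProduct]
  simp only [star_trivial, ← Matrix.mulVec_mulVec]
  rw [dotProduct_comm, dotProduct_comm, Matrix.dotProduct_mulVec, Matrix.mulVec_transpose]

lemma exists_norm_le_mul_norm_toEuclideanLin (hW : W.PosDef) (hR : R.transpose * R = W) :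
    ∃ c : ℝ, 0 < c ∧ ∀ v, ‖v‖ ≤ c * ‖Matrix.toEuclideanLin R v‖ := by
  have hinj : LinearMap.ker (Matrix.toEuclideanLin R) = ⊥ := by
    rw [LinearMap.ker_eq_bot']
    intro v hv
    by_contra hne
    have h1 := score_self_eq_norm_sq hR v
    rw [hv, norm_zero] at h1
    have h2 := hW.re_dotProduct_pos (x := v.ofLp) (fun h => hne (by ext i; simp [h]))
    rw [score, Matrix.toLpLin_apply, EuclideanSpace.inner_eq_star_dotProduct] at h1
    simp only [star_trivial] at h1 h2
    rw [dotProduct_comm] at h1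
    simp at h1 h2
    linarith
  obtain ⟨c, hc, hlip⟩ := (Matrix.toEuclideanLin R).exists_antilipschitzWith hinj
  refine ⟨c, by exact_mod_cast hc, fun v => ?_⟩
  have := hlip.le_mul_dist v 0
  simpa using this

lemma measurable_rawWeight (hΦ : Measurable Φ) {n : ℕ} {d : ℝ}
    (hθ : IsDualSolver f Φ R d (fun t => θhat t n)) (i : Fin n) :
    Measurable fun z : Fin n → EuclideanSpace ℝ (Fin p) × Bool =>
      rawWeight f Φ R (fun t => θhat t n) (fun j => (z j).1) (fun j => (z j).2) i := by
  have hx : Measurable fun z : Fin n → EuclideanSpace ℝ (Fin p) × Bool => fun j => (z j).1 :=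
    measurable_pi_lambda _ fun j => measurable_fst.comp (measurable_pi_apply j)
  have hs : Measurable fun z : Fin n → EuclideanSpace ℝ (Fin p) × Bool => fun j => (z j).2 :=
    measurable_pi_lambda _ fun j => measurable_snd.comp (measurable_pi_apply j)
  have hΦi : ∀ j : Fin n, Measurable fun z : Fin n → EuclideanSpace ℝ (Fin p) × Bool =>
      Φ (z j).1 := fun j => hΦ.comp (measurable_fst.comp (measurable_pi_apply j))
  have hmean : Measurable fun z : Fin n → EuclideanSpace ℝ (Fin p) × Bool =>
      basisMean Φ (fun j => (z j).1) :=
    (Finset.measurable_fun_sum Finset.univ fun j _ => hΦi j).const_smul (n : ℝ)⁻¹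
  have hθt : ∀ t, Measurable fun z : Fin n → EuclideanSpace ℝ (Fin p) × Bool =>
      θhat t n (fun j => (z j).1) (fun j => (z j).2) := fun t =>
    (hθ.measurable t).comp (hx.prodMk hs)
  have hθi : Measurable fun z : Fin n → EuclideanSpace ℝ (Fin p) × Bool =>
      θhat (z i).2 n (fun j => (z j).1) (fun j => (z j).2) := by
    have : (fun z : Fin n → EuclideanSpace ℝ (Fin p) × Bool =>
        θhat (z i).2 n (fun j => (z j).1) (fun j => (z j).2)) = fun z => if (z i).2 = true then
        θhat true n (fun j => (z j).1) (fun j => (z j).2) else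
          θhat false n (fun j => (z j).1) (fun j => (z j).2) := by
      funext z; cases (z i).2 <;> simp
    rw [this]
    exact Measurable.ite ((measurable_snd.comp (measurable_pi_apply i))
      (measurableSet_singleton true)) (hθt true) (hθt false)
  exact (measurable_conjDeriv f).comp
    (hθi.inner ((measurable_toEuclideanLin R).comp ((hΦi i).sub hmean)))

lemma measurable_mbWeight (hΦ : Measurable Φ) {n : ℕ} {d : ℝ}
    (hθ : IsDualSolver f Φ R d (fun t => θhat t n)) (i : Fin n) :
    Measurable fun z : Fin n → EuclideanSpace ℝ (Fin p) × Bool =>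
      mbWeight f Φ R (fun t => θhat t n) (fun j => (z j).1) (fun j => (z j).2) i := by
  refine (measurable_rawWeight hΦ hθ i).div (Finset.measurable_fun_sum Finset.univ fun j _ => ?_)
  exact Measurable.ite (measurableSet_eq_fun (measurable_snd.comp (measurable_pi_apply j))
    (measurable_snd.comp (measurable_pi_apply i))) (measurable_rawWeight hΦ hθ j) measurable_const

end Balance

/-! ### Balancing weights and a linear outcome model -/

section LinearOutcome

variable {Ω : Type*} [MeasurableSpace Ω] {P : Measure Ω} {p K : ℕ}
  {X : ℕ → Ω → EuclideanSpace ℝ (Fin p)} {T : ℕ → Ω → Bool} {Y : ℕ → Ω → Bool → ℝ}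
  {f : ℝ → ℝ} {Φ : EuclideanSpace ℝ (Fin p) → EuclideanSpace ℝ (Fin K)}
  {W R : Matrix (Fin K) (Fin K) ℝ} {δ : ℕ → ℝ} {Θ : Set (EuclideanSpace ℝ (Fin K))}
  {θhat : Bool → (n : ℕ) → (Fin n → EuclideanSpace ℝ (Fin p)) → (Fin n → Bool) →
      EuclideanSpace ℝ (Fin K)}

lemma armSum_sampleWeight {Ω : Type*} {X : ℕ → Ω → EuclideanSpace ℝ (Fin p)} {T : ℕ → Ω → Bool}
    {t : Bool} {n : ℕ} {ω : Ω}
    (hS : armSum (fun i : Fin n => T i ω) t (sampleRawWeight X T f Φ R θhat n ω) ≠ 0) :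
    armSum (fun i : Fin n => T i ω) t (sampleWeight X T f Φ R θhat n ω) = 1 := by
  rw [← div_self hS, ← armSum_div]
  exact armSum_congr fun i hi => sampleWeight_eq hi

/-- In a linear outcome model the error of the weighted mean consists of the sampling error of the
basis functions, the imbalance of the weights, and a weighted sum of the noise. -/
lemma armEstimator_eq_of_linear {Ω : Type*} {X : ℕ → Ω → EuclideanSpace ℝ (Fin p)}
    {T : ℕ → Ω → Bool} {Y : ℕ → Ω → Bool → ℝ} {t : Bool} {n : ℕ} {ω : Ω}
    (hS : armSum (fun i : Fin n => T i ω) t (sampleRawWeight X T f Φ R θhat n ω) ≠ 0)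
    (β : EuclideanSpace ℝ (Fin K)) :
    armEstimator X T Y f Φ R θhat t n ω =
      inner ℝ β (basisMean Φ fun i : Fin n => X i ω) +
      inner ℝ β (∑ i : Fin n, if T i ω = t then sampleWeight X T f Φ R θhat n ω i •
        (Φ (X i ω) - basisMean Φ fun i : Fin n => X i ω) else 0) +
      armSum (fun i : Fin n => T i ω) t (fun i => sampleWeight X T f Φ R θhat n ω i *
        (Y i ω t - inner ℝ β (Φ (X i ω)))) := by
  set b := basisMean Φ fun i : Fin n => X i ω with hb
  have h1 : inner ℝ β b = armSum (fun i : Fin n => T i ω) t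
      (fun i => sampleWeight X T f Φ R θhat n ω i * inner ℝ β b) := by
    rw [armSum_mul_const, armSum_sampleWeight hS, one_mul]
  have h2 : inner ℝ β (∑ i : Fin n, if T i ω = t then sampleWeight X T f Φ R θhat n ω i •
        (Φ (X i ω) - b) else 0) = armSum (fun i : Fin n => T i ω) t
      (fun i => sampleWeight X T f Φ R θhat n ω i * (inner ℝ β (Φ (X i ω)) - inner ℝ β b)) := by
    rw [inner_sum, armSum]
    refine Finset.sum_congr rfl fun i _ => ?_
    by_cases h : T i ω = t
    · simp only [h, if_true, inner_smul_right, inner_sub_right]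
    · simp [h]
  rw [h1, h2, ← armSum_add, ← armSum_add, armEstimator]
  exact armSum_congr fun i hi => by rw [hi]; ring

/-- Weighted sums of the noise of arm `t`, with weights that depend on the covariates and treatments
only, are `O_p(n^{-1/2})` if the sum of the squared weights is `O_p(n⁻¹)`. -/
lemma bddP_armSum_sampleWeight_mul [IsProbabilityMeasure P] (hsample : IsIIDSample P X T Y)
    (hΦ : Measurable Φ) (hθ : ∀ n, IsDualSolver f Φ R (δ n) (fun t => θhat t n)) {t : Bool}
    {e : EuclideanSpace ℝ (Fin p) × (Bool → ℝ) → ℝ} (he : Measurable e)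
    (hind0 : IndepFun (fun ω => (X 0 ω, T 0 ω)) (fun ω => e (X 0 ω, Y 0 ω)) P)
    (he2 : MemLp (fun ω => e (X 0 ω, Y 0 ω)) 2 P) (he0 : ∫ ω, e (X 0 ω, Y 0 ω) ∂P = 0)
    (hsq : BddP P (fun n ω => n * armSum (fun i : Fin n => T i ω) t
      (fun i => sampleWeight X T f Φ R θhat n ω i ^ 2))) :
    BddP P (fun n ω => √n * armSum (fun i : Fin n => T i ω) t
      (fun i => sampleWeight X T f Φ R θhat n ω i * e (X i ω, Y i ω))) := by
  have heD : Measurable fun z : EuclideanSpace ℝ (Fin p) × Bool × (Bool → ℝ) => e (z.1, z.2.2) :=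
    he.comp (measurable_fst.prodMk (measurable_snd.comp measurable_snd))
  have hxs : Measurable fun z : EuclideanSpace ℝ (Fin p) × Bool × (Bool → ℝ) => (z.1, z.2.1) :=
    measurable_fst.prodMk (measurable_fst.comp measurable_snd)
  have hid : ∀ i, IdentDistrib (fun ω => e (X i ω, Y i ω)) (fun ω => e (X 0 ω, Y 0 ω)) P P :=
    fun i => (hsample.identDistrib_obs i).comp heD
  have hid2 : ∀ i, IdentDistrib (fun ω => ((X i ω, T i ω), e (X i ω, Y i ω)))
      (fun ω => ((X 0 ω, T 0 ω), e (X 0 ω, Y 0 ω))) P P :=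
    fun i => (hsample.identDistrib_obs i).comp (hxs.prodMk heD)
  have ham : ∀ i, Measurable fun ω => (X i ω, T i ω) := fun i =>
    (hsample.measurable_X i).prodMk (hsample.measurable_T i)
  have hem : ∀ i, Measurable fun ω => e (X i ω, Y i ω) := fun i =>
    he.comp ((hsample.measurable_X i).prodMk (hsample.measurable_Y i))
  have hae : ∀ i, IndepFun (fun ω => (X i ω, T i ω)) (fun ω => e (X i ω, Y i ω)) P := by
    intro i
    have h : P.map (fun ω => (X i ω, T i ω)) = P.map (fun ω => (X 0 ω, T 0 ω)) :=
      ((hsample.identDistrib_obs i).comp hxs).map_eq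
    rw [indepFun_iff_map_prod_eq_prod_map_map (ham i).aemeasurable (hem i).aemeasurable,
      (hid2 i).map_eq, (hid i).map_eq, h]
    exact (indepFun_iff_map_prod_eq_prod_map_map (ham 0).aemeasurable (hem 0).aemeasurable).1 hind0
  have hpairs : iIndepFun (fun i ω => ((X i ω, T i ω), e (X i ω, Y i ω))) P :=
    hsample.iIndepFun_obs.comp (fun _ z => ((z.1, z.2.1), e (z.1, z.2.2)))
      fun _ => hxs.prodMk heD
  have hcov : ∀ i j, i ≠ j → ∫ ω, e (X i ω, Y i ω) * e (X j ω, Y j ω) ∂P = 0 := by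
    intro i j hij
    have h : IndepFun (fun ω => e (X i ω, Y i ω)) (fun ω => e (X j ω, Y j ω)) P :=
      (hsample.iIndepFun_obs.indepFun hij).comp heD heD
    rw [h.integral_fun_mul_eq_mul_integral (hem i).aestronglyMeasurable
      (hem j).aestronglyMeasurable, (hid i).integral_eq, he0, zero_mul]
  set σ := ∫ ω, e (X 0 ω, Y 0 ω) * e (X 0 ω, Y 0 ω) ∂P with hσ
  have hσ0 : 0 ≤ σ := integral_nonneg fun ω => mul_self_nonneg _
  have hvar : ∀ i, ∫ ω, e (X i ω, Y i ω) * e (X i ω, Y i ω) ∂P = σ := fun i =>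
    ((hid i).comp (u := fun x => x * x) (measurable_id.mul measurable_id)).integral_eq
  refine hsq.of_truncation fun M hM => ?_
  classical
  -- Weights that are cut off when the sum of their squares is large.
  set w : (n : ℕ) → (Fin n → EuclideanSpace ℝ (Fin p) × Bool) → Fin n → ℝ := fun n a =>
    mbWeight f Φ R (fun t => θhat t n) (fun j => (a j).1) (fun j => (a j).2) with hw
  set G : (n : ℕ) → Set (Fin n → EuclideanSpace ℝ (Fin p) × Bool) := fun n =>
    {a | n * armSum (fun j => (a j).2) t (fun j => w n a j ^ 2) ≤ M} with hG
  set c : (n : ℕ) → (Fin n → EuclideanSpace ℝ (Fin p) × Bool) → Fin n → ℝ := fun n a i =>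
    if a ∈ G n then (if (a i).2 = t then √n * w n a i else 0) else 0 with hc
  have harm : ∀ n (i : Fin n), MeasurableSet {a : Fin n → EuclideanSpace ℝ (Fin p) × Bool |
      (a i).2 = t} := fun n i =>
    (measurable_snd.comp (measurable_pi_apply i)) (measurableSet_singleton t)
  have hwm : ∀ n i, Measurable fun a => w n a i := fun n i => measurable_mbWeight hΦ (hθ n) i
  have hGm : ∀ n, MeasurableSet (G n) := fun n => measurableSet_le
    (measurable_const.mul (Finset.measurable_fun_sum Finset.univ fun j _ =>
      Measurable.ite (harm n j) ((hwm n j).pow_const 2) measurable_const)) measurable_const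
  have hcm : ∀ n i, Measurable fun a => c n a i := fun n i =>
    Measurable.ite (hGm n) (Measurable.ite (harm n i) ((hwm n i).const_mul _) measurable_const)
      measurable_const
  have hcB : ∀ n a, ∑ i, c n a i ^ 2 ≤ M := by
    intro n a
    by_cases ha : a ∈ G n
    · refine le_trans (le_of_eq ?_) ha
      rw [armSum, Finset.mul_sum]
      refine Finset.sum_congr rfl fun i _ => ?_
      by_cases h : (a i).2 = t
      · simp only [hc, ha, h, if_true, mul_pow, Real.sq_sqrt (Nat.cast_nonneg n)]
      · simp [hc, ha, h]
    · simpa [hc, ha] using hM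
  refine ⟨fun n ω => ∑ i : Fin n, c n (fun j => (X j ω, T j ω)) i * e (X i ω, Y i ω), ?_, ?_⟩
  · refine BddP.of_lintegral_sq_le (C := M * σ) (by positivity) (Eventually.of_forall fun n => ?_)
      fun n => ?_
    · exact lintegral_sq_sum_mul_le (A := fun ω (j : Fin n) => (X j ω, T j ω))
        (e := fun ω (i : Fin n) => e (X i ω, Y i ω))
        (measurable_pi_lambda _ fun j => ham j)
        (indepFun_pi_of_pairs ham hem hpairs hae n) (fun i => (hid i).memLp_iff.2 he2) hσ0
        (fun i => hvar i) (fun i j hij => hcov i j (fun h => hij (Fin.ext h))) (hcm n) (hcB n)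
    · exact (Finset.measurable_fun_sum Finset.univ fun i _ =>
        ((hcm n i).comp (measurable_pi_lambda _ fun j : Fin n => ham j)).mul
          (hem i)).aemeasurable
  · refine Eventually.of_forall fun n ω hω => ?_
    have ha : (fun j : Fin n => (X j ω, T j ω)) ∈ G n := (le_abs_self _).trans hω
    rw [armSum, Finset.mul_sum]
    refine Finset.sum_congr rfl fun i _ => ?_
    by_cases h : T i ω = t
    · simp only [hc, ha, h, if_true]
      rw [← mul_assoc]; rfl
    · simp [hc, ha, h]

/-- In a linear outcome model, the weighted mean is `O_p(n^{-1/2})`-consistent when the squared norm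
and the imbalance of the normalized weights are `O_p(n⁻¹)`. -/
theorem armEstimator_of_linearOutcome [IsProbabilityMeasure P] (hsample : IsIIDSample P X T Y)
    (hΦ : Measurable Φ) (hW : W.PosDef) (hR : R.transpose * R = W)
    (hθ : ∀ n, IsDualSolver f Φ R (δ n) (fun t => θhat t n))
    (hign : StrongIgnorability P (X 0) (T 0) (Y 0))
    (hreg : Regularity P (X 0) (T 0) (Y 0) f Φ R δ Θ) {t : Bool}
    (hlin : LinearOutcome P (X 0) (Y 0) Φ t)
    (hpos : WHP P (fun n ω => 0 < armSum (fun i : Fin n => T i ω) t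
      (sampleRawWeight X T f Φ R θhat n ω)))
    (hsq : BddP P (fun n ω => n * armSum (fun i : Fin n => T i ω) t
      (fun i => sampleWeight X T f Φ R θhat n ω i ^ 2)))
    (himb : BddP P (fun n ω => n * imbalance Φ W (fun i : Fin n => X i ω)
      (fun i : Fin n => T i ω) t (sampleWeight X T f Φ R θhat n ω))) :
    BddP P (fun n ω => √n * (armEstimator X T Y f Φ R θhat t n ω - armMean P (Y 0) t)) := by
  have hX := hsample.measurable_X 0
  have hT := hsample.measurable_T 0
  have hY := hsample.measurable_Y 0
  obtain ⟨β, hβ⟩ := hlin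
  obtain ⟨c, hc, hcR⟩ := exists_norm_le_mul_norm_toEuclideanLin hW hR
  set e : EuclideanSpace ℝ (Fin p) × (Bool → ℝ) → ℝ := fun z => z.2 t - inner ℝ β (Φ z.1) with he
  have hβΦ : Measurable fun x => inner ℝ β (Φ x) := measurable_const.inner hΦ
  have hem : Measurable e :=
    ((measurable_pi_apply t).comp measurable_snd).sub (hβΦ.comp measurable_fst)
  have hβ2 : MemLp (fun ω => inner ℝ β (Φ (X 0 ω))) 2 P := hreg.basis_memLp.const_inner β
  have hY2 := hreg.outcome_memLp t
  have hnoise : noise P (X 0) (Y 0) t =ᵐ[P] fun ω => e (X 0 ω, Y 0 ω) := by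
    filter_upwards [hβ] with ω hω
    simp only [noise, he, hω]
  have hmean : armMean P (Y 0) t = ∫ ω, inner ℝ β (Φ (X 0 ω)) ∂P := by
    rw [← integral_congr_ae hβ]
    exact (integral_condExp hX.comap_le).symm
  have he0 : ∫ ω, e (X 0 ω, Y 0 ω) ∂P = 0 := by
    simp only [he]
    rw [integral_sub (hY2.integrable one_le_two) (hβ2.integrable one_le_two), ← hmean]
    exact sub_self _
  have hindX : IndepFun (fun ω => e (X 0 ω, Y 0 ω)) (X 0) P :=
    (hreg.noise_indep_cov.comp (measurable_pi_apply t) measurable_id).congr hnoise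
      (ae_eq_refl _)
  have hN := bddP_armSum_sampleWeight_mul hsample hΦ hθ hem
    (hign.indepFun hX hT hY hem hindX) (hY2.sub hβ2) he0 hsq
  have hM : BddP P (fun n ω => √n * sampleMean (obs X T Y)
      (fun z => inner ℝ β (Φ z.1) - armMean P (Y 0) t) n ω) := by
    refine bddP_sqrt_mul_sampleMean hsample.iIndepFun_obs hsample.identDistrib_obs
      ((hβΦ.comp measurable_fst).sub_const _) (hβ2.sub (memLp_const _)) ?_
    refine (integral_sub (hβ2.integrable one_le_two) (integrable_const _)).trans ?_
    rw [← hmean]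
    simp
  have hI : BddP P (fun n ω => √n * inner ℝ β (∑ i : Fin n, if T i ω = t then
      sampleWeight X T f Φ R θhat n ω i • (Φ (X i ω) - basisMean Φ fun i : Fin n => X i ω)
        else 0)) := by
    refine himb.of_whp fun M hM => ⟨‖β‖ * (c * √M), WHP.of_ae fun n => ae_of_all _ fun ω hω => ?_⟩
    set v := ∑ i : Fin n, if T i ω = t then sampleWeight X T f Φ R θhat n ω i •
      (Φ (X i ω) - basisMean Φ fun i : Fin n => X i ω) else 0 with hv
    have h1 : imbalance Φ W (fun i : Fin n => X i ω) (fun i : Fin n => T i ω) t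
        (sampleWeight X T f Φ R θhat n ω) = ‖Matrix.toEuclideanLin R v‖ ^ 2 :=
      score_self_eq_norm_sq hR v
    rw [h1] at hω
    have h2 : √n * ‖Matrix.toEuclideanLin R v‖ ≤ √M := by
      refine Real.le_sqrt_of_sq_le ?_
      rw [mul_pow, Real.sq_sqrt (Nat.cast_nonneg n)]
      exact (le_abs_self _).trans hω
    rw [abs_mul, abs_of_nonneg (Real.sqrt_nonneg _)]
    calc √n * |inner ℝ β v| ≤ √n * (‖β‖ * (c * ‖Matrix.toEuclideanLin R v‖)) := by
          gcongr
          exact (abs_real_inner_le_norm _ _).trans (by gcongr; exact hcR v)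
      _ = ‖β‖ * (c * (√n * ‖Matrix.toEuclideanLin R v‖)) := by ring
      _ ≤ ‖β‖ * (c * √M) := by gcongr
  refine ((hM.add hI).add hN).of_whp_le ?_
  refine hpos.mono ?_
  filter_upwards [eventually_gt_atTop 0] with n hn ω hω
  have hn' : (n : ℝ) ≠ 0 := by positivity
  refine le_of_eq ?_
  congr 1
  rw [armEstimator_eq_of_linear hω.ne' β, sampleMean, Finset.sum_sub_distrib, basisMean,
    inner_smul_right, inner_sum]
  simp only [Finset.sum_const, Finset.card_univ, Fintype.card_fin, nsmul_eq_mul, smul_eq_mul, he,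
    obs, mul_sub, inv_mul_cancel_left₀ hn']
  ring

end LinearOutcome

/-! ### Exponential moments and the population dual problem of the entropy loss -/

section ExponentialMoments

variable {Ω : Type*} [MeasurableSpace Ω] {μ : Measure Ω} {K : ℕ} {V : Ω → EuclideanSpace ℝ (Fin K)}

lemma sq_le_two_mul_exp_add_exp (x : ℝ) : x ^ 2 ≤ 2 * (Real.exp x + Real.exp (-x)) := by
  have h1 := Real.quadratic_le_exp_of_nonneg (abs_nonneg x)
  have h2 : Real.exp |x| ≤ Real.exp x + Real.exp (-x) := by
    rcases abs_choice x with h | h <;> rw [h] <;> linarith [Real.exp_pos x, Real.exp_pos (-x)]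
  rw [sq_abs] at h1
  linarith [abs_nonneg x]

/-- Exponential moments in a neighbourhood of `θ₀` dominate the second moments of the exponentially
tilted distribution at `θ₀`. -/
lemma integrable_exp_mul_norm_sq (hV : Measurable V) {θ₀ : EuclideanSpace ℝ (Fin K)} {r a : ℝ}
    (hr : 0 < r) (ha : 0 < a)
    (h : ∀ θ ∈ Metric.closedBall θ₀ r, Integrable (fun ω => Real.exp (a * inner ℝ θ (V ω))) μ) :
    Integrable (fun ω => Real.exp (a * inner ℝ θ₀ (V ω)) * ‖V ω‖ ^ 2) μ := by
  set e : Fin K → EuclideanSpace ℝ (Fin K) := fun k => EuclideanSpace.single k r with he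
  have hen : ∀ k, ‖e k‖ = r := fun k => by simp [he, abs_of_pos hr]
  have hint : Integrable (fun ω => (2 / (a * r) ^ 2) *
      ∑ k, (Real.exp (a * inner ℝ (θ₀ + e k) (V ω)) +
      Real.exp (a * inner ℝ (θ₀ - e k) (V ω)))) μ := by
    refine (integrable_finsetSum _ fun k _ => (h _ ?_).add (h _ ?_)).const_mul _ <;>
    simp [hen]
  refine hint.mono' (((measurable_const.inner hV).const_mul a).exp.mul
    (hV.norm.pow_const 2)).aestronglyMeasurable (ae_of_all _ fun ω => ?_)
  rw [Real.norm_of_nonneg (by positivity), EuclideanSpace.norm_sq_eq, Finset.mul_sum,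
    Finset.mul_sum]
  refine Finset.sum_le_sum fun k _ => ?_
  have h1 : inner ℝ (e k) (V ω) = r * V ω k := by
    simp [he, EuclideanSpace.inner_single_left]
  have h2 := sq_le_two_mul_exp_add_exp (a * (r * V ω k))
  rw [inner_add_left, inner_sub_left, h1, mul_add a, mul_sub a, sub_eq_add_neg, Real.exp_add,
    Real.exp_add, ← mul_add, Real.norm_eq_abs, sq_abs]
  have h3 : V ω k ^ 2 ≤ 2 / (a * r) ^ 2 *
      (Real.exp (a * (r * V ω k)) + Real.exp (-(a * (r * V ω k)))) := by
    rw [div_mul_eq_mul_div, le_div_iff₀ (by positivity)]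
    calc V ω k ^ 2 * (a * r) ^ 2 = (a * (r * V ω k)) ^ 2 := by ring
      _ ≤ _ := h2
  calc Real.exp (a * inner ℝ θ₀ (V ω)) * V ω k ^ 2 ≤ Real.exp (a * inner ℝ θ₀ (V ω)) *
      (2 / (a * r) ^ 2 * (Real.exp (a * (r * V ω k)) + Real.exp (-(a * (r * V ω k))))) := by
        gcongr
    _ = _ := by ring

/-- First order condition at an interior minimizer of `θ ↦ E exp(θᵀ V)`. -/
lemma integral_exp_smul_eq_zero (hV : Measurable V) {θ₀ : EuclideanSpace ℝ (Fin K)} {r : ℝ}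
    (hr : 0 < r)
    (h : ∀ θ ∈ Metric.closedBall θ₀ r, Integrable (fun ω => Real.exp (inner ℝ θ (V ω))) μ)
    (hmin : ∀ θ ∈ Metric.closedBall θ₀ r,
      ∫ ω, Real.exp (inner ℝ θ₀ (V ω)) ∂μ ≤ ∫ ω, Real.exp (inner ℝ θ (V ω)) ∂μ) :
    ∫ ω, Real.exp (inner ℝ θ₀ (V ω)) • V ω ∂μ = 0 := by
  have hem : ∀ θ, Measurable fun ω => Real.exp (inner ℝ θ (V ω)) := fun θ =>
    (measurable_const.inner hV).exp
  have h0 : Integrable (fun ω => Real.exp (inner ℝ θ₀ (V ω))) μ :=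
    h θ₀ (Metric.mem_closedBall_self hr.le)
  have hint : Integrable (fun ω => Real.exp (inner ℝ θ₀ (V ω)) • V ω) μ := by
    have h2 := integrable_exp_mul_norm_sq hV hr one_pos (by simpa only [one_mul] using h)
    simp only [one_mul] at h2
    refine (h0.add h2).mono' ((hem θ₀).smul hV).aestronglyMeasurable (ae_of_all _ fun ω => ?_)
    rw [norm_smul, Real.norm_of_nonneg (Real.exp_pos _).le, Pi.add_apply]
    nlinarith [Real.exp_pos (inner ℝ θ₀ (V ω)), sq_nonneg (‖V ω‖ - 1), sq_nonneg (‖V ω‖)]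
  -- The one-sided directional derivatives are nonnegative.
  have hdir : ∀ v, ‖v‖ ≤ r → 0 ≤ inner ℝ v (∫ ω, Real.exp (inner ℝ θ₀ (V ω)) • V ω ∂μ) := by
    intro v hv
    have hball : ∀ s : ℝ, |s| ≤ 1 → θ₀ + s • v ∈ Metric.closedBall θ₀ r := fun s hs => by
      rw [mem_closedBall_iff_norm, add_sub_cancel_left, norm_smul, Real.norm_eq_abs]
      exact (mul_le_of_le_one_left (norm_nonneg v) hs).trans hv
    set s : ℕ → ℝ := fun n => 1 / ((n : ℝ) + 1) with hs
    have hs0 : ∀ n, 0 < s n := fun n => by positivity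
    have hs1 : ∀ n, s n ≤ 1 := fun n => by
      rw [hs]; exact (div_le_one (by positivity)).2 (by linarith [n.cast_nonneg (α := ℝ)])
    have hexp : ∀ n ω, Real.exp (inner ℝ (θ₀ + s n • v) (V ω)) =
        Real.exp (inner ℝ θ₀ (V ω)) * Real.exp (s n * inner ℝ v (V ω)) := fun n ω => by
      rw [inner_add_left, real_inner_smul_left, Real.exp_add]
    set g : ℕ → Ω → ℝ := fun n ω => Real.exp (inner ℝ θ₀ (V ω)) *
      ((s n)⁻¹ * (Real.exp (s n * inner ℝ v (V ω)) - 1)) with hg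
    have hlim : Tendsto (fun n => ∫ ω, g n ω ∂μ) atTop
        (𝓝 (∫ ω, Real.exp (inner ℝ θ₀ (V ω)) * inner ℝ v (V ω) ∂μ)) := by
      refine tendsto_integral_of_dominated_convergence
        (fun ω => Real.exp (inner ℝ (θ₀ + (1 : ℝ) • v) (V ω)) +
          Real.exp (inner ℝ (θ₀ + (-1 : ℝ) • v) (V ω))) (fun n => ?_)
        ((h _ (hball 1 (by simp))).add (h _ (hball (-1) (by simp))))
        (fun n => ae_of_all _ fun ω => ?_)
        (ae_of_all _ fun ω => ?_)
      · exact ((hem θ₀).mul ((((measurable_const.inner hV).const_mul _).exp.sub_const 1).const_mul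
          _)).aestronglyMeasurable
      · set y := inner ℝ v (V ω) with hy
        have e1 : Real.exp (inner ℝ (θ₀ + (1 : ℝ) • v) (V ω)) =
            Real.exp (inner ℝ θ₀ (V ω)) * Real.exp y := by
          rw [inner_add_left, real_inner_smul_left, Real.exp_add, one_mul]
        have e2 : Real.exp (inner ℝ (θ₀ + (-1 : ℝ) • v) (V ω)) =
            Real.exp (inner ℝ θ₀ (V ω)) * Real.exp (-y) := by
          rw [inner_add_left, real_inner_smul_left, Real.exp_add, neg_one_mul]
        rw [e1, e2, ← mul_add, hg, norm_mul, Real.norm_of_nonneg (Real.exp_pos _).le]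
        refine mul_le_mul_of_nonneg_left ?_ (Real.exp_pos _).le
        rw [Real.norm_eq_abs, abs_le]
        have hcvx : Real.exp (s n * y) ≤ s n * Real.exp y + (1 - s n) := by
          have := convexOn_exp.2 (mem_univ y) (mem_univ 0) (hs0 n).le (sub_nonneg.2 (hs1 n))
            (by ring)
          simpa using this
        have hlow := Real.add_one_le_exp (s n * y)
        have hy1 := Real.add_one_le_exp (-y)
        have hp1 := Real.exp_pos y
        have hp2 := Real.exp_pos (-y)
        constructor
        · rw [inv_mul_eq_div, le_div_iff₀ (hs0 n)]
          nlinarith [hs0 n]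
        · rw [inv_mul_eq_div, div_le_iff₀ (hs0 n)]
          nlinarith [hs0 n]
      · refine Tendsto.const_mul _ ?_
        have hd : HasDerivAt (fun x : ℝ => Real.exp (x * inner ℝ v (V ω))) (inner ℝ v (V ω)) 0 := by
          simpa using ((hasDerivAt_id (0 : ℝ)).mul_const (inner ℝ v (V ω))).exp
        have ht : Tendsto s atTop (𝓝[>] 0) :=
          tendsto_nhdsWithin_iff.2 ⟨tendsto_one_div_add_atTop_nhds_zero_nat,
            Eventually.of_forall hs0⟩
        have := hd.tendsto_slope_zero_right.comp ht
        simpa [Function.comp_def] using this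
    have hnn : ∀ n, 0 ≤ ∫ ω, g n ω ∂μ := by
      intro n
      have hb := hball (s n) (by rw [abs_of_pos (hs0 n)]; exact hs1 n)
      have e : ∀ ω, g n ω = (s n)⁻¹ * (Real.exp (inner ℝ (θ₀ + s n • v) (V ω)) -
          Real.exp (inner ℝ θ₀ (V ω))) := fun ω => by
        rw [hexp]; simp only [hg]; ring
      simp only [e]
      rw [integral_const_mul, integral_sub (h _ hb) h0]
      exact mul_nonneg (inv_nonneg.2 (hs0 n).le) (sub_nonneg.2 (hmin _ hb))
    rw [← integral_inner hint]
    simp only [inner_smul_right]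
    exact ge_of_tendsto' hlim hnn
  by_contra hne
  set w := ∫ ω, Real.exp (inner ℝ θ₀ (V ω)) • V ω ∂μ with hw
  have hwn : 0 < ‖w‖ := norm_pos_iff.2 hne
  have h1 := hdir (-(r / ‖w‖) • w) (by
    rw [norm_smul, norm_neg, Real.norm_of_nonneg (by positivity), div_mul_cancel₀ _ hwn.ne'])
  rw [real_inner_smul_left, real_inner_self_eq_norm_sq] at h1
  have : 0 < r / ‖w‖ * ‖w‖ ^ 2 := by positivity
  linarith

lemma eexpect_coe {F : Ω → ℝ} (hF : Integrable F μ) (hF0 : ∀ ω, 0 ≤ F ω) :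
    eexpect μ (fun ω => (F ω : EReal)) = ((∫ ω, F ω ∂μ : ℝ) : EReal) := by
  have h1 : ∀ ω, (-(F ω : EReal)).toENNReal = 0 := fun ω => by
    rw [EReal.toENNReal_eq_zero_iff]
    exact_mod_cast neg_nonpos.2 (hF0 ω)
  have h2 : ∀ ω, (F ω : EReal).toENNReal = ENNReal.ofReal (F ω) := fun ω => by
    rw [EReal.toENNReal_of_ne_top (EReal.coe_ne_top _), EReal.toReal_coe]
  simp only [eexpect, h1, h2, lintegral_zero, EReal.coe_ennreal_zero, sub_zero]
  rw [← ofReal_integral_eq_lintegral_ofReal hF (ae_of_all _ hF0), EReal.coe_ennreal_ofReal,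
    max_eq_left (integral_nonneg hF0)]

end ExponentialMoments

section Entropy

variable {Ω : Type*} [MeasurableSpace Ω] {P : Measure Ω} {p K : ℕ}
  {X : ℕ → Ω → EuclideanSpace ℝ (Fin p)} {T : ℕ → Ω → Bool} {Y : ℕ → Ω → Bool → ℝ}
  {f : ℝ → ℝ} {Φ : EuclideanSpace ℝ (Fin p) → EuclideanSpace ℝ (Fin K)}
  {R : Matrix (Fin K) (Fin K) ℝ} {δ : ℕ → ℝ} {Θ : Set (EuclideanSpace ℝ (Fin K))}

/-- Centring at the mean of an arm or at the overall mean changes the exponential moments by a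
constant factor only. -/
lemma Regularity.integrable_exp_inner_feature
    (hreg : Regularity P (X 0) (T 0) (Y 0) f Φ R δ Θ) {a : ℝ} (ha : a ∈ ({1, 2, 3} : Set ℝ))
    {θ : EuclideanSpace ℝ (Fin K)} (hθ : θ ∈ Θ) :
    Integrable (fun ω => Real.exp (a * inner ℝ θ (feature P (X 0) Φ R (obs X T Y 0 ω)))) P := by
  set m₁ := ∫ ω', Φ (X 0 ω') ∂(P[|T 0 ⁻¹' {true}]) with hm₁
  set m := ∫ ω, Φ (X 0 ω) ∂P with hm
  refine ((hreg.exp_moment a ha θ hθ true).mul_const (Real.exp (a * score R θ (m₁ - m)))).congr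
    (ae_of_all _ fun ω => ?_)
  simp only
  rw [← Real.exp_add, ← mul_add, score, score, ← inner_add_right, ← map_add, sub_add_sub_cancel]
  rfl

/-- For the entropy loss the population dual objective is a multiple of `E 1{T = t} exp(θᵀ V)`,
where `V` are the centred features; so the minimizer over `Θ` satisfies the first order condition. -/
lemma Regularity.exists_entropy_minimizer [IsProbabilityMeasure P] (hE : IsEntropy f)
    (hX : Measurable (X 0)) (hT : Measurable (T 0)) (hY : Measurable (Y 0)) (hΦ : Measurable Φ)
    (hreg : Regularity P (X 0) (T 0) (Y 0) f Φ R δ Θ) (t : Bool) :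
    ∃ (θ₀ : EuclideanSpace ℝ (Fin K)) (r : ℝ), 0 < r ∧ Metric.closedBall θ₀ r ⊆ Θ ∧
      ∫ ω, (if T 0 ω = t then Real.exp (inner ℝ θ₀ (feature P (X 0) Φ R (obs X T Y 0 ω))) •
        feature P (X 0) Φ R (obs X T Y 0 ω) else 0) ∂P = 0 := by
  have hf := hreg.strictConvexOn
  have hC := hreg.contDiffOn
  obtain ⟨θ₀, hθ₀, hlt⟩ := hreg.unique_min t
  obtain ⟨r, hr, hball⟩ := Metric.nhds_basis_closedBall.mem_iff.1 (mem_interior_iff_mem_nhds.1 hθ₀)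
  refine ⟨θ₀, r, hr, hball, ?_⟩
  set V : Ω → EuclideanSpace ℝ (Fin K) :=
    fun ω => feature P (X 0) Φ R (obs X T Y 0 ω) with hVdef
  have hV : Measurable V := (measurable_feature hΦ).comp (hX.prodMk (hT.prodMk hY))
  have harm : MeasurableSet (T 0 ⁻¹' {t}) := hT (measurableSet_singleton t)
  have hint : ∀ θ ∈ Θ, Integrable (fun ω => Real.exp (inner ℝ θ (V ω))) P := fun θ hθ => by
    simpa only [one_mul] using hreg.integrable_exp_inner_feature (a := 1) (by simp) hθ
  have hpop : ∀ θ ∈ Θ, popDualObj P (X 0) (T 0) f Φ R t θ =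
      ((Real.exp (-1) * ∫ ω in T 0 ⁻¹' {t}, Real.exp (inner ℝ θ (V ω)) ∂P : ℝ) : EReal) := by
    intro θ hθ
    have h1 : ∀ ω, (if T 0 ω = t then conj f (score R θ (centered P (X 0) Φ ω)) else 0) =
        (((T 0 ⁻¹' {t}).indicator
          (fun ω => Real.exp (-1) * Real.exp (inner ℝ θ (V ω))) ω : ℝ) : EReal) := by
      intro ω
      by_cases h : T 0 ω = t
      · rw [if_pos h, hE.conj_eq hf hC, indicator_of_mem (show ω ∈ T 0 ⁻¹' {t} from h),
          sub_eq_neg_add, Real.exp_add]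
        rfl
      · rw [if_neg h, indicator_of_notMem (show ω ∉ T 0 ⁻¹' {t} from h)]
        rfl
    simp only [popDualObj, h1]
    rw [eexpect_coe (((hint θ hθ).const_mul _).indicator harm)
      (fun ω => indicator_nonneg (fun _ _ => by positivity) ω), integral_indicator harm,
      integral_const_mul]
  have key := integral_exp_smul_eq_zero (μ := P.restrict (T 0 ⁻¹' {t})) hV hr
    (fun θ hθ => (hint θ (hball hθ)).restrict) (fun θ hθ => ?_)
  · rw [← integral_indicator harm] at key
    refine (integral_congr_ae (ae_of_all _ fun ω => ?_)).trans key
    by_cases h : T 0 ω = t <;> simp [indicator, h, hVdef]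
  · rcases eq_or_ne θ θ₀ with rfl | hne
    · exact le_rfl
    · have h1 := hlt θ (hball hθ) hne
      rw [hpop θ (hball hθ), hpop θ₀ (interior_subset hθ₀), EReal.coe_lt_coe_iff] at h1
      exact (lt_of_mul_lt_mul_left h1 (Real.exp_pos _).le).le

end Entropy

/-! ### Entropy balancing -/

lemma HasStrongTangent.mono {f : ℝ → ℝ} {y ρ c c' : ℝ} (h : HasStrongTangent f y ρ c)
    (hc : c' ≤ c) : HasStrongTangent f y ρ c' :=
  ⟨h.ne_top, h.continuousAt, fun x s hs hs1 hsx => le_trans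
    (EReal.coe_le_coe_iff.2 (by gcongr)) (h.le_conj x s hs hs1 hsx)⟩

section EntropyBalancing

variable {Ω : Type*} [MeasurableSpace Ω] {P : Measure Ω} {p K : ℕ}
  {X : ℕ → Ω → EuclideanSpace ℝ (Fin p)} {T : ℕ → Ω → Bool} {Y : ℕ → Ω → Bool → ℝ}
  {f : ℝ → ℝ} {Φ : EuclideanSpace ℝ (Fin p) → EuclideanSpace ℝ (Fin K)}
  {W R : Matrix (Fin K) (Fin K) ℝ} {δ : ℕ → ℝ} {Θ : Set (EuclideanSpace ℝ (Fin K))}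
  {θhat : Bool → (n : ℕ) → (Fin n → EuclideanSpace ℝ (Fin p)) → (Fin n → Bool) →
      EuclideanSpace ℝ (Fin K)}

/-- The imbalance of the normalized weights, in terms of the gradient of the unpenalized dual
objective. -/
lemma imbalance_sampleWeight {X₀ : Ω → EuclideanSpace ℝ (Fin p)} (hR : R.transpose * R = W)
    (t : Bool) (n : ℕ) (ω : Ω) :
    imbalance Φ W (fun i : Fin n => X i ω) (fun i : Fin n => T i ω) t
      (sampleWeight X T f Φ R θhat n ω) =
    (‖∑ i : Fin n, if T i ω = t then sampleRawWeight X T f Φ R θhat n ω i •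
        recentered (obs X T Y) (feature P X₀ Φ R) n ω i else 0‖ /
      armSum (fun i : Fin n => T i ω) t (sampleRawWeight X T f Φ R θhat n ω)) ^ 2 := by
  set S := armSum (fun i : Fin n => T i ω) t (sampleRawWeight X T f Φ R θhat n ω) with hS
  rw [imbalance, score_self_eq_norm_sq hR, ← sq_abs (_ / S), abs_div, abs_norm,
    ← Real.norm_eq_abs S, div_eq_inv_mul, ← norm_inv, ← norm_smul, Finset.smul_sum, map_sum]
  congr 2
  refine Finset.sum_congr rfl fun i _ => ?_
  by_cases h : T i ω = t
  · simp only [h, if_true]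
    rw [map_smul, toEuclideanLin_sub_basisMean (T := T) (Y := Y) (P := P) (X₀ := X₀),
      sampleWeight_eq h, smul_smul, div_eq_inv_mul]
  · simp [h]

/-- For the entropy loss the dual solution approaches the population minimizer, so that the weights
are within constant factors of the population weights `exp(θ₀ᵀ V)`; this controls the squared norm
of the normalized weights. The first order condition of the dual problem controls their imbalance. -/
theorem armEstimator_of_entropy [IsProbabilityMeasure P] (hsample : IsIIDSample P X T Y)
    (hΦ : Measurable Φ) (hW : W.PosDef) (hR : R.transpose * R = W)
    (hθ : ∀ n, IsDualSolver f Φ R (δ n) (fun t => θhat t n))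
    (hign : StrongIgnorability P (X 0) (T 0) (Y 0))
    (hreg : Regularity P (X 0) (T 0) (Y 0) f Φ R δ Θ) {t : Bool}
    (hlin : LinearOutcome P (X 0) (Y 0) Φ t) (hE : IsEntropy f) :
    BddP P (fun n ω => √n * (armEstimator X T Y f Φ R θhat t n ω - armMean P (Y 0) t)) := by
  have hX := hsample.measurable_X 0
  have hT := hsample.measurable_T 0
  have hY := hsample.measurable_Y 0
  have hf := hreg.strictConvexOn
  have hC := hreg.contDiffOn
  have hind := hsample.iIndepFun_obs
  have hid := hsample.identDistrib_obs
  have hD0 := hsample.measurable_obs 0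
  obtain ⟨η, hη, hov⟩ := exists_le_propensity hX hT hreg.strict_overlap
  obtain ⟨θ₀, r, hr, hball, hfoc⟩ := hreg.exists_entropy_minimizer hE hX hT hY hΦ t
  set D := obs X T Y with hD
  set V := feature P (X 0) Φ R with hVdef
  have hV : Measurable V := measurable_feature hΦ
  have hV2 : MemLp (fun ω => V (D 0 ω)) 2 P := memLp_feature hreg.basis_memLp
  have hV0 : ∫ ω, V (D 0 ω) ∂P = 0 := integral_feature hreg.basis_memLp
  have harm : MeasurableSet {z : EuclideanSpace ℝ (Fin p) × Bool × (Bool → ℝ) | z.2.1 = t} :=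
    (measurable_fst.comp measurable_snd) (measurableSet_singleton t)
  have hsm : Measurable fun z : EuclideanSpace ℝ (Fin p) × Bool × (Bool → ℝ) =>
    Real.exp (inner ℝ θ₀ (V z)) := (measurable_const.inner hV).exp
  -- The population weights of the arm.
  set a : EuclideanSpace ℝ (Fin p) × Bool × (Bool → ℝ) → ℝ :=
    fun z => if z.2.1 = t then Real.exp (inner ℝ θ₀ (V z)) else 0 with ha
  have ham : Measurable a := Measurable.ite harm hsm measurable_const
  have ha0 : ∀ z, 0 ≤ a z := fun z => by
    simp only [ha]; split_ifs; exacts [(Real.exp_pos _).le, le_rfl]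
  have hale : ∀ z, a z ≤ Real.exp (inner ℝ θ₀ (V z)) := fun z => by
    simp only [ha]; split_ifs; exacts [le_rfl, (Real.exp_pos _).le]
  have hat : ∀ z, z.2.1 = t → 0 < a z := fun z hz => by
    simp only [ha, hz, if_true]; exact Real.exp_pos _
  have hmom : ∀ b ∈ ({1, 2, 3} : Set ℝ), ∀ θ ∈ Metric.closedBall θ₀ r,
      Integrable (fun ω => Real.exp (b * inner ℝ θ (V (D 0 ω)))) P :=
    fun b hb θ hθ => hreg.integrable_exp_inner_feature hb (hball hθ)
  have hsq : ∀ z, a z ^ 2 ≤ Real.exp (2 * inner ℝ θ₀ (V z)) := fun z => by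
    rw [two_mul, Real.exp_add, ← pow_two]
    exact pow_le_pow_left₀ (ha0 z) (hale z) 2
  have hcen := Metric.mem_closedBall_self (x := θ₀) hr.le
  have haint : Integrable (fun ω => a (D 0 ω)) P :=
    (hmom 1 (by simp) θ₀ hcen).mono' (ham.comp hD0).aestronglyMeasurable
      (ae_of_all _ fun ω => by
        rw [one_mul, Real.norm_of_nonneg (ha0 _)]; exact hale _)
  have hasq : Integrable (fun ω => a (D 0 ω) ^ 2) P :=
    (hmom 2 (by simp) θ₀ hcen).mono' ((ham.pow_const 2).comp hD0).aestronglyMeasurable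
      (ae_of_all _ fun ω => by rw [Real.norm_of_nonneg (sq_nonneg _)]; exact hsq _)
  have hVD : Measurable fun ω => V (D 0 ω) := hV.comp hD0
  have haV : Integrable (fun ω => a (D 0 ω) * ‖V (D 0 ω)‖ ^ 2) P := by
    refine (integrable_exp_mul_norm_sq hVD hr one_pos (hmom 1 (by simp))).mono'
      ((ham.mul (hV.norm.pow_const 2)).comp hD0).aestronglyMeasurable (ae_of_all _ fun ω => ?_)
    rw [one_mul, Real.norm_of_nonneg (mul_nonneg (ha0 _) (by positivity))]
    exact mul_le_mul_of_nonneg_right (hale _) (by positivity)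
  have hpos : 0 < ∫ ω, a (D 0 ω) ∂P := by
    rw [integral_pos_iff_support_of_nonneg (fun ω => ha0 _) haint]
    refine (measure_arm_pos hη hX hT (hov t)).trans_le (measure_mono fun ω hω => ?_)
    exact (hat (D 0 ω) hω).ne'
  have hd : ∀ ε : ℝ, 0 < ε → WHP P (fun n ω => ‖sampleMean D V n ω‖ ≤ ε) := by
    intro ε hε
    simpa only [hV0, sub_zero] using
      whp_sampleMean hind hid hV (hV2.integrable one_le_two) hε
  have hθd : WHP P (fun n ω => |inner ℝ θ₀ (sampleMean D V n ω)| ≤ 1) := by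
    refine (hd (1 / (‖θ₀‖ + 1)) (by positivity)).mono (Eventually.of_forall fun n ω h => ?_)
    refine (abs_real_inner_le_norm _ _).trans ?_
    calc ‖θ₀‖ * ‖sampleMean D V n ω‖ ≤ (‖θ₀‖ + 1) * (1 / (‖θ₀‖ + 1)) := by
          gcongr
          linarith
      _ = 1 := by field_simp
  have hre : ∀ (θ : EuclideanSpace ℝ (Fin K)) (n : ℕ) (ω : Ω) (i : Fin n),
      inner ℝ θ (recentered D V n ω i) =
        inner ℝ θ (V (D i ω)) - inner ℝ θ (sampleMean D V n ω) := fun θ n ω i => by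
    rw [recentered, inner_sub_right]
  have hst : WHP P (fun n ω => ∀ i : Fin n, (D i ω).2.1 = t →
      HasStrongTangent f (inner ℝ θ₀ (recentered D V n ω i)) 1
        (Real.exp (-2) / 4 * a (D i ω))) := by
    refine hθd.mono (Eventually.of_forall fun n ω h i hi => ?_)
    refine (hE.hasStrongTangent hf hC _).mono ?_
    have h1 : a (D i ω) = Real.exp (inner ℝ θ₀ (V (D i ω))) := by simp only [ha, hi, if_true]
    rw [h1, hre, div_mul_eq_mul_div, ← Real.exp_add]
    refine div_le_div_of_nonneg_right (Real.exp_le_exp.2 ?_) (by norm_num)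
    linarith [(abs_le.1 h).2]
  have hgrad : BddP P (fun n ω => √n * ‖sampleGrad f D V (fun z => z.2.1) t θ₀ n ω‖) := by
    set G : EuclideanSpace ℝ (Fin p) × Bool × (Bool → ℝ) → EuclideanSpace ℝ (Fin K) :=
      fun z => a z • V z with hG
    have hGm : Measurable G := ham.smul hV
    have hG2 : MemLp (fun ω => G (D 0 ω)) 2 P := by
      refine (memLp_two_iff_integrable_sq_norm (hGm.comp hD0).aestronglyMeasurable).2 ?_
      refine (integrable_exp_mul_norm_sq hVD hr two_pos (hmom 2 (by simp))).mono'
        ((hGm.norm.pow_const 2).comp hD0).aestronglyMeasurable (ae_of_all _ fun ω => ?_)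
      rw [Real.norm_of_nonneg (by positivity)]
      simp only [hG, Function.comp_apply]
      rw [norm_smul, mul_pow, Real.norm_of_nonneg (ha0 _)]
      exact mul_le_mul_of_nonneg_right (hsq _) (by positivity)
    have hGz : ∫ ω, G (D 0 ω) ∂P = 0 := by
      rw [← hfoc]
      refine integral_congr_ae (ae_of_all _ fun ω => ?_)
      have h1 : (D 0 ω).2.1 = T 0 ω := rfl
      by_cases h : T 0 ω = t <;> simp [hG, ha, h1, h]
    have hGB := bddP_sqrt_mul_norm_sampleMean hind hid hGm hG2 hGz
    have hdB : BddP P (fun n ω => √n * ‖sampleMean D V n ω‖) :=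
      bddP_sqrt_mul_norm_sampleMean hind hid hV hV2 hV0
    have haB : BddP P (fun n ω => sampleMean D a n ω) := bddP_sampleMean hind hid ham haint
    refine (hGB.abs_add_abs (haB.mul hdB)).of_whp_le (hθd.mono ?_)
    filter_upwards with n ω h
    set d := sampleMean D V n ω with hdd
    have h1 : sampleGrad f D V (fun z => z.2.1) t θ₀ n ω =
        Real.exp (-inner ℝ θ₀ d - 1) • (sampleMean D G n ω - sampleMean D a n ω • d) := by
      have e1 : ∀ i : Fin n, (if (D i ω).2.1 = t then
          conjDeriv f (inner ℝ θ₀ (recentered D V n ω i)) • recentered D V n ω i else 0) =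
          Real.exp (-inner ℝ θ₀ d - 1) • (G (D i ω) - a (D i ω) • d) := by
        intro i
        by_cases hi : (D i ω).2.1 = t
        · simp only [hi, if_true, hG, ha]
          rw [← smul_sub, hE.conjDeriv_eq hf hC, hre, smul_smul, ← Real.exp_add, recentered]
          congr 2
          ring
        · simp [hi, hG, ha]
      simp only [sampleGrad, e1]
      rw [← Finset.smul_sum, Finset.sum_sub_distrib, ← Finset.sum_smul, smul_comm, smul_sub,
        smul_smul, sampleMean, sampleMean, smul_eq_mul]
    have h2 : Real.exp (-inner ℝ θ₀ d - 1) ≤ 1 :=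
      Real.exp_le_one_iff.2 (by linarith [(abs_le.1 h).1])
    rw [abs_of_nonneg (by positivity), h1, norm_smul, Real.norm_of_nonneg (Real.exp_pos _).le]
    have h3 := norm_sub_le (sampleMean D G n ω) (sampleMean D a n ω • d)
    rw [norm_smul, Real.norm_eq_abs] at h3
    refine le_trans ?_ (le_abs_self _)
    rw [abs_of_nonneg (a := √n * _) (by positivity), abs_mul,
      abs_of_nonneg (a := √n * _) (by positivity)]
    calc √n * (Real.exp (-inner ℝ θ₀ d - 1) * ‖sampleMean D G n ω - sampleMean D a n ω • d‖)
        ≤ √n * (1 * (‖sampleMean D G n ω‖ + |sampleMean D a n ω| * ‖d‖)) := by gcongr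
      _ = _ := by ring
  obtain ⟨hminW, -, hmax⟩ := dual_localization hind hid hV hV2 hV0 (s := fun z => z.2.1) (t := t)
    ham ha0 (fun z hz => by simp only [ha]; exact if_neg hz) haint haV
    (fun h hh => integral_mul_inner_feature_sq_pos (hreg.unique_min t) hD0.aemeasurable hΦ ham ha0
      hat haV hh)
    hreg.delta_isLittleO (by positivity) one_pos hst hgrad
    (θhat := fun n ω => θhat t n (fun i => X i ω) (fun i => T i ω))
    (fun n ω h => isMinOn_samplePenObj hθ t n ω h)
  set θn : ℕ → Ω → EuclideanSpace ℝ (Fin K) :=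
    fun n ω => θhat t n (fun i => X i ω) (fun i => T i ω) with hθn
  have hraw : ∀ n ω (i : Fin n), T i ω = t → sampleRawWeight X T f Φ R θhat n ω i =
      Real.exp (inner ℝ (θn n ω) (recentered D V n ω i) - 1) := fun n ω i hi => by
    rw [sampleRawWeight_eq (Y := Y) (P := P) (X₀ := X 0) hi, hE.conjDeriv_eq hf hC]
  -- The weights are within constant factors of the population weights.
  have hcomp : WHP P (fun n ω => ∀ i : Fin n, T i ω = t →
      Real.exp (-4) * a (D i ω) ≤ sampleRawWeight X T f Φ R θhat n ω i ∧
      sampleRawWeight X T f Φ R θhat n ω i ≤ Real.exp 2 * a (D i ω)) := by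
    refine ((hmax 1 one_pos).and hθd).mono ?_
    filter_upwards [eventually_gt_atTop 0] with n hn ω ⟨hm, hθ₀d⟩ i hi
    have hn' : (0 : ℝ) < n := by exact_mod_cast hn
    have h1 : a (D i ω) = Real.exp (inner ℝ θ₀ (V (D i ω))) := by
      have : (D i ω).2.1 = t := hi
      simp only [ha, this, if_true]
    have h2 : |inner ℝ (θn n ω - θ₀) (sampleMean D V n ω)| ≤ 1 := by
      rw [sampleMean, inner_smul_right, inner_sum, abs_mul, abs_of_pos (inv_pos.2 hn'),
        inv_mul_le_iff₀ hn']
      refine (Finset.abs_sum_le_sum_abs _ _).trans ((Finset.sum_le_sum fun i _ => hm i).trans ?_)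
      simp
    have h3 := hm i
    rw [inner_sub_left] at h2 h3
    rw [hraw n ω i hi, h1, hre, ← Real.exp_add, ← Real.exp_add, Real.exp_le_exp, Real.exp_le_exp]
    rw [abs_le] at h2 h3 hθ₀d
    constructor <;> linarith
  set c' := Real.exp (-4) * ((∫ ω, a (D 0 ω) ∂P) / 2) with hc'
  have hc0 : 0 < c' := by positivity
  have hS : WHP P (fun n ω => n * c' ≤ armSum (fun i : Fin n => T i ω) t
      (sampleRawWeight X T f Φ R θhat n ω)) := by
    refine (hcomp.and (whp_sampleMean hind hid ham haint
      (ε := (∫ ω, a (D 0 ω) ∂P) / 2) (by positivity))).mono ?_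
    filter_upwards [eventually_gt_atTop 0] with n hn ω ⟨hw, hmean⟩
    have h1 : (∫ ω, a (D 0 ω) ∂P) / 2 ≤ sampleMean D a n ω := by
      rw [Real.norm_eq_abs] at hmean
      linarith [(abs_le.1 hmean).1]
    calc (n : ℝ) * c' = Real.exp (-4) * (n * ((∫ ω, a (D 0 ω) ∂P) / 2)) := by rw [hc']; ring
      _ ≤ Real.exp (-4) * (n * sampleMean D a n ω) := by gcongr
      _ = ∑ i : Fin n, Real.exp (-4) * a (D i ω) := by rw [mul_sampleMean hn, Finset.mul_sum]
      _ ≤ _ := by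
        refine Finset.sum_le_sum fun i _ => ?_
        by_cases h : T i ω = t
        · simpa only [h, if_true] using (hw i h).1
        · have h' : (D i ω).2.1 ≠ t := h
          simp [h, ha, h']
  refine armEstimator_of_linearOutcome hsample hΦ hW hR hθ hign hreg hlin ?_ ?_ ?_
  · refine hS.mono ?_
    filter_upwards [eventually_gt_atTop 0] with n hn ω h
    have hn' : (0 : ℝ) < n := by exact_mod_cast hn
    exact lt_of_lt_of_le (by positivity) h
  · have hB := bddP_sampleMean hind hid (ham.pow_const 2) hasq
    refine (hB.mul (BddP.const (Real.exp 2 ^ 2 / c' ^ 2))).of_whp_le ((hS.and hcomp).mono ?_)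
    filter_upwards [eventually_gt_atTop 0] with n hn ω ⟨hSn, hw⟩
    have hn' : (0 : ℝ) < n := by exact_mod_cast hn
    set S := armSum (fun i : Fin n => T i ω) t (sampleRawWeight X T f Φ R θhat n ω) with hSdef
    have hSpos : 0 < S := lt_of_lt_of_le (by positivity) hSn
    have h1 : armSum (fun i : Fin n => T i ω) t
        (fun i => sampleWeight X T f Φ R θhat n ω i ^ 2) ≤
        Real.exp 2 ^ 2 / S ^ 2 * (n * sampleMean D (fun z => a z ^ 2) n ω) := by
      rw [mul_sampleMean hn, Finset.mul_sum]
      refine Finset.sum_le_sum fun i _ => ?_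
      by_cases h : T i ω = t
      · simp only [h, if_true]
        rw [sampleWeight_eq h, div_pow, div_mul_eq_mul_div, ← mul_pow]
        refine div_le_div_of_nonneg_right ?_ (by positivity)
        refine pow_le_pow_left₀ ?_ (hw i h).2 2
        rw [hraw n ω i h]; positivity
      · simp only [h, if_false]; positivity
    have h0 : 0 ≤ sampleMean D (fun z => a z ^ 2) n ω :=
      smul_nonneg (by positivity) (Finset.sum_nonneg fun i _ => sq_nonneg _)
    have h2 : 0 ≤ armSum (fun i : Fin n => T i ω) t
        (fun i => sampleWeight X T f Φ R θhat n ω i ^ 2) :=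
      Finset.sum_nonneg fun i _ => by split_ifs <;> positivity
    rw [abs_of_nonneg (by positivity)]
    refine le_trans ?_ (le_abs_self _)
    have h3 : n * n / S ^ 2 ≤ 1 / c' ^ 2 := by
      rw [div_le_div_iff₀ (by positivity) (by positivity), one_mul]
      calc (n : ℝ) * n * c' ^ 2 = (n * c') ^ 2 := by ring
        _ ≤ S ^ 2 := pow_le_pow_left₀ (by positivity) hSn 2
    calc n * armSum (fun i : Fin n => T i ω) t
          (fun i => sampleWeight X T f Φ R θhat n ω i ^ 2)
        ≤ n * (Real.exp 2 ^ 2 / S ^ 2 * (n * sampleMean D (fun z => a z ^ 2) n ω)) := by gcongr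
      _ = sampleMean D (fun z => a z ^ 2) n ω * Real.exp 2 ^ 2 * (n * n / S ^ 2) := by
        field_simp
      _ ≤ sampleMean D (fun z => a z ^ 2) n ω * Real.exp 2 ^ 2 * (1 / c' ^ 2) := by gcongr
      _ = _ := by ring
  · refine (BddP.const (1 / c' ^ 2)).of_whp_le ((hS.and hminW).mono ?_)
    filter_upwards [eventually_gt_atTop 0, hreg.delta_isLittleO.bound one_pos] with n hn hδ ω
      ⟨hSn, hmin⟩
    have hn' : (0 : ℝ) < n := by exact_mod_cast hn
    have hfocn := norm_sum_exp_smul_le_of_isMinOn (hE.conj_eq hf hC) hmin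
    have hδn : √(δ n) ≤ √n :=
      Real.sqrt_le_sqrt ((le_abs_self _).trans (by simpa using hδ))
    have hsum : (∑ i : Fin n, if T i ω = t then sampleRawWeight X T f Φ R θhat n ω i •
        recentered D V n ω i else 0) = ∑ i : Fin n, if (D i ω).2.1 = t then
          Real.exp (inner ℝ (θn n ω) (recentered D V n ω i) - 1) • recentered D V n ω i else 0 := by
      refine Finset.sum_congr rfl fun i _ => ?_
      have h1 : (D i ω).2.1 = T i ω := rfl
      rw [h1]
      by_cases h : T i ω = t
      · rw [if_pos h, if_pos h, hraw n ω i h]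
      · rw [if_neg h, if_neg h]
    rw [imbalance_sampleWeight (Y := Y) (P := P) (X₀ := X 0) hR, hsum]
    set N := ‖∑ i : Fin n, if (D i ω).2.1 = t then
          Real.exp (inner ℝ (θn n ω) (recentered D V n ω i) - 1) • recentered D V n ω i else 0‖
    set S := armSum (fun i : Fin n => T i ω) t (sampleRawWeight X T f Φ R θhat n ω) with hSdef
    have hSpos : 0 < S := lt_of_lt_of_le (by positivity) hSn
    have hN0 : 0 ≤ N := norm_nonneg _
    have hN : N ^ 2 ≤ n := by
      rw [← Real.sq_sqrt hn'.le]
      exact pow_le_pow_left₀ hN0 (hfocn.trans hδn) 2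
    rw [abs_of_nonneg (by positivity), abs_of_nonneg (by positivity), div_pow, ← mul_div_assoc,
      div_le_div_iff₀ (by positivity) (by positivity), one_mul]
    calc (n : ℝ) * N ^ 2 * c' ^ 2 ≤ n * n * c' ^ 2 := by gcongr
      _ = (n * c') ^ 2 := by ring
      _ ≤ S ^ 2 := pow_le_pow_left₀ (by positivity) hSn 2

end EntropyBalancing

/-! ### The average treatment effect -/

section AverageEffect

variable {Ω : Type*} [MeasurableSpace Ω] {P : Measure Ω} {p K : ℕ}
  {X : ℕ → Ω → EuclideanSpace ℝ (Fin p)} {T : ℕ → Ω → Bool} {Y : ℕ → Ω → Bool → ℝ}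
  {f : ℝ → ℝ} {Φ : EuclideanSpace ℝ (Fin p) → EuclideanSpace ℝ (Fin K)}
  {W R : Matrix (Fin K) (Fin K) ℝ} {δ : ℕ → ℝ} {Θ : Set (EuclideanSpace ℝ (Fin K))}
  {θhat : Bool → (n : ℕ) → (Fin n → EuclideanSpace ℝ (Fin p)) → (Fin n → Bool) →
      EuclideanSpace ℝ (Fin K)}

lemma bddP_ateEstimator [IsProbabilityMeasure P]
    (hY : ∀ t, MemLp (fun ω => Y 0 ω t) 2 P)
    (h : ∀ t, BddP P (fun n ω => √n *
      (armEstimator X T Y f Φ R θhat t n ω - armMean P (Y 0) t))) :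
    BddP P (fun n ω => √n * (ateEstimator X T Y f Φ R θhat n ω - ate P (Y 0))) := by
  refine ((h true).add ((h false).mul (BddP.const (-1)))).of_le fun n ω => le_of_eq ?_
  congr 1
  rw [ateEstimator, ate, integral_sub ((hY true).integrable one_le_two)
    ((hY false).integrable one_le_two), armMean, armMean]
  ring

/-- Under the stability and imbalance conditions the weights satisfy the hypotheses of
`armEstimator_of_linearOutcome`. -/
theorem StableWeights.armEstimator [IsProbabilityMeasure P] (hsample : IsIIDSample P X T Y)
    (hΦ : Measurable Φ) (hW : W.PosDef) (hR : R.transpose * R = W)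
    (hθ : ∀ n, IsDualSolver f Φ R (δ n) (fun t => θhat t n))
    (hign : StrongIgnorability P (X 0) (T 0) (Y 0))
    (hreg : Regularity P (X 0) (T 0) (Y 0) f Φ R δ Θ) {t : Bool}
    (hlin : LinearOutcome P (X 0) (Y 0) Φ t) (hst : StableWeights P X T f Φ W R θhat) :
    BddP P (fun n ω => √n * (armEstimator X T Y f Φ R θhat t n ω - armMean P (Y 0) t)) := by
  refine armEstimator_of_linearOutcome hsample hΦ hW hR hθ hign hreg hlin ?_ ?_
    (isBigOP_inv_iff.1 (hst.imbalance t))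
  · simpa only [WHP, not_lt] using hst.pos t
  · refine (isBigOP_inv_iff.1 hst.square).of_le fun n ω => ?_
    have h0 : 0 ≤ armSum (fun i : Fin n => T i ω) t
        (fun i => sampleWeight X T f Φ R θhat n ω i ^ 2) :=
      Finset.sum_nonneg fun i _ => by split_ifs <;> positivity
    rw [abs_of_nonneg (by positivity), abs_of_nonneg (by positivity)]
    refine mul_le_mul_of_nonneg_left (Finset.sum_le_sum fun i _ => ?_) (Nat.cast_nonneg n)
    split_ifs
    · exact le_rfl
    · positivity

end AverageEffect

end MahalanobisBalancing

open MahalanobisBalancing in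
theorem theorem2 {Ω : Type*} [MeasurableSpace Ω] (P : Measure Ω) [IsProbabilityMeasure P]
    {p K : ℕ}
    -- the i.i.d. sample of covariates, treatments and potential outcomes
    (X : ℕ → Ω → EuclideanSpace ℝ (Fin p)) (T : ℕ → Ω → Bool) (Y : ℕ → Ω → Bool → ℝ)
    (hsample : IsIIDSample P X T Y)
    -- the loss, the basis functions, the weight matrix `W = Rᵀ R` and the thresholds
    (f : ℝ → ℝ) (Φ : EuclideanSpace ℝ (Fin p) → EuclideanSpace ℝ (Fin K)) (hΦ : Measurable Φ)
    (W R : Matrix (Fin K) (Fin K) ℝ) (hW : W.PosDef) (hR : R.transpose * R = W)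
    (δ : ℕ → ℝ) (Θ : Set (EuclideanSpace ℝ (Fin K)))
    -- the solutions of the dual problems of the two arms
    (θhat : Bool → (n : ℕ) → (Fin n → EuclideanSpace ℝ (Fin p)) → (Fin n → Bool) →
      EuclideanSpace ℝ (Fin K))
    (hθ : ∀ n, IsDualSolver f Φ R (δ n) (fun t => θhat t n))
    (hign : StrongIgnorability P (X 0) (T 0) (Y 0))
    (hover : Overlap P (X 0) (T 0))
    (hreg : Regularity P (X 0) (T 0) (Y 0) f Φ R δ Θ) :
    -- (i)
    ((∀ x : ℝ, 0 < x → 0 < deriv (deriv f) x) →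
      (∀ t, InversePropensityForm P (X 0) (T 0) f Φ R t →
        IsBigOP P (fun n ω => armEstimator X T Y f Φ R θhat t n ω - armMean P (Y 0) t)
          (fun n => (n : ℝ) ^ (-(1 / 2) : ℝ))) ∧
      ((∀ t, InversePropensityForm P (X 0) (T 0) f Φ R t) →
        IsBigOP P (fun n ω => ateEstimator X T Y f Φ R θhat n ω - ate P (Y 0))
          (fun n => (n : ℝ) ^ (-(1 / 2) : ℝ)))) ∧
    -- (ii)
    ((∀ t, LinearOutcome P (X 0) (Y 0) Φ t) →
      (IsEntropy f ∨ StableWeights P X T f Φ W R θhat) →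
        IsBigOP P (fun n ω => ateEstimator X T Y f Φ R θhat n ω - ate P (Y 0))
          (fun n => (n : ℝ) ^ (-(1 / 2) : ℝ))) := by
  refine ⟨fun hf2 => ⟨fun t hform => ?_, fun hform => ?_⟩, fun hlin h => ?_⟩
  · exact isBigOP_rpow_iff.2
      (armEstimator_of_inversePropensityForm hsample hΦ hθ hign hreg hf2 hform)
  · exact isBigOP_rpow_iff.2 (bddP_ateEstimator hreg.outcome_memLp fun t =>
      armEstimator_of_inversePropensityForm hsample hΦ hθ hign hreg hf2 (hform t))
  · refine isBigOP_rpow_iff.2 (bddP_ateEstimator hreg.outcome_memLp fun t => ?_)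
    rcases h with hE | hst
    · exact armEstimator_of_entropy hsample hΦ hW hR hθ hign hreg (hlin t) hE
    · exact hst.armEstimator hsample hΦ hW hR hθ hign hreg (hlin t)
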